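/- Let $G$ be a compact quantum group, that is, a Hopf $*$-algebra $(\mathbb C[G],\Delta)$ generated as an algebra by the matrix coefficients of finite dimensional unitary representations of $G$, i.e. of unitaries $U\in B(H_U)\otimes\mathbb C[G]$ with $H_U$ a finite dimensional Hilbert space and $(\iota\otimes\Delta)(U)=U_{12}U_{13}$. Let $h$ be its Haar state, $L^2(G)$ the corresponding GNS space, and $C(G)\subset B(L^2(G))$ the norm closure of $\mathbb C[G]$ acting by left multiplication. Let $\mathcal H=(H_n)_{n\ge0}$ be a $G$-equivariant subproduct system of finite dimensional Hilbert spaces: $\dim H_0=1$, there are isometries $w_{k,l}\colon H_{k+l}\to H_k\otimes H_l$ with $(w_{k,l}\otimes1)w_{k+l,n}=(1\otimes w_{l,n})w_{k,l+n}$ for all $k,l,n\ge0$, and there are unitary representations $U_n$ of $G$ on $H_n$ such that every $w_{k,l}$ intertwines $U_{k+l}$ with the tensor product representation $(U_k)_{13}(U_l)_{23}$. Let $\mathcal F_{\mathcal H}=\bigoplus_{n\ge0}H_n$ be the Fock space (Hilbert space direct sum), and for $\xi\in H_1$ let $S_\xi$ be the operator on $\mathcal F_{\mathcal H}$ with $S_\xi\zeta=w_{1,n}^*(\xi\otimes\zeta)$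 for $\zeta\in H_n$. Let $\mathcal T_{\mathcal H}$ be the unital C$^*$-algebra generated by the operators $S_\xi$, let $\mathcal O_{\mathcal H}=\mathcal T_{\mathcal H}/\mathcal K(\mathcal F_{\mathcal H})$ be the Cuntz--Pimsner algebra, where $\mathcal K(\mathcal F_{\mathcal H})$ denotes the compact operators, let $q\colon\mathcal T_{\mathcal H}\to\mathcal O_{\mathcal H}$ be the quotient map, and put $s_\xi=q(S_\xi)$. Put $U_{\mathcal H}=\bigoplus_n U_n$, a unitary operator on $\mathcal F_{\mathcal H}\otimes L^2(G)$. Assume that (i) the $G$-modules $H_n$, $n\ge0$, are simple and pairwise nonisomorphic; (ii) $\mathcal O_{\mathcal H}$ admits normal ordering, i.e. the elements $s_{\xi_1}\cdots s_{\xi_n}s_{\zeta_1}^*\cdots s_{\zeta_m}^*$ ($n,m\ge0$, $\xi_i,\zeta_j\in H_1$) span a dense subspace of $\mathcal O_{\mathcal H}$. Then the formula $\alpha(q(T))=(q\otimes\iota)\big(U_{\mathcal H}(T\otimes1)U_{\mathcal H}^*\big)$, $T\in\mathcal T_{\mathcal H}$, defines a unique unital $*$-homomorphism $\alpha\colon\mathcal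 O_{\mathcal H}\to\mathcal O_{\mathcal H}\otimes C(G)$ (minimal tensor product), the action of $G$ on $\mathcal O_{\mathcal H}$, and this action is ergodic: $\mathcal O_{\mathcal H}^G=\{a\in\mathcal O_{\mathcal H}:\alpha(a)=a\otimes1\}=\mathbb C1$. -/

import Mathlib

namespace CQG

open scoped TensorProduct ComplexOrder InnerProductSpace ENNReal
open UniformSpace

noncomputable section

/-! ### Quotient C*-algebras -/

section Quotient

set_option linter.unusedSectionVars false

variable {T : Type*} [CStarAlgebra T] (I : Ideal T) [I.IsTwoSided]

/-- If `I` is a closed star-closed two-sided ideal, the quotient norm satisfies the C*-inequality. -/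
theorem quotient_cstar_ineq (hcl : IsClosed (I : Set T)) (hstar : ∀ a ∈ I, star a ∈ I) (a : T) :
    ‖(Submodule.Quotient.mk a : T ⧸ I)‖ * ‖(Submodule.Quotient.mk a : T ⧸ I)‖ ≤
      ‖(Submodule.Quotient.mk (star a * a) : T ⧸ I)‖ := by
  let J : NonUnitalStarSubalgebra ℂ T :=
    { carrier := I
      add_mem' := I.add_mem
      zero_mem' := I.zero_mem
      mul_mem' := fun {x y} _ hy => I.mul_mem_left x hy
      smul_mem' := fun c x hx => by
        have := I.mul_mem_left (algebraMap ℂ T c) hx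
        rwa [← Algebra.smul_def] at this
      star_mem' := fun {x} hx => hstar x hx }
  have : IsClosed (J : Set T) := hcl
  let _ : PartialOrder J := CStarAlgebra.spectralOrder J
  have : StarOrderedRing J := CStarAlgebra.spectralOrderedRing J
  let _ : PartialOrder T := CStarAlgebra.spectralOrder T
  have : StarOrderedRing T := CStarAlgebra.spectralOrderedRing T
  have hl := CStarAlgebra.increasingApproximateUnit J
  -- `‖b (1 - e)‖` is asymptotically at most the quotient norm
  have key : ∀ b : T, ∀ ε > 0, ∀ᶠ e : J in CStarAlgebra.approximateUnit J,
      ‖b * (1 - (e : T))‖ ≤ ‖(Submodule.Quotient.mk b : T ⧸ I)‖ + ε := by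
    intro b ε hε
    obtain ⟨m, hm, hmn⟩ := Submodule.Quotient.norm_mk_lt
      (Submodule.Quotient.mk b : T ⧸ I) (half_pos hε)
    have hi : b - m ∈ I := (Submodule.Quotient.eq I).1 hm.symm
    let i : J := ⟨b - m, hi⟩
    have ht := hl.tendsto_mul_left i
    have ht' := (tendsto_iff_norm_sub_tendsto_zero.1 ht).eventually (gt_mem_nhds (half_pos hε))
    filter_upwards [ht', hl.eventually_nonneg, hl.eventually_norm] with e he h0 h1
    have h0' : (0 : T) ≤ (e : T) := by
      obtain ⟨x, hx⟩ := CStarAlgebra.nonneg_iff_eq_star_mul_self.1 h0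
      rw [hx]
      exact star_mul_self_nonneg (x : T)
    have h1' : ‖(1 : T) - (e : T)‖ ≤ 1 := by
      have hh : (e : T) ∈ Set.Icc (0 : T) 1 := CStarAlgebra.mem_Icc_iff_norm_le_one.2 ⟨h0', h1⟩
      exact (CStarAlgebra.mem_Icc_iff_norm_le_one.1 (Set.sub_mem_Icc_zero_iff_right.2 hh)).2
    have e1 : b * (1 - (e : T)) = m * (1 - (e : T)) - ((i * e - i : J) : T) := by
      simp only [i]
      push_cast
      noncomm_ring
    have h2 : ‖m * (1 - (e : T))‖ ≤ ‖m‖ :=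
      (norm_mul_le _ _).trans (mul_le_of_le_one_right (norm_nonneg _) h1')
    have h3 : ‖((i * e - i : J) : T)‖ < ε / 2 := he
    rw [e1]
    refine (norm_sub_le _ _).trans ?_
    linarith
  -- and at least the quotient norm
  have low : ∀ b : T, ∀ e : J, ‖(Submodule.Quotient.mk b : T ⧸ I)‖ ≤ ‖b * (1 - (e : T))‖ := by
    intro b e
    have : (Submodule.Quotient.mk b : T ⧸ I) = Submodule.Quotient.mk (b * (1 - (e : T))) := by
      rw [Submodule.Quotient.eq]
      have : b - b * (1 - (e : T)) = b * e := by noncomm_ring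
      rw [this]
      exact I.mul_mem_left b e.2
    rw [this]
    exact Submodule.Quotient.norm_mk_le (S := I) _
  refine le_of_forall_pos_le_add fun ε hε => ?_
  obtain ⟨e, he, h0, h1⟩ :=
    ((key (star a * a) ε hε).and (hl.eventually_nonneg.and hl.eventually_norm)).exists
  have h0' : (0 : T) ≤ (e : T) := by
    obtain ⟨x, hx⟩ := CStarAlgebra.nonneg_iff_eq_star_mul_self.1 h0
    rw [hx]
    exact star_mul_self_nonneg (x : T)
  have h1' : ‖(1 : T) - (e : T)‖ ≤ 1 := by
    have hh : (e : T) ∈ Set.Icc (0 : T) 1 := CStarAlgebra.mem_Icc_iff_norm_le_one.2 ⟨h0', h1⟩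
    exact (CStarAlgebra.mem_Icc_iff_norm_le_one.1 (Set.sub_mem_Icc_zero_iff_right.2 hh)).2
  calc _ ≤ ‖a * (1 - (e : T))‖ * ‖a * (1 - (e : T))‖ :=
        mul_self_le_mul_self (norm_nonneg _) (low a e)
    _ = ‖star (a * (1 - (e : T))) * (a * (1 - (e : T)))‖ := CStarRing.norm_star_mul_self.symm
    _ = ‖star (1 - (e : T)) * (star a * a * (1 - (e : T)))‖ := by
        rw [star_mul]; simp only [mul_assoc]
    _ ≤ ‖star (1 - (e : T))‖ * ‖star a * a * (1 - (e : T))‖ := norm_mul_le _ _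
    _ ≤ ‖star a * a * (1 - (e : T))‖ := by
        rw [norm_star]; exact mul_le_of_le_one_left (norm_nonneg _) h1'
    _ ≤ _ := he

/-- The quotient of a C*-algebra by a closed (star-closed) two-sided ideal, with the quotient
norm and the quotient involution, is a C*-algebra. -/
@[reducible]
def quotientCStarAlgebra (hcl : IsClosed (I : Set T)) (hstar : ∀ a ∈ I, star a ∈ I) :
    CStarAlgebra (T ⧸ I) :=
  haveI : IsClosed (I : Set T) := hcl
  let nacg : NormedAddCommGroup (T ⧸ I) := Submodule.Quotient.normedAddCommGroup I
  let rng : Ring (T ⧸ I) := Ideal.Quotient.ring I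
  let nr : NormedRing (T ⧸ I) :=
    { rng, nacg with
      dist_eq := nacg.dist_eq
      norm_mul_le := by
        intro x y
        obtain ⟨a, rfl⟩ := Submodule.Quotient.mk_surjective I x
        obtain ⟨b, rfl⟩ := Submodule.Quotient.mk_surjective I y
        refine le_of_forall_pos_le_add fun ε hε => ?_
        have hc : Filter.Tendsto
            (fun t : ℝ => (‖(Submodule.Quotient.mk a : T ⧸ I)‖ + t) *
              (‖(Submodule.Quotient.mk b : T ⧸ I)‖ + t)) (nhdsWithin 0 (Set.Ioi 0))
            (nhds ((‖(Submodule.Quotient.mk a : T ⧸ I)‖ + 0) *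
              (‖(Submodule.Quotient.mk b : T ⧸ I)‖ + 0))) :=
          Filter.Tendsto.mono_left (Continuous.tendsto (by fun_prop) 0) nhdsWithin_le_nhds
        rw [add_zero, add_zero] at hc
        obtain ⟨t, ht, htp⟩ := ((hc.eventually (gt_mem_nhds (lt_add_of_pos_right _ hε))).and
          self_mem_nhdsWithin).exists
        obtain ⟨m, hm, hm'⟩ := Submodule.Quotient.norm_mk_lt
          (Submodule.Quotient.mk a : T ⧸ I) htp
        obtain ⟨n, hn, hn'⟩ := Submodule.Quotient.norm_mk_lt
          (Submodule.Quotient.mk b : T ⧸ I) htp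
        have : (Submodule.Quotient.mk a : T ⧸ I) * Submodule.Quotient.mk b =
            Submodule.Quotient.mk (m * n) := by
          rw [← hm, ← hn]; rfl
        rw [this]
        calc _ ≤ ‖m * n‖ := Submodule.Quotient.norm_mk_le (S := I) _
          _ ≤ ‖m‖ * ‖n‖ := norm_mul_le _ _
          _ ≤ _ := mul_le_mul hm'.le hn'.le (norm_nonneg _) (by positivity)
          _ ≤ _ := ht.le }
  let st : StarRing (T ⧸ I) :=
    { star := Quotient.map' star (by
        intro a b hab
        rw [Submodule.quotientRel_def] at hab ⊢
        rw [← star_sub]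
        exact hstar _ hab)
      star_involutive := by
        intro x
        obtain ⟨a, rfl⟩ := Submodule.Quotient.mk_surjective I x
        exact congrArg (Submodule.Quotient.mk (p := I)) (star_star a)
      star_mul := by
        intro x y
        obtain ⟨a, rfl⟩ := Submodule.Quotient.mk_surjective I x
        obtain ⟨b, rfl⟩ := Submodule.Quotient.mk_surjective I y
        exact congrArg (Submodule.Quotient.mk (p := I)) (star_mul a b)
      star_add := by
        intro x y
        obtain ⟨a, rfl⟩ := Submodule.Quotient.mk_surjective I x
        obtain ⟨b, rfl⟩ := Submodule.Quotient.mk_surjective I y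
        exact congrArg (Submodule.Quotient.mk (p := I)) (star_add a b) }
  { nr, st with
    complete := (Submodule.Quotient.completeSpace I).complete
    norm_mul_self_le := by
      intro x
      obtain ⟨a, rfl⟩ := Submodule.Quotient.mk_surjective I x
      exact quotient_cstar_ineq I hcl hstar a
    __ := (Ideal.Quotient.algebra ℂ : Algebra ℂ (T ⧸ I))
    norm_smul_le := (Submodule.Quotient.normedSpace I ℂ).norm_smul_le
    star_smul := by
      intro c x
      obtain ⟨a, rfl⟩ := Submodule.Quotient.mk_surjective I x
      exact congrArg (Submodule.Quotient.mk (p := I)) (star_smul c a) }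

end Quotient

/-- The adjoint of a compact operator on a Hilbert space is compact. -/
theorem isCompactOperator_star {F : Type*} [NormedAddCommGroup F] [InnerProductSpace ℂ F]
    [CompleteSpace F] {t : F →L[ℂ] F} (ht : IsCompactOperator t) :
    IsCompactOperator (star t : F →L[ℂ] F) := by
  have hc : IsCompactOperator (t * star t : F →L[ℂ] F) := ht.comp_clm (star t)
  have h1 : TotallyBounded ((t * star t : F →L[ℂ] F) '' Metric.closedBall 0 1) :=
    (hc.isCompact_closure_image_closedBall (f := ((t * star t : F →L[ℂ] F) : F →ₗ[ℂ] F)) 1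
      ).totallyBounded.subset subset_closure
  suffices TotallyBounded ((star t : F →L[ℂ] F) '' Metric.closedBall 0 1) by
    change IsCompactOperator ((star t : F →L[ℂ] F) : F →ₗ[ℂ] F)
    rw [isCompactOperator_iff_isCompact_closure_image_closedBall _ zero_lt_one]
    exact this.closure.isCompact_of_isClosed isClosed_closure
  rw [Metric.totallyBounded_iff]
  intro ε hε
  obtain ⟨u', hu's, hfin, hcov⟩ := totallyBounded_iff_subset.1 h1 _
    (Metric.dist_mem_uniformity (show (0 : ℝ) < ε ^ 2 / 4 by positivity))
  obtain ⟨u, huB, hufin, rfl⟩ := Set.exists_subset_image_finite_and.1 ⟨u', hu's, hfin, rfl⟩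
  refine ⟨(star t : F →L[ℂ] F) '' u, hufin.image _, ?_⟩
  rintro _ ⟨x, hx, rfl⟩
  obtain ⟨y', hy', hd⟩ := Set.mem_iUnion₂.1 (hcov ⟨x, hx, rfl⟩)
  obtain ⟨y, hy, rfl⟩ := hy'
  refine Set.mem_iUnion₂.2 ⟨_, ⟨y, hy, rfl⟩, ?_⟩
  have hd' : ‖(t * star t : F →L[ℂ] F) (x - y)‖ < ε ^ 2 / 4 := by
    rw [map_sub, ← dist_eq_norm]; exact hd
  have hxy : ‖x - y‖ ≤ 2 := by
    have h1 := mem_closedBall_zero_iff.1 hx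
    have h2 := mem_closedBall_zero_iff.1 (huB hy)
    linarith [norm_sub_le x y]
  have hsq : ‖(star t : F →L[ℂ] F) (x - y)‖ ^ 2 < ε ^ 2 := by
    have e : ‖(star t : F →L[ℂ] F) (x - y)‖ ^ 2 =
        RCLike.re (inner ℂ (x - y) ((t * star t : F →L[ℂ] F) (x - y))) := by
      rw [← inner_self_eq_norm_sq (𝕜 := ℂ), ContinuousLinearMap.star_eq_adjoint,
        ContinuousLinearMap.adjoint_inner_left]
      rfl
    rw [e]
    calc _ ≤ ‖x - y‖ * ‖(t * star t : F →L[ℂ] F) (x - y)‖ := re_inner_le_norm _ _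
      _ ≤ 2 * (ε ^ 2 / 4) := mul_le_mul hxy hd'.le (norm_nonneg _) (by norm_num)
      _ < ε ^ 2 := by nlinarith [sq_pos_of_pos hε]
  rw [Metric.mem_ball, dist_eq_norm, ← map_sub]
  exact lt_of_pow_lt_pow_left₀ 2 hε.le hsq

/-! ### Universal representation and spatial tensor product -/

section Universal

variable (A : Type*) [CStarAlgebra A] [PartialOrder A] [StarOrderedRing A]

/-- The Hilbert direct sum of the GNS spaces of all positive functionals. -/
abbrev GNSSum : Type _ := lp (fun φ : A →ₚ[ℂ] ℂ => φ.GNS) 2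

variable {A}

theorem norm_gns_le (φ : A →ₚ[ℂ] ℂ) (a : A) (x : φ.GNS) :
    ‖φ.gnsStarAlgHom a x‖ ≤ ‖a‖ * ‖x‖ :=
  (ContinuousLinearMap.le_opNorm _ _).trans
    (mul_le_mul_of_nonneg_right (NonUnitalStarAlgHom.norm_apply_le φ.gnsStarAlgHom a)
      (norm_nonneg _))

theorem norm_gns_le' (φ : A →ₚ[ℂ] ℂ) (a : A) (x : φ.GNS) :
    ‖φ.gnsStarAlgHom a x‖ ≤ ‖(‖a‖ : ℂ) • x‖ := by
  rw [norm_smul, Complex.norm_real, norm_norm]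
  exact norm_gns_le φ a x

/-- `a` acts on the direct sum of the GNS spaces componentwise. -/
def gnsSumOp (a : A) : GNSSum A →L[ℂ] GNSSum A :=
  LinearMap.mkContinuous
    { toFun := fun f => ⟨fun φ => φ.gnsStarAlgHom a (f φ),
        ((lp.memℓp f).const_smul (‖a‖ : ℂ)).mono' fun φ => norm_gns_le' φ a (f φ)⟩
      map_add' := fun f g => lp.ext (funext fun φ => map_add (φ.gnsStarAlgHom a) (f φ) (g φ))
      map_smul' := fun c f => lp.ext (funext fun φ => map_smul (φ.gnsStarAlgHom a) c (f φ)) }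
    ‖a‖ (fun f => by
      have h : ‖a‖ * ‖f‖ = ‖(‖a‖ : ℂ) • f‖ := by rw [norm_smul]; simp
      rw [h]
      refine lp.norm_mono (by norm_num) fun φ => ?_
      exact norm_gns_le' φ a (f φ))

theorem gnsSumOp_apply (a : A) (f : GNSSum A) (φ : A →ₚ[ℂ] ℂ) :
    gnsSumOp a f φ = φ.gnsStarAlgHom a (f φ) := rfl

/-- The direct sum of all GNS representations. -/
def gnsSumRep : A →⋆ₐ[ℂ] (GNSSum A →L[ℂ] GNSSum A) where
  toFun := gnsSumOp
  map_one' := by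
    ext f φ
    rw [gnsSumOp_apply, map_one]; rfl
  map_mul' a b := by
    ext f φ
    rw [gnsSumOp_apply, map_mul]; rfl
  map_zero' := by
    ext f φ
    rw [gnsSumOp_apply, map_zero]; rfl
  map_add' a b := by
    ext f φ
    rw [gnsSumOp_apply, map_add]; rfl
  commutes' c := by
    ext f φ
    rw [gnsSumOp_apply, AlgHomClass.commutes]; rfl
  map_star' a := by
    rw [ContinuousLinearMap.star_eq_adjoint, ContinuousLinearMap.eq_adjoint_iff]
    intro f g
    rw [lp.inner_eq_tsum, lp.inner_eq_tsum]
    refine tsum_congr fun φ => ?_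
    rw [gnsSumOp_apply, gnsSumOp_apply, map_star, ContinuousLinearMap.star_eq_adjoint,
      ContinuousLinearMap.adjoint_inner_left]

variable (A) in
/-- The Hilbert space of the universal representation of a C*-algebra: the Hilbert direct sum
of the GNS spaces of all positive functionals. -/
def UniversalSpace : Type _ := GNSSum A

instance : NormedAddCommGroup (UniversalSpace A) :=
  lp.normedAddCommGroup (E := fun φ : A →ₚ[ℂ] ℂ => φ.GNS) (p := 2)

instance : InnerProductSpace ℂ (UniversalSpace A) :=
  lp.instInnerProductSpace (G := fun φ : A →ₚ[ℂ] ℂ => φ.GNS)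

instance : CompleteSpace (UniversalSpace A) :=
  lp.completeSpace (E := fun φ : A →ₚ[ℂ] ℂ => φ.GNS) (p := 2)

/-- The universal representation of a C*-algebra: the direct sum of all its GNS representations.
It is faithful by the Gelfand--Naimark theorem. -/
def universalRep : A →⋆ₐ[ℂ] (UniversalSpace A →L[ℂ] UniversalSpace A) := gnsSumRep

variable (A) in
/-- The image of a C*-algebra in its universal representation. -/
def universalImage : StarSubalgebra ℂ (UniversalSpace A →L[ℂ] UniversalSpace A) :=
  (universalRep (A := A)).range

end Universal

section Spatial

set_option linter.unusedSectionVars false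

variable {K L : Type*} [NormedAddCommGroup K] [InnerProductSpace ℂ K] [CompleteSpace K]
  [NormedAddCommGroup L] [InnerProductSpace ℂ L] [CompleteSpace L]

/-- The Hilbert space tensor product. -/
def HilbertTensor (K L : Type*) [NormedAddCommGroup K] [InnerProductSpace ℂ K]
    [NormedAddCommGroup L] [InnerProductSpace ℂ L] : Type _ :=
  Completion (K ⊗[ℂ] L)

instance : NormedAddCommGroup (HilbertTensor K L) :=
  inferInstanceAs (NormedAddCommGroup (Completion (K ⊗[ℂ] L)))

instance : InnerProductSpace ℂ (HilbertTensor K L) :=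
  inferInstanceAs (InnerProductSpace ℂ (Completion (K ⊗[ℂ] L)))

instance : CompleteSpace (HilbertTensor K L) :=
  inferInstanceAs (CompleteSpace (Completion (K ⊗[ℂ] L)))

/-- The canonical isometric embedding of the algebraic tensor product. -/
def toHilbertTensor : K ⊗[ℂ] L →ₗᵢ[ℂ] HilbertTensor K L :=
  Completion.toComplₗᵢ

theorem denseRange_toHilbertTensor :
    DenseRange (toHilbertTensor : K ⊗[ℂ] L →ₗᵢ[ℂ] HilbertTensor K L) :=
  Completion.denseRange_coe

/-- The operator `x ⊗ y` on the Hilbert space tensor product. -/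
def opTensor (x : K →L[ℂ] K) (y : L →L[ℂ] L) : HilbertTensor K L →L[ℂ] HilbertTensor K L :=
  ContinuousLinearMap.completion (TensorProduct.mapL x y)

theorem opTensor_tmul (x : K →L[ℂ] K) (y : L →L[ℂ] L) (ξ : K) (η : L) :
    opTensor x y (toHilbertTensor (ξ ⊗ₜ η)) = toHilbertTensor (x ξ ⊗ₜ y η) :=
  (ContinuousLinearMap.completion_apply_coe (TensorProduct.mapL x y) (ξ ⊗ₜ η)).trans
    (congrArg _ (TensorProduct.mapL_tmul x y ξ η))

/-- The spatial (minimal) tensor product of two concrete unital C*-algebras: the C*-algebra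
generated by the elementary tensors `a ⊗ b`. -/
def spatialTensor (A : StarSubalgebra ℂ (K →L[ℂ] K)) (B : StarSubalgebra ℂ (L →L[ℂ] L)) :
    StarSubalgebra ℂ (HilbertTensor K L →L[ℂ] HilbertTensor K L) :=
  (StarAlgebra.adjoin ℂ {X | ∃ a ∈ A, ∃ b ∈ B, X = opTensor a b}).topologicalClosure

instance (A : StarSubalgebra ℂ (K →L[ℂ] K)) (B : StarSubalgebra ℂ (L →L[ℂ] L)) :
    IsClosed (spatialTensor A B : Set (HilbertTensor K L →L[ℂ] HilbertTensor K L)) :=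
  StarSubalgebra.isClosed_topologicalClosure _

/-- The spatial tensor product as a C*-algebra in its own right. -/
def SpatialTensor (A : StarSubalgebra ℂ (K →L[ℂ] K)) (B : StarSubalgebra ℂ (L →L[ℂ] L)) :
    Type _ := ↥(spatialTensor A B)

instance (A : StarSubalgebra ℂ (K →L[ℂ] K)) (B : StarSubalgebra ℂ (L →L[ℂ] L)) :
    CStarAlgebra (SpatialTensor A B) :=
  StarSubalgebra.cstarAlgebra (spatialTensor A B)

variable {A : StarSubalgebra ℂ (K →L[ℂ] K)} {B : StarSubalgebra ℂ (L →L[ℂ] L)}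

/-- The inclusion of the spatial tensor product into `B(K ⊗ L)`. -/
def SpatialTensor.toOp :
    SpatialTensor A B →⋆ₐ[ℂ] (HilbertTensor K L →L[ℂ] HilbertTensor K L) :=
  (spatialTensor A B).subtype

/-- The elementary tensor `a ⊗ b` as an element of the spatial tensor product. -/
def SpatialTensor.tmul (a : A) (b : B) : SpatialTensor A B :=
  ⟨opTensor (a : K →L[ℂ] K) (b : L →L[ℂ] L), StarSubalgebra.le_topologicalClosure _
    (StarAlgebra.subset_adjoin ℂ _ ⟨a, a.2, b, b.2, rfl⟩)⟩

end Spatial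

/-! ### Compact quantum groups -/

section CompactQuantumGroup

set_option linter.unusedSectionVars false

variable (A : Type*) [Ring A] [StarRing A] [HopfAlgebra ℂ A] [StarModule ℂ A]
variable {H K : Type*} [NormedAddCommGroup H] [InnerProductSpace ℂ H] [FiniteDimensional ℂ H]
  [NormedAddCommGroup K] [InnerProductSpace ℂ K] [FiniteDimensional ℂ K]

variable (H) in
/-- A finite dimensional unitary representation on `H` of the compact quantum group with Hopf
algebra `A`: a unitary `U ∈ B(H) ⊗ A` such that `(ι ⊗ Δ)(U) = U₁₂ U₁₃`. -/
structure UnitaryRep where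
  U : Module.End ℂ H ⊗[ℂ] A
  unitary : U ∈ unitary (Module.End ℂ H ⊗[ℂ] A)
  comul : Algebra.TensorProduct.map (AlgHom.id ℂ (Module.End ℂ H)) (Bialgebra.comulAlgHom ℂ A) U =
    Algebra.TensorProduct.map (AlgHom.id ℂ (Module.End ℂ H))
        (Algebra.TensorProduct.includeLeft : A →ₐ[ℂ] A ⊗[ℂ] A) U *
      Algebra.TensorProduct.map (AlgHom.id ℂ (Module.End ℂ H))
        (Algebra.TensorProduct.includeRight : A →ₐ[ℂ] A ⊗[ℂ] A) U

/-- A compact quantum group, given by its Hopf `*`-algebra `A`: the comultiplication is a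
`*`-homomorphism, and `A` is generated as an algebra by the matrix coefficients of finite
dimensional unitary representations. -/
class CompactQuantumGroup : Prop where
  comul_star : ∀ a : A, Coalgebra.comul (R := ℂ) (star a) = star (Coalgebra.comul (R := ℂ) a)
  generated : Algebra.adjoin ℂ
    {a : A | ∃ (n : ℕ) (V : UnitaryRep A (EuclideanSpace ℂ (Fin n)))
      (ω : Module.End ℂ (EuclideanSpace ℂ (Fin n)) →ₗ[ℂ] ℂ),
      a = TensorProduct.lid ℂ A (ω.rTensor A V.U)} = ⊤

variable {A}

/-- The comodule map `ξ ↦ U(ξ ⊗ 1)`, for `U ∈ B(H) ⊗ A`. -/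
def coaction (U : Module.End ℂ H ⊗[ℂ] A) : H →ₗ[ℂ] H ⊗[ℂ] A :=
  (LinearMap.rTensorHom A ∘ₗ LinearMap.applyₗ).flip U

/-- The tensor product `U₁₃ V₂₃ ∈ B(H ⊗ K) ⊗ A` of `U ∈ B(H) ⊗ A` and `V ∈ B(K) ⊗ A`. -/
def tensorRep (U : Module.End ℂ H ⊗[ℂ] A) (V : Module.End ℂ K ⊗[ℂ] A) :
    Module.End ℂ (H ⊗[ℂ] K) ⊗[ℂ] A :=
  Algebra.TensorProduct.map (Module.End.rTensorAlgHom ℂ H K) (AlgHom.id ℂ A) U *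
    Algebra.TensorProduct.map (Module.End.lTensorAlgHom ℂ K H) (AlgHom.id ℂ A) V

/-- `t : H → K` intertwines `U` and `V`. -/
def Intertwines (U : Module.End ℂ H ⊗[ℂ] A) (V : Module.End ℂ K ⊗[ℂ] A) (t : H →ₗ[ℂ] K) : Prop :=
  t.rTensor A ∘ₗ coaction U = coaction V ∘ₗ t

/-- The module `H` is simple: it is nonzero and has no proper nonzero invariant subspaces. -/
def UnitaryRep.IsSimple (V : UnitaryRep A H) : Prop :=
  Nontrivial H ∧ ∀ W : Submodule ℂ H,
    (∀ ξ ∈ W, coaction V.U ξ ∈ LinearMap.range (W.subtype.rTensor A)) → W = ⊥ ∨ W = ⊤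

/-- Two modules are isomorphic. -/
def UnitaryRep.IsIso (V : UnitaryRep A H) (W : UnitaryRep A K) : Prop :=
  ∃ t : H ≃ₗ[ℂ] K, Intertwines V.U W.U t

/-- `h` is a Haar state: a positive unital functional that is invariant under left and right
translations. -/
structure IsHaarState (h : A →ₗ[ℂ] ℂ) : Prop where
  map_one : h 1 = 1
  nonneg : ∀ a : A, 0 ≤ h (star a * a)
  left_invariant : ∀ a : A,
    TensorProduct.lid ℂ A (h.rTensor A (Coalgebra.comul (R := ℂ) a)) = h a • (1 : A)
  right_invariant : ∀ a : A,
    TensorProduct.rid ℂ A (h.lTensor A (Coalgebra.comul (R := ℂ) a)) = h a • (1 : A)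

variable (A)

open Classical in
/-- The Haar state of a compact quantum group. (Its existence and uniqueness is a theorem; the
value `0` is never taken.) -/
def haarState : A →ₗ[ℂ] ℂ :=
  if h : ∃ h : A →ₗ[ℂ] ℂ, IsHaarState h then h.choose else 0

theorem haarState_nonneg (a : A) : 0 ≤ haarState A (star a * a) := by
  unfold haarState
  split_ifs with h
  · exact h.choose_spec.nonneg a
  · simp

variable {A} in
theorem conj_haarState_mul (a b : A) :
    (starRingEnd ℂ) (haarState A (star b * a)) = haarState A (star a * b) := by
  have haa := haarState_nonneg A a
  have hbb := haarState_nonneg A b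
  have h1 := haarState_nonneg A (a + b)
  have h2 := haarState_nonneg A (a + Complex.I • b)
  simp only [star_add, star_smul, add_mul, mul_add, map_add, smul_mul_assoc, mul_smul_comm,
    map_smul, smul_eq_mul] at h1 h2
  have e1 := (Complex.nonneg_iff.1 haa).2
  have e2 := (Complex.nonneg_iff.1 hbb).2
  have e3 := (Complex.nonneg_iff.1 h1).2
  have e4 := (Complex.nonneg_iff.1 h2).2
  simp at e3 e4
  apply Complex.ext <;> simp <;> linarith

/-- The space `A` equipped with the semi-inner product `⟪a, b⟫ = h (a* b)` of the Haar state. -/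
def PreL2 (A : Type*) [Ring A] [StarRing A] [HopfAlgebra ℂ A] [StarModule ℂ A] : Type _ := A

instance : AddCommGroup (PreL2 A) := inferInstanceAs (AddCommGroup A)
instance : Module ℂ (PreL2 A) := inferInstanceAs (Module ℂ A)

/-- The identity map `A → PreL2 A`. -/
def toPreL2 : A ≃ₗ[ℂ] PreL2 A := LinearEquiv.refl ℂ A

/-- The semi-inner product of the Haar state. -/
abbrev preL2Core : PreInnerProductSpace.Core ℂ (PreL2 A) where
  inner a b := haarState A (star ((toPreL2 A).symm a) * (toPreL2 A).symm b)
  conj_inner_symm a b := conj_haarState_mul _ _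
  re_inner_nonneg a := (Complex.nonneg_iff.1 (haarState_nonneg A ((toPreL2 A).symm a))).1
  add_left a b c := by rw [map_add, star_add, add_mul, map_add]
  smul_left a b c := by
    rw [map_smul, star_smul, smul_mul_assoc, map_smul]; rfl

instance : SeminormedAddCommGroup (PreL2 A) :=
  InnerProductSpace.Core.toSeminormedAddCommGroup (c := preL2Core A)
instance : InnerProductSpace ℂ (PreL2 A) := InnerProductSpace.ofCore (preL2Core A)

/-- The GNS space `L²(G)` of the Haar state. -/
def L2 : Type _ := Completion (PreL2 A)

instance : NormedAddCommGroup (L2 A) :=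
  inferInstanceAs (NormedAddCommGroup (Completion (PreL2 A)))
instance : InnerProductSpace ℂ (L2 A) :=
  inferInstanceAs (InnerProductSpace ℂ (Completion (PreL2 A)))
instance : CompleteSpace (L2 A) := inferInstanceAs (CompleteSpace (Completion (PreL2 A)))

/-- The canonical map `Λ : A → L²(G)` with dense range. -/
def toL2 : A →ₗ[ℂ] L2 A :=
  (Completion.toComplₗᵢ : PreL2 A →ₗᵢ[ℂ] Completion (PreL2 A)).toLinearMap ∘ₗ
    (toPreL2 A).toLinearMap

theorem inner_toL2 (a b : A) : inner ℂ (toL2 A a) (toL2 A b) = haarState A (star a * b) :=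
  Completion.inner_coe (toPreL2 A a) (toPreL2 A b)

theorem denseRange_toL2 : DenseRange (toL2 A) :=
  (Completion.denseRange_coe (α := PreL2 A)).comp (toPreL2 A).surjective.denseRange
    (Completion.continuous_coe _)

/-- The reduced C*-algebra `C(G) ⊆ B(L²(G))`: the C*-algebra generated by the operators
`Λ(b) ↦ Λ(ab)` of left multiplication by elements `a` of the Hopf algebra. -/
def reducedAlgebra : StarSubalgebra ℂ (L2 A →L[ℂ] L2 A) :=
  (StarAlgebra.adjoin ℂ {X | ∃ a : A, ∀ b : A, X (toL2 A b) = toL2 A (a * b)}).topologicalClosure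

end CompactQuantumGroup

/-! ### Actions on C*-algebras -/

section Action

variable (A : Type*) [Ring A] [StarRing A] [HopfAlgebra ℂ A] [StarModule ℂ A]
variable (B : Type*) [CStarAlgebra B] [PartialOrder B] [StarOrderedRing B]

/-- The minimal tensor product `B ⊗ C(G)`, with `B` in its universal representation. -/
def TensorReduced : Type _ :=
  SpatialTensor (universalImage B) (reducedAlgebra A)

instance : CStarAlgebra (TensorReduced A B) :=
  inferInstanceAs (CStarAlgebra (SpatialTensor (universalImage B) (reducedAlgebra A)))

variable {A B}

/-- The elementary tensor `b ⊗ x ∈ B ⊗ C(G)`. -/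
def tmulReduced (b : B) (x : reducedAlgebra A) : TensorReduced A B :=
  SpatialTensor.tmul ⟨universalRep b, b, rfl⟩ x

/-- The fixed point set `B^G = {b ∈ B : α(b) = b ⊗ 1}` of `α : B → B ⊗ C(G)`. -/
def fixedPoints (α : B →⋆ₐ[ℂ] TensorReduced A B) : Set B :=
  {b | α b = tmulReduced b 1}

/-- `α` is ergodic if its fixed point set is `ℂ1`. -/
def IsErgodic (α : B →⋆ₐ[ℂ] TensorReduced A B) : Prop :=
  fixedPoints α = Set.range (algebraMap ℂ B)

end Action

/-! ### Subproduct systems -/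

/-- The adjoint of an isometry is a contraction. -/
theorem norm_adjoint_isometry_le {E F : Type*} [NormedAddCommGroup E] [InnerProductSpace ℂ E]
    [FiniteDimensional ℂ E] [NormedAddCommGroup F] [InnerProductSpace ℂ F]
    [FiniteDimensional ℂ F] (w : E →ₗᵢ[ℂ] F) (x : F) :
    ‖LinearMap.adjoint w.toLinearMap x‖ ≤ ‖x‖ := by
  set y := LinearMap.adjoint w.toLinearMap x with hy
  have h1 : ‖y‖ * ‖y‖ ≤ ‖x‖ * ‖y‖ := by
    calc ‖y‖ * ‖y‖ = ‖inner ℂ y y‖ := by simp [inner_self_eq_norm_sq_to_K, sq]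
      _ = ‖inner ℂ x (w y)‖ := by
        nth_rw 1 [hy]
        rw [LinearMap.adjoint_inner_left]; rfl
      _ ≤ ‖x‖ * ‖w y‖ := norm_inner_le_norm _ _
      _ = ‖x‖ * ‖y‖ := by rw [LinearIsometry.norm_map]
  rcases (norm_nonneg y).eq_or_lt with h0 | h0
  · rw [← h0]; exact norm_nonneg x
  · exact le_of_mul_le_mul_right h1 h0

theorem tsum_shift_le {a b : ℕ → ℝ} {C : ℝ} (h0 : a 0 = 0) (h : ∀ n, a (n + 1) ≤ C * b n)
    (ha : Summable a) (hb : Summable b) : ∑' n, a n ≤ C * ∑' n, b n := by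
  rw [ha.tsum_eq_zero_add, h0, zero_add, ← tsum_mul_left]
  exact Summable.tsum_le_tsum h ((summable_nat_add_iff 1).2 ha) (hb.mul_left _)

/-- A subproduct system of finite dimensional Hilbert spaces over `ℤ₊`. -/
structure SubproductSystem where
  H : ℕ → Type*
  [normed : ∀ n, NormedAddCommGroup (H n)]
  [innerProduct : ∀ n, InnerProductSpace ℂ (H n)]
  [finiteDimensional : ∀ n, FiniteDimensional ℂ (H n)]
  w : ∀ k l, H (k + l) →ₗᵢ[ℂ] H k ⊗[ℂ] H l
  finrank_zero : Module.finrank ℂ (H 0) = 1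
  coassoc : ∀ (k l n : ℕ) (x : H (k + l + n)),
    TensorProduct.assoc ℂ (H k) (H l) (H n) ((w k l).toLinearMap.rTensor (H n) (w (k + l) n x)) =
      (w l n).toLinearMap.lTensor (H k)
        (w k (l + n) (cast (congrArg H (Nat.add_assoc k l n)) x))

namespace SubproductSystem

attribute [instance] normed innerProduct finiteDimensional

variable (𝓗 : SubproductSystem)

instance (n : ℕ) : CompleteSpace (𝓗.H n) := FiniteDimensional.complete ℂ _

/-- The Hilbert direct sum of the spaces `H n`. -/
abbrev FockSum : Type _ := lp 𝓗.H 2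

/-- Transport along an equality of indices. -/
def castEquiv {m n : ℕ} (h : m = n) : 𝓗.H m ≃ₗᵢ[ℂ] 𝓗.H n := h ▸ LinearIsometryEquiv.refl ℂ (𝓗.H m)

/-- The vector `w₁ₙ*(ξ ⊗ ζ) ∈ H (n + 1)`. -/
def mulVec (n : ℕ) (ξ : 𝓗.H 1) : 𝓗.H n →ₗ[ℂ] 𝓗.H (n + 1) :=
  (𝓗.castEquiv (Nat.add_comm 1 n)).toLinearEquiv.toLinearMap ∘ₗ
    LinearMap.adjoint (𝓗.w 1 n).toLinearMap ∘ₗ TensorProduct.mk ℂ (𝓗.H 1) (𝓗.H n) ξ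

theorem norm_mulVec_le (n : ℕ) (ξ : 𝓗.H 1) (ζ : 𝓗.H n) : ‖𝓗.mulVec n ξ ζ‖ ≤ ‖ξ‖ * ‖ζ‖ := by
  calc ‖𝓗.mulVec n ξ ζ‖ = ‖LinearMap.adjoint (𝓗.w 1 n).toLinearMap (ξ ⊗ₜ ζ)‖ :=
        LinearIsometryEquiv.norm_map _ _
    _ ≤ ‖ξ ⊗ₜ[ℂ] ζ‖ := norm_adjoint_isometry_le (𝓗.w 1 n) _
    _ = ‖ξ‖ * ‖ζ‖ := TensorProduct.norm_tmul ξ ζ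

/-- The components of `S_ξ f`. -/
def creationFun (ξ : 𝓗.H 1) (f : ∀ n, 𝓗.H n) : ∀ n, 𝓗.H n
  | 0 => 0
  | n + 1 => 𝓗.mulVec n ξ (f n)

theorem norm_creationFun_rpow_le (ξ : 𝓗.H 1) (f : ∀ n, 𝓗.H n) (n : ℕ) :
    ‖𝓗.creationFun ξ f (n + 1)‖ ^ (2 : ℝ≥0∞).toReal ≤
      ‖ξ‖ ^ (2 : ℝ≥0∞).toReal * ‖f n‖ ^ (2 : ℝ≥0∞).toReal := by
  rw [← Real.mul_rpow (norm_nonneg _) (norm_nonneg _)]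
  exact Real.rpow_le_rpow (norm_nonneg _) (𝓗.norm_mulVec_le n ξ (f n)) ENNReal.toReal_nonneg

theorem summable_creationFun (ξ : 𝓗.H 1) (f : 𝓗.FockSum) :
    Summable fun n => ‖𝓗.creationFun ξ f n‖ ^ (2 : ℝ≥0∞).toReal := by
  rw [← summable_nat_add_iff 1]
  exact Summable.of_nonneg_of_le (fun n => Real.rpow_nonneg (norm_nonneg _) _)
    (fun n => 𝓗.norm_creationFun_rpow_le ξ f n)
    (((lp.memℓp f).summable (by norm_num)).mul_left _)

theorem norm_creationSum_le (ξ : 𝓗.H 1) (f g : 𝓗.FockSum) (hg : ∀ n, g n = 𝓗.creationFun ξ f n) :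
    ‖g‖ ≤ ‖ξ‖ * ‖f‖ := by
  have h2 : 0 < (2 : ℝ≥0∞).toReal := by norm_num
  have hs := 𝓗.summable_creationFun ξ f
  have hf := (lp.memℓp f).summable h2
  have h0 : ‖𝓗.creationFun ξ f 0‖ ^ (2 : ℝ≥0∞).toReal = 0 := by
    rw [creationFun, norm_zero, Real.zero_rpow h2.ne']
  have key := tsum_shift_le h0 (𝓗.norm_creationFun_rpow_le ξ f) hs hf
  refine lp.norm_le_of_tsum_le h2 (mul_nonneg (norm_nonneg _) (norm_nonneg _)) ?_
  have e : (∑' n, ‖g n‖ ^ (2 : ℝ≥0∞).toReal) =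
      ∑' n, ‖𝓗.creationFun ξ f n‖ ^ (2 : ℝ≥0∞).toReal :=
    tsum_congr fun n => congrArg (fun x => ‖x‖ ^ (2 : ℝ≥0∞).toReal) (hg n)
  have e' : (‖ξ‖ * ‖f‖) ^ (2 : ℝ≥0∞).toReal = ‖ξ‖ ^ (2 : ℝ≥0∞).toReal *
      ∑' n, ‖f n‖ ^ (2 : ℝ≥0∞).toReal :=
    (Real.mul_rpow (norm_nonneg _) (norm_nonneg _)).trans
      (congrArg _ (lp.norm_rpow_eq_tsum h2 f))
  exact e.trans_le (key.trans_eq e'.symm)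

/-- The operator with `S_ξ ζ = w₁ₙ*(ξ ⊗ ζ)` for `ζ ∈ H n`. -/
def creationSum (ξ : 𝓗.H 1) : 𝓗.FockSum →L[ℂ] 𝓗.FockSum :=
  LinearMap.mkContinuous
    { toFun := fun f => ⟨𝓗.creationFun ξ f, memℓp_gen (𝓗.summable_creationFun ξ f)⟩
      map_add' := fun f g => by
        refine lp.ext (funext fun n => ?_)
        cases n with
        | zero => exact (add_zero (0 : 𝓗.H 0)).symm
        | succ n => exact map_add (𝓗.mulVec n ξ) (f n) (g n)
      map_smul' := fun c f => by
        refine lp.ext (funext fun n => ?_)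
        cases n with
        | zero => exact (smul_zero c : c • (0 : 𝓗.H 0) = 0).symm
        | succ n => exact map_smul (𝓗.mulVec n ξ) c (f n) }
    ‖ξ‖ (fun f => by
      exact 𝓗.norm_creationSum_le ξ f ⟨_, memℓp_gen (𝓗.summable_creationFun ξ f)⟩ fun _ => rfl)

/-- The Fock space, the Hilbert direct sum of the spaces `H n`. -/
def Fock : Type _ := 𝓗.FockSum

instance : NormedAddCommGroup 𝓗.Fock := lp.normedAddCommGroup (E := 𝓗.H) (p := 2)

instance : InnerProductSpace ℂ 𝓗.Fock := lp.instInnerProductSpace (G := 𝓗.H)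

instance : CompleteSpace 𝓗.Fock := lp.completeSpace (E := 𝓗.H) (p := 2)

/-- The embedding of `H n` into the Fock space. -/
def toFock (n : ℕ) : 𝓗.H n →ₗ[ℂ] 𝓗.Fock := lp.lsingle (E := 𝓗.H) (𝕜 := ℂ) 2 n

/-- The creation operator `S_ξ` on the Fock space, `S_ξ ζ = w₁ₙ*(ξ ⊗ ζ)` for `ζ ∈ H n`. -/
def creation (ξ : 𝓗.H 1) : 𝓗.Fock →L[ℂ] 𝓗.Fock := 𝓗.creationSum ξ

theorem creation_toFock (ξ : 𝓗.H 1) (n : ℕ) (ζ : 𝓗.H n) :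
    𝓗.creation ξ (𝓗.toFock n ζ) = 𝓗.toFock (n + 1) (𝓗.mulVec n ξ ζ) := by
  refine lp.ext (funext fun m => ?_)
  cases m with
  | zero => exact (lp.single_apply_ne 2 (n + 1) (𝓗.mulVec n ξ ζ) (Nat.succ_ne_zero n).symm).symm
  | succ m =>
    change 𝓗.mulVec m ξ (lp.single 2 n ζ m) = lp.single 2 (n + 1) (𝓗.mulVec n ξ ζ) (m + 1)
    by_cases h : m = n
    · subst h
      rw [lp.single_apply_self, lp.single_apply_self]
    · rw [lp.single_apply_ne 2 n ζ h, lp.single_apply_ne 2 (n + 1) _ (by omega), map_zero]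

/-- The Toeplitz algebra, the unital C*-algebra generated by the creation operators. -/
def toeplitz : StarSubalgebra ℂ (𝓗.Fock →L[ℂ] 𝓗.Fock) :=
  (StarAlgebra.adjoin ℂ (Set.range 𝓗.creation)).topologicalClosure

instance : IsClosed (𝓗.toeplitz : Set (𝓗.Fock →L[ℂ] 𝓗.Fock)) :=
  StarSubalgebra.isClosed_topologicalClosure _

/-- The creation operator as an element of the Toeplitz algebra. -/
def S (ξ : 𝓗.H 1) : 𝓗.toeplitz :=
  ⟨𝓗.creation ξ, StarSubalgebra.le_topologicalClosure _
    (StarAlgebra.subset_adjoin ℂ _ ⟨ξ, rfl⟩)⟩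

/-- The ideal of compact operators in the Toeplitz algebra. -/
def compacts : Ideal 𝓗.toeplitz where
  carrier := {t | IsCompactOperator (t : 𝓗.Fock →L[ℂ] 𝓗.Fock)}
  add_mem' := fun {s t} hs ht => IsCompactOperator.add (f := (s : 𝓗.Fock →L[ℂ] 𝓗.Fock))
    (g := (t : 𝓗.Fock →L[ℂ] 𝓗.Fock)) hs ht
  zero_mem' := isCompactOperator_zero
  smul_mem' := fun s t ht => IsCompactOperator.clm_comp (f := (t : 𝓗.Fock →L[ℂ] 𝓗.Fock)) ht
    (s : 𝓗.Fock →L[ℂ] 𝓗.Fock)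

instance : 𝓗.compacts.IsTwoSided where
  mul_mem_of_left {t} s ht := IsCompactOperator.comp_clm
    (f := (t : 𝓗.Fock →L[ℂ] 𝓗.Fock)) ht (s : 𝓗.Fock →L[ℂ] 𝓗.Fock)

theorem isClosed_compacts : IsClosed (𝓗.compacts : Set 𝓗.toeplitz) :=
  (isClosed_setOfPred_isCompactOperator (σ₁₂ := RingHom.id ℂ) (M₁ := 𝓗.Fock)
    (M₂ := 𝓗.Fock)).preimage continuous_subtype_val

theorem star_mem_compacts (t : 𝓗.toeplitz) (ht : t ∈ 𝓗.compacts) : star t ∈ 𝓗.compacts :=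
  isCompactOperator_star (t := (t : 𝓗.Fock →L[ℂ] 𝓗.Fock)) ht

/-- The Cuntz--Pimsner algebra, the quotient of the Toeplitz algebra by the compact operators. -/
def CuntzPimsner : Type _ := 𝓗.toeplitz ⧸ 𝓗.compacts

instance : CStarAlgebra 𝓗.CuntzPimsner :=
  quotientCStarAlgebra 𝓗.compacts 𝓗.isClosed_compacts 𝓗.star_mem_compacts

instance : PartialOrder 𝓗.CuntzPimsner := CStarAlgebra.spectralOrder _

instance : StarOrderedRing 𝓗.CuntzPimsner := CStarAlgebra.spectralOrderedRing _

/-- The quotient map from the Toeplitz algebra to the Cuntz--Pimsner algebra. -/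
def quotientMap : 𝓗.toeplitz →⋆ₐ[ℂ] 𝓗.CuntzPimsner where
  toFun t := Ideal.Quotient.mk 𝓗.compacts t
  map_one' := rfl
  map_mul' _ _ := rfl
  map_zero' := rfl
  map_add' _ _ := rfl
  commutes' _ := rfl
  map_star' _ := rfl

/-- The image `s_ξ` of the creation operator `S_ξ` in the Cuntz--Pimsner algebra. -/
def s (ξ : 𝓗.H 1) : 𝓗.CuntzPimsner := 𝓗.quotientMap (𝓗.S ξ)

/-- The Cuntz--Pimsner algebra admits normal ordering: the elements
`s_{ξ₁} ⋯ s_{ξₙ} s_{ζ₁}* ⋯ s_{ζₘ}*` (`n, m ≥ 0`) span a dense subspace. By linearity of `ξ ↦ s_ξ`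
it does not matter whether all vectors of `H 1` or only those of a basis are used. -/
def AdmitsNormalOrdering : Prop :=
  Dense (Submodule.span ℂ {a : 𝓗.CuntzPimsner | ∃ ξ ζ : List (𝓗.H 1),
    a = (ξ.map 𝓗.s).prod * (ζ.map fun η => star (𝓗.s η)).prod} : Set 𝓗.CuntzPimsner)

/-! ### Equivariant subproduct systems -/

variable (A : Type*) [Ring A] [StarRing A] [HopfAlgebra ℂ A] [StarModule ℂ A]

/-- The structure of a `G`-equivariant subproduct system: unitary representations of `G` on the
spaces `H n` such that the structure maps are intertwiners. -/
structure Equivariant where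
  rep : ∀ n, UnitaryRep A (𝓗.H n)
  equivariant : ∀ k l, Intertwines (rep (k + l)).U (tensorRep (rep k).U (rep l).U)
    (𝓗.w k l).toLinearMap

variable {𝓗 A}

/-- The map `H n ⊗ A → F ⊗ L²(G)`, `ζ ⊗ a ↦ ζ ⊗ Λ(a)`. -/
def fockTensor (n : ℕ) : 𝓗.H n ⊗[ℂ] A →ₗ[ℂ] HilbertTensor 𝓗.Fock (L2 A) :=
  toHilbertTensor.toLinearMap ∘ₗ
    TensorProduct.map (𝓗.toFock n) (toL2 A)

/-- `U` is the unitary representation `U_𝓗 = ⨁ U_n` on the Fock space, viewed as an operator on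
`F ⊗ L²(G)`: `U (ζ ⊗ Λ(b)) = U_n (ζ ⊗ 1) (1 ⊗ b)` for `ζ ∈ H n`. -/
def Equivariant.IsFockRep (ρ : 𝓗.Equivariant A)
    (U : HilbertTensor 𝓗.Fock (L2 A) →L[ℂ] HilbertTensor 𝓗.Fock (L2 A)) : Prop :=
  U ∈ unitary (HilbertTensor 𝓗.Fock (L2 A) →L[ℂ] HilbertTensor 𝓗.Fock (L2 A)) ∧
  ∀ (n : ℕ) (ζ : 𝓗.H n) (b : A), U (fockTensor n (ζ ⊗ₜ b)) =
    fockTensor n ((LinearMap.mulRight ℂ b).lTensor (𝓗.H n) (coaction (ρ.rep n).U ζ))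

/-- `αT : T → T ⊗ C(G)` is the action on the Toeplitz algebra, `αT(t) = U_𝓗 (t ⊗ 1) U_𝓗*`. -/
def Equivariant.IsToeplitzAction (ρ : 𝓗.Equivariant A)
    (αT : 𝓗.toeplitz →⋆ₐ[ℂ] SpatialTensor 𝓗.toeplitz (reducedAlgebra A)) : Prop :=
  ∃ U, ρ.IsFockRep U ∧ ∀ t : 𝓗.toeplitz,
    SpatialTensor.toOp (αT t) =
      U * opTensor (t : 𝓗.Fock →L[ℂ] 𝓗.Fock) 1 * star U

/-- `Q : T ⊗ C(G) → O ⊗ C(G)` is the homomorphism `q ⊗ ι`. -/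
def IsQuotientTensor
    (Q : SpatialTensor 𝓗.toeplitz (reducedAlgebra A) →⋆ₐ[ℂ] TensorReduced A 𝓗.CuntzPimsner) :
    Prop :=
  ∀ t x, Q (SpatialTensor.tmul t x) = tmulReduced (𝓗.quotientMap t) x

/-- `α : O → O ⊗ C(G)` is the action on the Cuntz--Pimsner algebra: the action on the Toeplitz
algebra passed to the quotient, `α ∘ q = (q ⊗ ι) ∘ αT`. -/
def Equivariant.IsInducedAction (ρ : 𝓗.Equivariant A)
    (α : 𝓗.CuntzPimsner →⋆ₐ[ℂ] TensorReduced A 𝓗.CuntzPimsner) : Prop :=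
  ∃ αT Q, ρ.IsToeplitzAction αT ∧ IsQuotientTensor Q ∧
    ∀ t, α (𝓗.quotientMap t) = Q (αT t)

end SubproductSystem

end
end CQG

/-! Write `T_η` for multiplication by `η ∈ H n` on the Fock space and `u^n` for the matrix of `U_n`
in an orthonormal basis. The multiplication `w*` intertwines the representations, so `U_𝓗 (T_i ⊗ 1)
U_𝓗* = ∑ l, T_l ⊗ u^n_{li}` for the basis vectors of `H n` (`conj_shift`). This already shows that
conjugation by `U_𝓗` maps the Toeplitz algebra into its spatial tensor product with `C(G)`.

Ergodicity comes from averaging. For every `a`, the element `(ι ⊗ h)α(a)` is a scalar; if `α(a) = a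
⊗ 1`, it equals `a`. By normal ordering and continuity it suffices to average `T_i T_j*`, with `i`
indexing a basis of `H n` and `j` one of `H m`. The result is `∑ l k, h(u^n_{li} (u^m_{kj})*) T_l
T_k*`. By Schur's lemma the coefficients vanish for `n ≠ m`, and for `n = m` they are `c δ_{lk}`.
What remains is `c ∑ l, T_l T_l*`, which is `c` modulo compacts because `w` is isometric: the sum is
the identity on all levels from `n` on (`isCompactOperator_sum_shift_mul_star_sub_one`).

Three inputs have to be built first.

The Haar state. It is defined by choice with default value `0`, so its existence has to be proved.
On the coefficients of one unitary corepresentation, an invariant functional comes from the unit of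
a star-closed algebra of matrices (`exists_invariant`), and uniqueness glues these functionals
together. Positivity says that the average of a positive matrix is positive. This follows from an
invariant faithful positive functional on matrices, which in turn comes from unitarizability of the
conjugate representation (`exists_invariant_form`, `average_posSemidef`).

The homomorphism `q ⊗ ι` on the spatial tensor product. Slicing the second leg along a finite
orthonormal family compresses an operator to a matrix over the first algebra, and matrix
amplifications of star-homomorphisms are contractive (`SliceRelated.norm_le`). Hence the closed
graph of `q ⊗ ι` is a C*-algebra whose first projection is isometric.

The descent to the quotient. `(q ⊗ ι)αT` has to vanish on compact operators. Since `U_𝓗` preserves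
the levels, all slices of `U_𝓗 (k ⊗ 1) U_𝓗*` are compact for compact `k`, and slices separate
operators. -/

namespace CQG

open scoped TensorProduct ComplexOrder InnerProductSpace ENNReal
open UniformSpace

noncomputable section

set_option linter.unusedSectionVars false

/-! ### Unitary corepresentation matrices -/

section Corep

open Matrix

variable {A : Type*} [Ring A] [StarRing A] [HopfAlgebra ℂ A]
variable {κ μ : Type} [Fintype κ] [DecidableEq κ] [Fintype μ] [DecidableEq μ]

/-- A finite dimensional unitary corepresentation in matrix form. -/
structure IsUnitaryCorep (v : Matrix κ κ A) : Prop where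
  comul : ∀ i j, Coalgebra.comul (R := ℂ) (v i j) = ∑ k, v i k ⊗ₜ[ℂ] v k j
  mul_star : v * vᴴ = 1
  star_mul : vᴴ * v = 1

/-- The space of matrix coefficients. -/
def coeffs (v : Matrix κ κ A) : Submodule ℂ A := Submodule.span ℂ (Set.range fun p : κ × κ => v p.1 p.2)

theorem mem_coeffs (v : Matrix κ κ A) (i j : κ) : v i j ∈ coeffs v :=
  Submodule.subset_span ⟨(i, j), rfl⟩

/-- A multiple of the trivial representation. It supplies the scalars as coefficients, and tensoring
with it produces multiples of a given representation. -/
theorem isUnitaryCorep_one : IsUnitaryCorep (1 : Matrix κ κ A) where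
  comul i j := by
    rw [Finset.sum_eq_single i (fun k _ hk => by
      rw [one_apply_ne (Ne.symm hk), TensorProduct.zero_tmul]) (by simp), one_apply_eq]
    rcases eq_or_ne i j with rfl | h
    · rw [one_apply_eq]; exact Bialgebra.comul_one
    · rw [one_apply_ne h, map_zero, TensorProduct.tmul_zero]
  mul_star := by simp
  star_mul := by simp

theorem IsUnitaryCorep.directSum {v : Matrix κ κ A} {w : Matrix μ μ A} (hv : IsUnitaryCorep v)
    (hw : IsUnitaryCorep w) : IsUnitaryCorep (fromBlocks v 0 0 w) where
  comul i j := by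
    rcases i with i | i <;> rcases j with j | j <;> simp [hv.comul, hw.comul]
  mul_star := by
    rw [fromBlocks_conjTranspose, fromBlocks_multiply]; simp [hv.mul_star, hw.mul_star]
  star_mul := by
    rw [fromBlocks_conjTranspose, fromBlocks_multiply]; simp [hv.star_mul, hw.star_mul]

/-- The tensor product of two matrices of algebra elements. -/
def kron (v : Matrix κ κ A) (w : Matrix μ μ A) : Matrix (κ × μ) (κ × μ) A :=
  Matrix.of fun p q => v p.1 q.1 * w p.2 q.2

theorem kron_apply (v : Matrix κ κ A) (w : Matrix μ μ A) (p q : κ × μ) :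
    kron v w p q = v p.1 q.1 * w p.2 q.2 := rfl

theorem IsUnitaryCorep.kron {v : Matrix κ κ A} {w : Matrix μ μ A} (hv : IsUnitaryCorep v)
    (hw : IsUnitaryCorep w) : IsUnitaryCorep (kron v w) where
  comul := by
    rintro ⟨i, k⟩ ⟨j, l⟩
    simp only [kron_apply, Bialgebra.comul_mul, hv.comul, hw.comul, Finset.sum_mul_sum,
      Algebra.TensorProduct.tmul_mul_tmul, Fintype.sum_prod_type]
  mul_star := by
    ext ⟨i, k⟩ ⟨i', k'⟩
    simp only [mul_apply, kron_apply, conjTranspose_apply, StarMul.star_mul, Fintype.sum_prod_type]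
    have h : ∀ j, ∑ l, v i j * w k l * (star (w k' l) * star (v i' j)) =
        v i j * (w * wᴴ) k k' * star (v i' j) := by
      intro j
      simp only [mul_apply, Finset.mul_sum, Finset.sum_mul, conjTranspose_apply, mul_assoc]
    simp only [h, hw.mul_star]
    have h2 := congrFun (congrFun hv.mul_star i) i'
    simp only [mul_apply, conjTranspose_apply] at h2
    by_cases hk : k = k'
    · subst hk
      simp only [one_apply_eq, mul_one, h2]
      simp [one_apply]
    · simp [hk, one_apply]
  star_mul := by
    ext ⟨i, k⟩ ⟨i', k'⟩
    -- In this order the entries of `v` are adjacent, so the sum over the first index has to be the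
    -- inner one; for `mul_star` it is the other way round, because `A` is not commutative.
    simp only [mul_apply, kron_apply, conjTranspose_apply, StarMul.star_mul, Fintype.sum_prod_type_right]
    have h : ∀ j, ∑ l, star (w j k) * star (v l i) * (v l i' * w j k') =
        star (w j k) * (vᴴ * v) i i' * w j k' := by
      intro j
      simp only [mul_apply, Finset.mul_sum, Finset.sum_mul, conjTranspose_apply, mul_assoc]
    simp only [h, hv.star_mul]
    have h2 := congrFun (congrFun hw.star_mul k) k'
    simp only [mul_apply, conjTranspose_apply] at h2
    by_cases hk : i = i'
    · subst hk
      simp only [one_apply_eq, mul_one, h2]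
      simp [one_apply]
    · simp [hk, one_apply]

theorem coeffs_le_directSum_left (v : Matrix κ κ A) (w : Matrix μ μ A) :
    coeffs v ≤ coeffs (fromBlocks v 0 0 w) := by
  refine Submodule.span_le.2 ?_
  rintro _ ⟨⟨i, j⟩, rfl⟩
  exact mem_coeffs (fromBlocks v 0 0 w) (Sum.inl i) (Sum.inl j)

theorem coeffs_le_directSum_right (v : Matrix κ κ A) (w : Matrix μ μ A) :
    coeffs w ≤ coeffs (fromBlocks v 0 0 w) := by
  refine Submodule.span_le.2 ?_
  rintro _ ⟨⟨i, j⟩, rfl⟩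
  exact mem_coeffs (fromBlocks v 0 0 w) (Sum.inr i) (Sum.inr j)

theorem mul_mem_coeffs_kron {v : Matrix κ κ A} {w : Matrix μ μ A} {a b : A} (ha : a ∈ coeffs v)
    (hb : b ∈ coeffs w) : a * b ∈ coeffs (kron v w) := by
  refine Submodule.mul_le.1 ?_ a ha b hb
  unfold coeffs
  rw [Submodule.span_mul_span, Submodule.span_le]
  rintro _ ⟨_, ⟨⟨i, j⟩, rfl⟩, _, ⟨⟨k, l⟩, rfl⟩, rfl⟩
  exact mem_coeffs (kron v w) (i, k) (j, l)

theorem mem_coeffs_iff {v : Matrix κ κ A} {a : A} :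
    a ∈ coeffs v ↔ ∃ c : κ × κ → ℂ, ∑ p, c p • v p.1 p.2 = a :=
  Submodule.mem_span_range_iff_exists_fun ℂ

/-! The matrix of a unitary in `B(H) ⊗ A`. -/

section Matrixify

variable {H : Type*} [NormedAddCommGroup H] [InnerProductSpace ℂ H] [FiniteDimensional ℂ H]

/-- The matrix with entries in `B` of an element of `B(H) ⊗ B`, in an orthonormal basis of `H`. -/
def toMatrixAlg (b : OrthonormalBasis κ ℂ H) (B : Type*) [Ring B] [Algebra ℂ B] :
    Module.End ℂ H ⊗[ℂ] B →ₐ[ℂ] Matrix κ κ B :=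
  Algebra.TensorProduct.lift
    ((Algebra.ofId ℂ B).mapMatrix.comp
      (LinearMap.toMatrixOrthonormal b : _ →ₐ[ℂ] Matrix κ κ ℂ))
    (Matrix.scalarAlgHom κ ℂ)
    (fun x y => show Commute _ _ by
      ext i j
      simp [Matrix.scalar_apply, Algebra.ofId_apply, Algebra.commutes])

theorem toMatrixAlg_tmul (b : OrthonormalBasis κ ℂ H) {B : Type*} [Ring B] [Algebra ℂ B]
    (x : Module.End ℂ H) (y : B) (i j : κ) :
    toMatrixAlg b B (x ⊗ₜ y) i j = (inner ℂ (b i) (x (b j)) : ℂ) • y := by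
  rw [← LinearMap.toMatrixOrthonormal_apply_apply, toMatrixAlg, Algebra.TensorProduct.lift_tmul,
    Algebra.smul_def]
  exact Matrix.mul_diagonal _ _ _ _

theorem toMatrixAlg_map (b : OrthonormalBasis κ ℂ H) {B C : Type*} [Ring B] [Algebra ℂ B]
    [Ring C] [Algebra ℂ C] (f : B →ₐ[ℂ] C) (U : Module.End ℂ H ⊗[ℂ] B) :
    toMatrixAlg b C (Algebra.TensorProduct.map (AlgHom.id ℂ (Module.End ℂ H)) f U) =
      (toMatrixAlg b B U).map f := by
  ext i j
  induction U with
  | zero => simp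
  | add x y hx hy => simp [hx, hy]
  | tmul x y => simp [toMatrixAlg_tmul]

theorem toMatrixAlg_star [StarModule ℂ A] (b : OrthonormalBasis κ ℂ H) (U : Module.End ℂ H ⊗[ℂ] A) :
    toMatrixAlg b A (star U) = (toMatrixAlg b A U)ᴴ := by
  ext i j
  induction U with
  | zero => simp
  | add x y hx hy => simp only [star_add, map_add, Matrix.add_apply, hx, hy, conjTranspose_add]
  | tmul x y =>
    rw [TensorProduct.star_tmul, toMatrixAlg_tmul, conjTranspose_apply, toMatrixAlg_tmul, star_smul,
      LinearMap.star_eq_adjoint, LinearMap.adjoint_inner_right]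
    simp

theorem UnitaryRep.isUnitaryCorep [StarModule ℂ A] (V : UnitaryRep A H) (b : OrthonormalBasis κ ℂ H) :
    IsUnitaryCorep (toMatrixAlg b A V.U) where
  comul i j := by
    have h := congrArg (toMatrixAlg b (A ⊗[ℂ] A)) V.comul
    rw [map_mul, toMatrixAlg_map, toMatrixAlg_map, toMatrixAlg_map] at h
    have := congrFun (congrFun h i) j
    simpa [mul_apply] using this
  mul_star := by
    rw [← toMatrixAlg_star, ← map_mul]
    exact (congrArg (toMatrixAlg b A) (Unitary.mul_star_self_of_mem V.unitary)).trans
      (toMatrixAlg b A).toRingHom.map_one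
  star_mul := by
    rw [← toMatrixAlg_star, ← map_mul]
    exact (congrArg (toMatrixAlg b A) (Unitary.star_mul_self_of_mem V.unitary)).trans
      (toMatrixAlg b A).toRingHom.map_one

theorem coaction_apply_basis (b : OrthonormalBasis κ ℂ H) (U : Module.End ℂ H ⊗[ℂ] A) (j : κ) :
    coaction U (b j) = ∑ i, b i ⊗ₜ toMatrixAlg b A U i j := by
  induction U with
  | zero => simp [coaction]
  | add x y hx hy =>
    simp only [coaction, map_add, LinearMap.add_apply, Matrix.add_apply, TensorProduct.tmul_add,
      Finset.sum_add_distrib] at hx hy ⊢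
    rw [hx, hy]
  | tmul x y =>
    simp only [toMatrixAlg_tmul, ← TensorProduct.smul_tmul, ← TensorProduct.sum_tmul]
    rw [b.sum_repr']
    simp [coaction]

theorem slice_mem_coeffs (b : OrthonormalBasis κ ℂ H) (U : Module.End ℂ H ⊗[ℂ] A)
    (ω : Module.End ℂ H →ₗ[ℂ] ℂ) :
    TensorProduct.lid ℂ A (ω.rTensor A U) ∈ coeffs (toMatrixAlg b A U) := by
  rw [mem_coeffs_iff]
  refine ⟨fun p => ω ((LinearMap.toMatrixOrthonormal b).symm (Matrix.single p.1 p.2 1)), ?_⟩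
  induction U with
  | zero => simp
  | add x y hx hy => simp only [map_add, Matrix.add_apply, smul_add, Finset.sum_add_distrib, hx, hy]
  | tmul x y =>
    simp only [toMatrixAlg_tmul, LinearMap.rTensor_tmul, TensorProduct.lid_tmul, smul_smul,
      ← Finset.sum_smul]
    congr 1
    have : x = ∑ p : κ × κ, (inner ℂ (b p.1) (x (b p.2)) : ℂ) •
        (LinearMap.toMatrixOrthonormal b).symm (Matrix.single p.1 p.2 1) := by
      apply (LinearMap.toMatrixOrthonormal b).injective
      change LinearMap.toMatrixOrthonormal b x = LinearMap.toMatrixOrthonormal b _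
      rw [map_sum, Fintype.sum_prod_type, Matrix.matrix_eq_sum_single
        (LinearMap.toMatrixOrthonormal b x)]
      refine Finset.sum_congr rfl fun i _ => Finset.sum_congr rfl fun j _ => ?_
      rw [map_smul, StarAlgEquiv.apply_symm_apply, Matrix.smul_single, smul_eq_mul, mul_one,
        LinearMap.toMatrixOrthonormal_apply_apply]
    conv_rhs => rw [this]
    simp [mul_comm]

end Matrixify

/-- Direct sums and tensor products of unitary corepresentations show that their coefficients are
closed under sums and products. The generators and the scalars are coefficients, so nothing else is
left. -/
theorem exists_mem_coeffs [StarModule ℂ A] [CompactQuantumGroup A] (a : A) :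
    ∃ (n : Type) (_ : Fintype n) (_ : DecidableEq n) (v : Matrix n n A),
      IsUnitaryCorep v ∧ a ∈ coeffs v := by
  have ha : a ∈ (⊤ : Subalgebra ℂ A) := trivial
  rw [← CompactQuantumGroup.generated (A := A)] at ha
  induction ha using Algebra.adjoin_induction with
  | mem x hx =>
    obtain ⟨n, V, ω, rfl⟩ := hx
    exact ⟨Fin n, inferInstance, inferInstance, _,
      V.isUnitaryCorep (EuclideanSpace.basisFun (Fin n) ℂ), slice_mem_coeffs _ _ _⟩
  | algebraMap r =>
    refine ⟨Unit, inferInstance, inferInstance, 1, isUnitaryCorep_one, ?_⟩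
    rw [Algebra.algebraMap_eq_smul_one]
    exact Submodule.smul_mem _ _ (by simpa using mem_coeffs (1 : Matrix Unit Unit A) () ())
  | add x y _ _ hx hy =>
    obtain ⟨n, _, _, v, hv, hvs⟩ := hx
    obtain ⟨m, _, _, w, hw, hws⟩ := hy
    exact ⟨n ⊕ m, inferInstance, inferInstance, _, hv.directSum hw,
      add_mem (coeffs_le_directSum_left _ _ hvs) (coeffs_le_directSum_right _ _ hws)⟩
  | mul x y _ _ hx hy =>
    obtain ⟨n, _, _, v, hv, hvs⟩ := hx
    obtain ⟨m, _, _, w, hw, hws⟩ := hy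
    exact ⟨n × m, inferInstance, inferInstance, _, hv.kron hw, mul_mem_coeffs_kron hvs hws⟩

/-- Finitely many elements are coefficients of one unitary corepresentation. -/
theorem exists_coeffs_of_finset [StarModule ℂ A] [CompactQuantumGroup A] (s : Finset A) :
    ∃ (n : Type) (_ : Fintype n) (_ : DecidableEq n) (v : Matrix n n A),
      IsUnitaryCorep v ∧ ∀ a ∈ s, a ∈ coeffs v := by
  classical
  induction s using Finset.induction_on with
  | empty => exact ⟨Unit, inferInstance, inferInstance, 1, isUnitaryCorep_one, by simp⟩
  | insert a s ha ih =>
    obtain ⟨n, _, _, v, hv, hvs⟩ := ih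
    obtain ⟨m, _, _, w, hw, hws⟩ := exists_mem_coeffs a
    refine ⟨m ⊕ n, inferInstance, inferInstance, _, hw.directSum hv, fun b hb => ?_⟩
    rcases Finset.mem_insert.1 hb with rfl | hb
    · exact coeffs_le_directSum_left _ _ hws
    · exact coeffs_le_directSum_right _ _ (hvs b hb)

end Corep

/-! ### Invariant functionals -/

section Invariant

open Matrix

variable {A : Type*} [Ring A] [StarRing A] [HopfAlgebra ℂ A]
variable {κ μ : Type} [Fintype κ] [DecidableEq κ] [Fintype μ] [DecidableEq μ]

/-- A complex matrix as a matrix over an algebra. -/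
abbrev scalarMatrix (A : Type*) [Ring A] [Algebra ℂ A] {κ μ : Type} (m : Matrix κ μ ℂ) :
    Matrix κ μ A :=
  m.map (algebraMap ℂ A)

theorem scalarMatrix_mul {ν : Type} (m : Matrix κ μ ℂ) (n : Matrix μ ν ℂ) :
    scalarMatrix A (m * n) = scalarMatrix A m * scalarMatrix A n :=
  Matrix.map_mul

theorem scalarMatrix_one : scalarMatrix A (1 : Matrix κ κ ℂ) = 1 :=
  Matrix.map_one _ (map_zero _) (_root_.map_one _)

/-- The counit is a left inverse of the unit map. -/
theorem algebraMap_injective_of_counit : Function.Injective (algebraMap ℂ A) := fun x y h => by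
  simpa using congrArg (Coalgebra.counit (R := ℂ)) h

theorem scalarMatrix_injective {m n : Matrix κ μ ℂ} (h : scalarMatrix A m = scalarMatrix A n) :
    m = n :=
  Matrix.map_injective algebraMap_injective_of_counit h

theorem scalarMatrix_conjTranspose [StarModule ℂ A] (m : Matrix κ μ ℂ) :
    scalarMatrix A mᴴ = (scalarMatrix A m)ᴴ := by
  ext i j
  exact algebraMap_star_comm (A := A) (m j i)

theorem scalarMatrix_mul_apply {ν : Type} (m : Matrix ν κ ℂ) (v : Matrix κ μ A) (i : ν) (j : μ) :
    (scalarMatrix A m * v) i j = ∑ k, m i k • v k j := by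
  simp [mul_apply, Algebra.smul_def]

theorem mul_scalarMatrix_apply {ν : Type} (v : Matrix κ μ A) (m : Matrix μ ν ℂ) (i : κ) (j : ν) :
    (v * scalarMatrix A m) i j = ∑ k, m k j • v i k := by
  simp [mul_apply, Algebra.smul_def, Algebra.commutes]

/-- Functionals separate the points of matrices over an algebra. -/
theorem matrix_ext_dual {v w : Matrix κ μ A} (h : ∀ f : A →ₗ[ℂ] ℂ, v.map f = w.map f) : v = w := by
  ext i j
  refine sub_eq_zero.1 ((Module.forall_dual_apply_eq_zero_iff ℂ _).1 fun f => ?_)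
  have := congrFun (congrFun (h f) i) j
  simp only [map_apply] at this
  rw [map_sub, this, sub_self]

theorem map_functional_scalarMatrix_mul {ν : Type} (f : A →ₗ[ℂ] ℂ) (m : Matrix ν κ ℂ) (v : Matrix κ μ A) :
    (scalarMatrix A m * v).map f = m * v.map f := by
  ext i j
  simp [mul_apply, ← Algebra.smul_def]

theorem map_functional_mul_scalarMatrix {ν : Type} (f : A →ₗ[ℂ] ℂ) (v : Matrix κ μ A) (m : Matrix μ ν ℂ) :
    (v * scalarMatrix A m).map f = v.map f * m := by
  ext i j
  simp [mul_apply, ← Algebra.commutes, ← Algebra.smul_def, mul_comm]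

/-- The convolution of functionals. -/
def conv (f g : A →ₗ[ℂ] ℂ) : A →ₗ[ℂ] ℂ :=
  (TensorProduct.lid ℂ ℂ).toLinearMap ∘ₗ TensorProduct.map f g ∘ₗ Coalgebra.comul

/-- Convolution as a functional of a translate. If `f` is left invariant at `a`, this form gives
`conv f g a = f a * g 1`. -/
theorem conv_eq_left (f g : A →ₗ[ℂ] ℂ) (a : A) :
    conv f g a = g (TensorProduct.lid ℂ A (f.rTensor A (Coalgebra.comul (R := ℂ) a))) := by
  simp only [conv, LinearMap.comp_apply]
  induction Coalgebra.comul (R := ℂ) a with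
  | zero => simp
  | add x y hx hy => simp only [map_add, hx, hy]
  | tmul x y => simp

theorem conv_eq_right (f g : A →ₗ[ℂ] ℂ) (a : A) :
    conv f g a = f (TensorProduct.rid ℂ A (g.lTensor A (Coalgebra.comul (R := ℂ) a))) := by
  simp only [conv, LinearMap.comp_apply]
  induction Coalgebra.comul (R := ℂ) a with
  | zero => simp
  | add x y hx hy => simp only [map_add, hx, hy]
  | tmul x y => simp [mul_comm]

namespace IsUnitaryCorep

variable {v : Matrix κ κ A} (hv : IsUnitaryCorep v)
include hv

/-- The corepresentation `v` becomes a representation of the convolution algebra of functionals. -/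
theorem map_conv (f g : A →ₗ[ℂ] ℂ) : v.map (conv f g) = v.map f * v.map g := by
  ext i j
  simp [conv, hv.comul, mul_apply]

/-- The counit axiom gives `ε(v) v = v`, and `v` is invertible. -/
theorem map_counit : v.map (Coalgebra.counit (R := ℂ) (A := A)) = 1 := by
  apply scalarMatrix_injective (A := A)
  have h : scalarMatrix A (v.map (Coalgebra.counit (R := ℂ) (A := A))) * v = v := by
    ext i j
    have := Coalgebra.rTensor_counit_comul (R := ℂ) (v i j)
    rw [hv.comul, map_sum] at this
    have := congrArg (TensorProduct.lid ℂ A) this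
    simp only [LinearMap.rTensor_tmul, map_sum, TensorProduct.lid_tmul, one_smul] at this
    rw [scalarMatrix_mul_apply]
    simpa using this
  calc _ = scalarMatrix A (v.map (Coalgebra.counit (R := ℂ) (A := A))) * v * vᴴ := by
        rw [Matrix.mul_assoc, hv.mul_star, Matrix.mul_one]
    _ = _ := by rw [h, hv.mul_star, scalarMatrix_one]

/-- The antipode axiom makes `S(v)` a left inverse of `v`, so it agrees with the inverse `vᴴ`. -/
theorem map_antipode : v.map (HopfAlgebra.antipode ℂ (A := A)) = vᴴ := by
  have h : v.map (HopfAlgebra.antipode ℂ (A := A)) * v = 1 := by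
    ext i j
    have := HopfAlgebra.mul_antipode_rTensor_comul_apply (R := ℂ) (v i j)
    rw [hv.comul, map_sum, map_sum] at this
    simp only [LinearMap.rTensor_tmul, LinearMap.mul'_apply] at this
    have h2 := congrFun (congrFun hv.map_counit i) j
    rw [map_apply] at h2
    rw [mul_apply]
    simp only [map_apply]
    rw [this, h2]
    rcases eq_or_ne i j with rfl | h
    · simp
    · simp [one_apply_ne h]
  calc _ = v.map (HopfAlgebra.antipode ℂ (A := A)) * v * vᴴ := by
        rw [Matrix.mul_assoc, hv.mul_star, Matrix.mul_one]
    _ = _ := by rw [h, Matrix.one_mul]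

end IsUnitaryCorep

variable [StarModule ℂ A]

/-- The adjoint `a ↦ conj (f (S(a)*))` of a functional. -/
def daggerFunctional (f : A →ₗ[ℂ] ℂ) : A →ₗ[ℂ] ℂ where
  toFun a := star (f (star (HopfAlgebra.antipode ℂ a)))
  map_add' a b := by simp
  map_smul' c a := by simp

theorem daggerFunctional_one (f : A →ₗ[ℂ] ℂ) : daggerFunctional f 1 = star (f 1) := by
  simp [daggerFunctional]

/-- Since `S(v) = vᴴ`, this functional is the involution of the dual for which `f ↦ v.map f` is
star-preserving. It makes spaces of matrices `v.map f` star-closed. -/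
theorem IsUnitaryCorep.map_daggerFunctional {v : Matrix κ κ A} (hv : IsUnitaryCorep v)
    (f : A →ₗ[ℂ] ℂ) : v.map (daggerFunctional f) = (v.map f)ᴴ := by
  ext i j
  have h := congrFun (congrFun hv.map_antipode i) j
  simp only [map_apply, conjTranspose_apply] at h
  simp [daggerFunctional, h]

/-- `f` is invariant at `a`. -/
def InvariantAt (f : A →ₗ[ℂ] ℂ) (a : A) : Prop :=
  TensorProduct.lid ℂ A (f.rTensor A (Coalgebra.comul (R := ℂ) a)) = f a • (1 : A) ∧
    TensorProduct.rid ℂ A (f.lTensor A (Coalgebra.comul (R := ℂ) a)) = f a • (1 : A)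

theorem InvariantAt.add {f : A →ₗ[ℂ] ℂ} {a b : A} (ha : InvariantAt f a) (hb : InvariantAt f b) :
    InvariantAt f (a + b) := by
  constructor
  · simp only [map_add, ha.1, hb.1, add_smul]
  · simp only [map_add, ha.2, hb.2, add_smul]

theorem InvariantAt.smul {f : A →ₗ[ℂ] ℂ} {a : A} (ha : InvariantAt f a) (c : ℂ) :
    InvariantAt f (c • a) := by
  constructor
  · simp only [map_smul, ha.1, smul_assoc]
  · simp only [map_smul, ha.2, smul_assoc]

theorem InvariantAt.of_mem_coeffs {f : A →ₗ[ℂ] ℂ} {v : Matrix κ κ A}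
    (h : ∀ i j, InvariantAt f (v i j)) {a : A} (ha : a ∈ coeffs v) : InvariantAt f a := by
  induction ha using Submodule.span_induction with
  | mem x hx => obtain ⟨p, rfl⟩ := hx; exact h _ _
  | zero => simp [InvariantAt]
  | add x y _ _ hx hy => exact hx.add hy
  | smul c x _ hx => exact hx.smul c

/-- Normalized functionals invariant at `a` agree at `a`. -/
theorem InvariantAt.eq {f g : A →ₗ[ℂ] ℂ} {a : A} (hf : InvariantAt f a) (hg : InvariantAt g a)
    (hf1 : f 1 = 1) (hg1 : g 1 = 1) : f a = g a := by
  -- The convolution at `a` is computed twice: it is `f a * g 1` by left invariance of `f`, and `f 1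
  -- * g a` by right invariance of `g`.
  have h1 := conv_eq_left f g a
  have h2 := conv_eq_right f g a
  rw [hf.1, map_smul, hg1, smul_eq_mul, mul_one] at h1
  rw [hg.2, map_smul, hf1, smul_eq_mul, mul_one] at h2
  rw [← h1, h2]

/-- A star-closed left-multiplicatively closed space of matrices that annihilates a complement
of the identity. -/
theorem exists_projection (J : Submodule ℂ (Matrix κ κ ℂ)) (hmul : ∀ x ∈ J, ∀ y ∈ J, x * y ∈ J)
    (hstar : ∀ x ∈ J, xᴴ ∈ J) :
    ∃ e ∈ J, ∀ x ∈ J, x * e = x ∧ e * x = x := by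
  let _ := (1 : Matrix κ κ ℂ).toMatrixNormedAddCommGroup PosDef.one
  let _ := (1 : Matrix κ κ ℂ).toMatrixInnerProductSpace PosSemidef.one
  have hin : ∀ x y : Matrix κ κ ℂ, inner ℂ x y = (y * xᴴ).trace := by
    intro x y
    change (y * 1 * xᴴ).trace = _
    rw [Matrix.mul_one]
  -- For the Hilbert–Schmidt inner product, `e` is the component of `1` in `J` and `p` the
  -- orthogonal one. It will turn out that `p` annihilates `J`, so that `e` is a unit of `J`.
  obtain ⟨e, he, p, hp, hep⟩ := J.exists_add_mem_mem_orthogonal (1 : Matrix κ κ ℂ)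
  have h0 : ∀ x ∈ J, p * x = 0 := by
    intro x hx
    have hpx : p * x ∈ J := by
      have : p * x = x - e * x := by
        rw [← sub_eq_iff_eq_add'.2 hep, Matrix.sub_mul, Matrix.one_mul]
      rw [this]
      exact J.sub_mem hx (hmul _ he _ hx)
    -- The matrix `p x xᴴ` lies in `J`, hence is orthogonal to `p`; their inner product is the
    -- squared Hilbert–Schmidt norm of `p x`.
    have h := (Submodule.mem_orthogonal J p).1 hp _ (hmul _ hpx _ (hstar _ hx))
    rw [hin, conjTranspose_mul, conjTranspose_mul, conjTranspose_conjTranspose] at h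
    have h3 : ((p * x) * (p * x)ᴴ).trace = 0 := by
      rw [conjTranspose_mul, Matrix.mul_assoc]; exact h
    exact trace_mul_conjTranspose_self_eq_zero_iff.1 h3
  have hex : ∀ x ∈ J, e * x = x := by
    intro x hx
    have := congrArg (· * x) hep
    simpa [Matrix.add_mul, h0 x hx] using this.symm
  have hes : eᴴ = e := by
    have h1 := hex _ (hstar _ he)
    have h2 := congrArg conjTranspose h1
    rw [conjTranspose_mul, conjTranspose_conjTranspose] at h2
    rw [← h1, h2]
  refine ⟨e, he, fun x hx => ⟨?_, hex x hx⟩⟩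
  have h := congrArg conjTranspose (hex _ (hstar x hx))
  rwa [conjTranspose_mul, conjTranspose_conjTranspose, hes] at h

/-- There is a normalized functional that is invariant on the coefficients of a unitary
corepresentation. -/
theorem IsUnitaryCorep.exists_invariant {v : Matrix κ κ A} (hv : IsUnitaryCorep v) :
    ∃ f : A →ₗ[ℂ] ℂ, f 1 = 1 ∧ ∀ a ∈ coeffs v, InvariantAt f a := by
  have hc1 : ∀ f g : A →ₗ[ℂ] ℂ, conv f g 1 = f 1 * g 1 := by
    intro f g; simp [conv, Algebra.TensorProduct.one_def]
  let ev : (A →ₗ[ℂ] ℂ) →ₗ[ℂ] ℂ := LinearMap.applyₗ (1 : A)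
  let mp : (A →ₗ[ℂ] ℂ) →ₗ[ℂ] Matrix κ κ ℂ :=
    { toFun := fun f => v.map f
      map_add' := fun f g => by ext; simp
      map_smul' := fun c f => by ext; simp }
  -- The image of the functionals vanishing at `1`. If `e` is its unit, `1 - e` should be the
  -- projection onto the invariant vectors of `v`, which is the value of an invariant functional on
  -- `v`.
  let J : Submodule ℂ (Matrix κ κ ℂ) := (LinearMap.ker ev).map mp
  have hJ : ∀ x, x ∈ J ↔ ∃ f : A →ₗ[ℂ] ℂ, f 1 = 0 ∧ v.map f = x := fun x => by
    simp only [J, Submodule.mem_map, LinearMap.mem_ker]; rfl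
  obtain ⟨e, he, hex⟩ := exists_projection J
    (by
      intro x hx y hy
      obtain ⟨f, hf, rfl⟩ := (hJ x).1 hx
      obtain ⟨g, hg, rfl⟩ := (hJ y).1 hy
      exact (hJ _).2 ⟨conv f g, by rw [hc1, hf, zero_mul], hv.map_conv f g⟩)
    (by
      intro x hx
      obtain ⟨f, hf, rfl⟩ := (hJ x).1 hx
      exact (hJ _).2 ⟨daggerFunctional f, by rw [daggerFunctional_one, hf, star_zero],
        hv.map_daggerFunctional f⟩)
  obtain ⟨f, hf, rfl⟩ := (hJ e).1 he
  -- The counit goes to the identity matrix and `f` to the unit of `J`, so `p` goes to their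
  -- difference, and `f 1 = 0` keeps `p` normalized.
  let p : A →ₗ[ℂ] ℂ := Coalgebra.counit - f
  have hp1 : p 1 = 1 := by simp [p, hf]
  have hvp : v.map p = 1 - v.map f := by
    rw [← hv.map_counit]; ext; simp [p]
  have key : ∀ g : A →ₗ[ℂ] ℂ, v.map (conv g p) = g 1 • v.map p ∧
      v.map (conv p g) = g 1 • v.map p := by
    intro g
    -- Every `g` differs from `g 1` times the counit by a functional vanishing at `1`, and
    -- multiplication by `v.map p` annihilates `J` on both sides.
    have hg : v.map g - g 1 • 1 ∈ J :=
      (hJ _).2 ⟨g - g 1 • Coalgebra.counit, by simp, by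
        rw [← hv.map_counit]; ext; simp⟩
    obtain ⟨h1, h2⟩ := hex _ hg
    rw [hv.map_conv, hv.map_conv, hvp]
    have e1 : (v.map g - g 1 • 1) * (1 - v.map f) = 0 := by
      rw [Matrix.mul_sub, h1, Matrix.mul_one, sub_self]
    have e2 : (1 - v.map f) * (v.map g - g 1 • 1) = 0 := by
      rw [Matrix.sub_mul, h2, Matrix.one_mul, sub_self]
    rw [Matrix.sub_mul, sub_eq_zero] at e1
    rw [Matrix.mul_sub, sub_eq_zero] at e2
    rw [e1, e2]
    simp
  refine ⟨p, hp1, fun a ha => InvariantAt.of_mem_coeffs (fun i j => ?_) ha⟩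
  constructor
  · refine sub_eq_zero.1 ((Module.forall_dual_apply_eq_zero_iff ℂ _).1 fun g => ?_)
    have : conv p g (v i j) = g 1 * p (v i j) := congrFun (congrFun (key g).2 i) j
    rw [map_sub, ← conv_eq_left, map_smul]
    rw [this, smul_eq_mul, mul_comm, sub_self]
  · refine sub_eq_zero.1 ((Module.forall_dual_apply_eq_zero_iff ℂ _).1 fun g => ?_)
    have : conv g p (v i j) = g 1 * p (v i j) := congrFun (congrFun (key g).1 i) j
    rw [map_sub, ← conv_eq_right, map_smul]
    rw [this, smul_eq_mul, mul_comm, sub_self]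

variable (A) in
-- Every finite set of elements has a normalized functional that is invariant there. Such
-- functionals agree wherever both are invariant (`InvariantAt.eq`), so the local choices glue to
-- one linear functional.
theorem exists_invariant_functional [CompactQuantumGroup A] :
    ∃ h : A →ₗ[ℂ] ℂ, h 1 = 1 ∧ ∀ a, InvariantAt h a := by
  classical
  have H : ∀ s : Finset A, ∃ f : A →ₗ[ℂ] ℂ, f 1 = 1 ∧ ∀ a ∈ s, InvariantAt f a := by
    intro s
    obtain ⟨n, _, _, v, hv, hs⟩ := exists_coeffs_of_finset s
    obtain ⟨f, hf, hfi⟩ := hv.exists_invariant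
    exact ⟨f, hf, fun a ha => hfi a (hs a ha)⟩
  choose F hF1 hFi using H
  -- The value chosen at `a` is that of any normalized functional invariant at `a`. Linearity
  -- follows by comparing with one functional that serves all the elements involved.
  have hag : ∀ (a : A) (f : A →ₗ[ℂ] ℂ), f 1 = 1 → InvariantAt f a → F {a} a = f a :=
    fun a f h1 hf => InvariantAt.eq (hFi {a} a (by simp)) hf (hF1 _) h1
  let h : A →ₗ[ℂ] ℂ :=
    { toFun := fun a => F {a} a
      map_add' := fun a b => by
        have ha := hFi {a, b} a (by simp)
        have hb := hFi {a, b} b (by simp)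
        rw [hag a _ (hF1 _) ha, hag b _ (hF1 _) hb, hag (a + b) _ (hF1 _) (ha.add hb), map_add]
      map_smul' := fun c a => by
        have ha := hFi {a} a (by simp)
        rw [hag (c • a) _ (hF1 _) (ha.smul c), map_smul]; rfl }
  refine ⟨h, hF1 _, fun a => ?_⟩
  obtain ⟨n, _, _, v, hv, hs⟩ := exists_mem_coeffs a
  obtain ⟨f, hf, hfi⟩ := hv.exists_invariant
  -- Invariance at `v i j` only involves values on `coeffs v`, because `Δ(v i j)` has both legs
  -- there. It therefore passes from `f` to `h`.
  have hhf : ∀ b ∈ coeffs v, h b = f b := fun b hb => hag b f hf (hfi b hb)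
  refine InvariantAt.of_mem_coeffs (v := v) (fun i j => ?_) hs
  have hij := hfi _ (mem_coeffs v i j)
  unfold InvariantAt at hij ⊢
  rw [hv.comul] at hij ⊢
  simp only [map_sum, LinearMap.rTensor_tmul, LinearMap.lTensor_tmul, TensorProduct.lid_tmul,
    TensorProduct.rid_tmul, hhf _ (mem_coeffs v _ _)] at hij ⊢
  exact hij

end Invariant

/-! ### Positivity of the invariant functional -/

section Positivity

open Matrix

variable {A : Type*} [Ring A] [StarRing A] [HopfAlgebra ℂ A] [StarModule ℂ A]
variable {κ μ : Type} [Fintype κ] [DecidableEq κ] [Fintype μ] [DecidableEq μ]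

theorem scalarMatrix_apply (m : Matrix κ μ ℂ) (i : κ) (j : μ) :
    scalarMatrix A m i j = m i j • (1 : A) :=
  Algebra.algebraMap_eq_smul_one _

theorem sum_comm_pairs {M : Type*} [AddCommMonoid M] (f : κ → κ → κ → κ → M) :
    ∑ i, ∑ k, ∑ l, ∑ j, f i k l j = ∑ l, ∑ j, ∑ i, ∑ k, f i k l j := by
  calc _ = ∑ i, ∑ l, ∑ k, ∑ j, f i k l j := Finset.sum_congr rfl fun i _ => Finset.sum_comm
    _ = ∑ l, ∑ i, ∑ k, ∑ j, f i k l j := Finset.sum_comm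
    _ = ∑ l, ∑ i, ∑ j, ∑ k, f i k l j :=
      Finset.sum_congr rfl fun l _ => Finset.sum_congr rfl fun i _ => Finset.sum_comm
    _ = _ := Finset.sum_congr rfl fun l _ => Finset.sum_comm

theorem IsUnitaryCorep.comul_star_apply [CompactQuantumGroup A] {v : Matrix κ κ A}
    (hv : IsUnitaryCorep v) (i j : κ) :
    Coalgebra.comul (R := ℂ) (star (v i j)) = ∑ k, star (v i k) ⊗ₜ[ℂ] star (v k j) := by
  rw [CompactQuantumGroup.comul_star, hv.comul, star_sum]
  rfl

/-- The linear combination of the coefficients of `w` with given coefficients. -/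
def coeffMap (w : Matrix μ μ A) : EuclideanSpace ℂ (μ × μ) →ₗ[ℂ] A :=
  ∑ p : μ × μ, (EuclideanSpace.proj (𝕜 := ℂ) p).toLinearMap.smulRight (w p.1 p.2)

theorem coeffMap_apply (w : Matrix μ μ A) (y : EuclideanSpace ℂ (μ × μ)) :
    coeffMap w y = ∑ p, y p • w p.1 p.2 := by
  simp [coeffMap]

/-- Right translation by `f` on the coefficients of `w` is the action of the multiple `1 ⊗ w` on
coefficient vectors. In particular the kernel of `coeffMap w` is invariant under that action. -/
theorem coeffMap_toEuclideanLin {w : Matrix μ μ A} (hw : IsUnitaryCorep w) (f : A →ₗ[ℂ] ℂ)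
    (y : EuclideanSpace ℂ (μ × μ)) :
    coeffMap w (Matrix.toEuclideanLin ((kron (1 : Matrix μ μ A) w).map f) y) =
      TensorProduct.rid ℂ A (f.lTensor A (Coalgebra.comul (R := ℂ) (coeffMap w y))) := by
  simp only [coeffMap_apply, map_sum, map_smul, hw.comul, LinearMap.lTensor_tmul,
    TensorProduct.rid_tmul]
  have h : ∀ p : μ × μ, (Matrix.toEuclideanLin ((kron (1 : Matrix μ μ A) w).map f) y) p =
      ∑ b', f (w p.2 b') * y (p.1, b') := by
    rintro ⟨a, b⟩
    rw [Matrix.toLpLin_apply]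
    change ∑ q : μ × μ, f (kron (1 : Matrix μ μ A) w (a, b) q) * y q = _
    rw [Fintype.sum_prod_type, Finset.sum_eq_single a]
    · simp [kron_apply]
    · intro a' _ ha'
      simp [kron_apply, one_apply_ne (Ne.symm ha')]
    · simp
  simp only [h, Fintype.sum_prod_type, Finset.sum_smul, Finset.smul_sum, smul_smul]
  refine Finset.sum_congr rfl fun a _ => ?_
  rw [Finset.sum_comm]
  refine Finset.sum_congr rfl fun b _ => Finset.sum_congr rfl fun c _ => ?_
  rw [mul_comm]

/-- The conjugate of a unitary corepresentation is unitarizable: it admits an invariant positive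
definite form, written as a sum of squares. -/
theorem IsUnitaryCorep.exists_invariant_form [CompactQuantumGroup A] {v : Matrix κ κ A}
    (hv : IsUnitaryCorep v) :
    ∃ (ν : Type) (_ : Fintype ν) (t : κ → Matrix ν κ ℂ),
      (∀ y : Matrix κ κ ℂ, (∀ k, t k * y.map star = 0) → y = 0) ∧
      (v.map star)ᴴ * scalarMatrix A (∑ k, (t k)ᴴ * t k) * v.map star =
        scalarMatrix A (∑ k, (t k)ᴴ * t k) := by
  classical
  obtain ⟨μ, _, _, w, hw, hs⟩ := exists_coeffs_of_finset
    (Finset.univ.image fun p : κ × κ => star (v p.1 p.2))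
  -- The entries of the conjugate of `v` are coefficients of the unitary `w`. The aim is to embed
  -- the conjugate of `v` into multiples of `w` and pull back the invariant inner product.
  let W := CQG.kron (1 : Matrix μ μ A) w
  have hW : IsUnitaryCorep W := isUnitaryCorep_one.kron hw
  let K := LinearMap.ker (coeffMap w)
  have hKinv : ∀ (f : A →ₗ[ℂ] ℂ), ∀ y ∈ K, Matrix.toEuclideanLin (W.map f) y ∈ K := by
    intro f y hy
    rw [LinearMap.mem_ker] at hy ⊢
    rw [coeffMap_toEuclideanLin hw, hy]
    simp
  -- The adjoint of `W.map f` is again of the form `W.map g`, so the orthogonal complement of an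
  -- invariant subspace is invariant.
  have hKorth : ∀ (f : A →ₗ[ℂ] ℂ), ∀ y ∈ Kᗮ, Matrix.toEuclideanLin (W.map f) y ∈ Kᗮ := by
    intro f y hy
    rw [Submodule.mem_orthogonal]
    intro z hz
    rw [← LinearMap.adjoint_inner_left, ← Matrix.toEuclideanLin_conjTranspose_eq_adjoint,
      ← hW.map_daggerFunctional]
    exact (Submodule.mem_orthogonal K y).1 hy _ (hKinv _ z hz)
  -- On `Kᗮ` the map `coeffMap w` is injective, so `star (v k j)` has a unique lift there. For fixed
  -- `k` these lifts are the columns of `t k`.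
  have hlift : ∀ k j, ∃ y ∈ Kᗮ, coeffMap w y = star (v k j) := by
    intro k j
    obtain ⟨c, hc⟩ := mem_coeffs_iff.1 (hs (star (v k j))
      (Finset.mem_image.2 ⟨(k, j), Finset.mem_univ _, rfl⟩))
    obtain ⟨z, hz, y, hy, hzy⟩ := K.exists_add_mem_mem_orthogonal (WithLp.toLp 2 c)
    refine ⟨y, hy, ?_⟩
    have h1 : coeffMap w (WithLp.toLp 2 c) = star (v k j) := by rw [coeffMap_apply]; exact hc
    rwa [hzy, map_add, LinearMap.mem_ker.1 hz, zero_add] at h1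
  choose y hy hyv using hlift
  let t : κ → Matrix (μ × μ) κ ℂ := fun k => Matrix.of fun p j => y k j p
  have hinter : ∀ k, W * scalarMatrix A (t k) = scalarMatrix A (t k) * v.map star := by
    intro k
    refine matrix_ext_dual fun f => ?_
    rw [map_functional_mul_scalarMatrix, map_functional_scalarMatrix_mul]
    -- Both sides lie in `Kᗮ` and have the same image under `coeffMap w`, by the formula for `Δ
    -- (star (v k j))`; so their difference lies in `K ∩ Kᗮ = 0`.
    have hcol : ∀ j, Matrix.toEuclideanLin (W.map f) (y k j) = ∑ i, f (star (v i j)) • y k i := by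
      intro j
      refine sub_eq_zero.1 (Submodule.disjoint_def.1 K.orthogonal_disjoint _ ?_ ?_)
      · rw [LinearMap.mem_ker, map_sub, coeffMap_toEuclideanLin hw, hyv, hv.comul_star_apply]
        simp [hyv]
      · exact Submodule.sub_mem _ (hKorth f _ (hy k j))
          (Submodule.sum_mem _ fun i _ => Submodule.smul_mem _ _ (hy k i))
    ext p j
    have := congrArg (fun z : EuclideanSpace ℂ (μ × μ) => z p) (hcol j)
    rw [Matrix.toLpLin_apply] at this
    rw [mul_apply, mul_apply]
    simp only [WithLp.ofLp_sum, WithLp.ofLp_smul, Finset.sum_apply, Pi.smul_apply, smul_eq_mul] at this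
    refine Eq.trans ?_ (this.trans ?_)
    · rfl
    · exact Finset.sum_congr rfl fun i _ => mul_comm _ _
  refine ⟨μ × μ, inferInstance, t, ?_, ?_⟩
  · intro z hz
    -- Applying `coeffMap w` to the vanishing combination of lifts and then `star` gives the entries
    -- of `v z`; unitarity of `v` then gives `z = 0`.
    have h0 : v * scalarMatrix A z = 0 := by
      ext k j
      rw [mul_scalarMatrix_apply]
      have h1 : ∑ i, star (z i j) • y k i = 0 := by
        ext p
        have := congrFun (congrFun (hz k) p) j
        rw [mul_apply] at this
        simp only [WithLp.ofLp_sum, WithLp.ofLp_smul, Finset.sum_apply, Pi.smul_apply, smul_eq_mul]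
        refine Eq.trans ?_ this
        exact Finset.sum_congr rfl fun i _ => mul_comm _ _
      have h2 := congrArg star (congrArg (coeffMap w) h1)
      simpa [hyv] using h2
    apply scalarMatrix_injective (A := A)
    calc scalarMatrix A z = vᴴ * (v * scalarMatrix A z) := by
          rw [← Matrix.mul_assoc, hv.star_mul, Matrix.one_mul]
      _ = scalarMatrix A 0 := by rw [h0]; ext; simp
  · have hsum : scalarMatrix A (∑ k, (t k)ᴴ * t k) =
        ∑ k, (scalarMatrix A (t k))ᴴ * scalarMatrix A (t k) := by
      have : ∀ k, (scalarMatrix A (t k))ᴴ * scalarMatrix A (t k) = scalarMatrix A ((t k)ᴴ * t k) :=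
        fun k => by rw [scalarMatrix_mul, scalarMatrix_conjTranspose]
      rw [Finset.sum_congr rfl fun k _ => this k]
      exact map_sum (algebraMap ℂ A).mapMatrix _ _
    rw [hsum, Matrix.mul_sum, Matrix.sum_mul]
    refine Finset.sum_congr rfl fun k _ => ?_
    calc (v.map star)ᴴ * ((scalarMatrix A (t k))ᴴ * scalarMatrix A (t k)) * v.map star
        = (scalarMatrix A (t k) * v.map star)ᴴ * (scalarMatrix A (t k) * v.map star) := by
          rw [conjTranspose_mul]; simp only [Matrix.mul_assoc]
      _ = (scalarMatrix A (t k))ᴴ * (Wᴴ * W) * scalarMatrix A (t k) := by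
          rw [← hinter k, conjTranspose_mul]; simp only [Matrix.mul_assoc]
      _ = _ := by rw [hW.star_mul, Matrix.mul_one]

/-- The average of a matrix over a compact quantum group. -/
def average (h : A →ₗ[ℂ] ℂ) (v : Matrix κ κ A) (T : Matrix κ κ ℂ) : Matrix κ κ ℂ :=
  (v * scalarMatrix A T * vᴴ).map h

theorem mul_scalarMatrix_mul_apply (v : Matrix κ κ A) (w : Matrix κ κ A) (T : Matrix κ κ ℂ)
    (i k : κ) : (v * scalarMatrix A T * w) i k = ∑ l, ∑ j, T j l • (v i j * w l k) := by
  rw [mul_apply]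
  simp only [mul_scalarMatrix_apply, Finset.sum_mul, smul_mul_assoc]

/-- Averages of matrices are intertwiners. -/
theorem average_intertwines [CompactQuantumGroup A] {h : A →ₗ[ℂ] ℂ}
    (hinv : ∀ a, InvariantAt h a) {v : Matrix κ κ A} {w : Matrix μ μ A} (hv : IsUnitaryCorep v)
    (hw : IsUnitaryCorep w) (T : Matrix κ μ ℂ) :
    v * scalarMatrix A ((v * scalarMatrix A T * wᴴ).map h) =
      scalarMatrix A ((v * scalarMatrix A T * wᴴ).map h) * w := by
  have e : ∀ (x : Matrix κ κ A) (T : Matrix κ μ ℂ) (y : Matrix μ μ A) i k,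
      (x * scalarMatrix A T * y) i k = ∑ l, ∑ j, T j l • (x i j * y l k) := fun x T y i k => by
    rw [mul_apply]
    simp only [mul_scalarMatrix_apply, Finset.sum_mul, smul_mul_assoc]
  have key : v * scalarMatrix A ((v * scalarMatrix A T * wᴴ).map h) * wᴴ =
      scalarMatrix A ((v * scalarMatrix A T * wᴴ).map h) := by
    ext i k
    -- Let `E` be the average. Applying `ι ⊗ h` to the comultiplication of an entry of `v T wᴴ`
    -- gives that entry of `v E wᴴ`, while invariance gives the scalar entry of `E`.
    have h1 := (hinv ((v * scalarMatrix A T * wᴴ) i k)).2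
    rw [scalarMatrix_apply, Matrix.map_apply, ← h1, e, e]
    simp only [Matrix.map_apply, e, map_sum, map_smul, conjTranspose_apply, Bialgebra.comul_mul,
      hv.comul, hw.comul_star_apply, Finset.sum_mul_sum, Algebra.TensorProduct.tmul_mul_tmul,
      LinearMap.lTensor_tmul, TensorProduct.rid_tmul, Finset.sum_smul, Finset.smul_sum, smul_smul,
      smul_eq_mul]
    calc _ = ∑ l, ∑ j, ∑ l', ∑ j', (T j' l' * h (v j j' * star (w l l'))) •
          (v i j * star (w k l)) := rfl
      _ = ∑ l, ∑ l', ∑ j, ∑ j', (T j' l' * h (v j j' * star (w l l'))) •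
          (v i j * star (w k l)) := Finset.sum_congr rfl fun l _ => Finset.sum_comm
      _ = ∑ l', ∑ l, ∑ j, ∑ j', (T j' l' * h (v j j' * star (w l l'))) •
          (v i j * star (w k l)) := Finset.sum_comm
      _ = ∑ l', ∑ l, ∑ j', ∑ j, (T j' l' * h (v j j' * star (w l l'))) •
          (v i j * star (w k l)) :=
        Finset.sum_congr rfl fun l' _ => Finset.sum_congr rfl fun l _ => Finset.sum_comm
      _ = ∑ l', ∑ j', ∑ l, ∑ j, (T j' l' * h (v j j' * star (w l l'))) •
          (v i j * star (w k l)) := Finset.sum_congr rfl fun l' _ => Finset.sum_comm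
      _ = ∑ l', ∑ j', ∑ j, ∑ l, (T j' l' * h (v j j' * star (w l l'))) •
          (v i j * star (w k l)) :=
        Finset.sum_congr rfl fun l' _ => Finset.sum_congr rfl fun j' _ => Finset.sum_comm
      _ = _ := rfl
  calc _ = v * scalarMatrix A ((v * scalarMatrix A T * wᴴ).map h) * wᴴ * w := by
        rw [Matrix.mul_assoc _ wᴴ w, hw.star_mul, Matrix.mul_one]
    _ = _ := by rw [key]

theorem average_invariant [CompactQuantumGroup A] {h : A →ₗ[ℂ] ℂ} (hinv : ∀ a, InvariantAt h a)
    {v : Matrix κ κ A} (hv : IsUnitaryCorep v) (T : Matrix κ κ ℂ) :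
    v * scalarMatrix A (average h v T) = scalarMatrix A (average h v T) * v :=
  average_intertwines hinv hv hv T

/-- An intertwiner can be pulled out of the average on both sides. It is used for spectral
projections of averages. -/
theorem average_mul_mul (h : A →ₗ[ℂ] ℂ) {v : Matrix κ κ A} (T p : Matrix κ κ ℂ)
    (hp : v * scalarMatrix A p = scalarMatrix A p * v)
    (hp' : vᴴ * scalarMatrix A p = scalarMatrix A p * vᴴ) :
    average h v (p * T * p) = p * average h v T * p := by
  unfold average
  rw [← map_functional_scalarMatrix_mul, ← map_functional_mul_scalarMatrix, scalarMatrix_mul,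
    scalarMatrix_mul]
  congr 1
  rw [← Matrix.mul_assoc, ← Matrix.mul_assoc, hp, Matrix.mul_assoc _ _ vᴴ, ← hp']
  simp only [Matrix.mul_assoc]

/-- Averages of positive matrices are positive. -/
theorem average_posSemidef [CompactQuantumGroup A] {h : A →ₗ[ℂ] ℂ} (h1 : h 1 = 1)
    (hinv : ∀ a, InvariantAt h a) {v : Matrix κ κ A} (hv : IsUnitaryCorep v)
    {ι : Type} [Fintype ι] (x : Matrix κ ι ℂ) :
    (average h v (x * xᴴ)).PosSemidef := by
  -- The functional `a ↦ star (h (star a))` is also normalized and invariant, so it equals `h` by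
  -- uniqueness.
  have hstar : ∀ a, h (star a) = star (h a) := by
    let g : A →ₗ[ℂ] ℂ :=
      { toFun := fun a => star (h (star a))
        map_add' := fun a b => by simp
        map_smul' := fun c a => by simp }
    have hg : ∀ a, InvariantAt g a := by
      intro a
      have ha := hinv (star a)
      unfold InvariantAt at ha ⊢
      rw [CompactQuantumGroup.comul_star] at ha
      have e1 : ∀ z : A ⊗[ℂ] A, TensorProduct.lid ℂ A (g.rTensor A z) =
          star (TensorProduct.lid ℂ A (h.rTensor A (star z))) := by
        intro z
        induction z with
        | zero => simp
        | add x y hx hy => simp only [map_add, star_add, hx, hy]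
        | tmul x y => simp [g, TensorProduct.star_tmul]
      have e2 : ∀ z : A ⊗[ℂ] A, TensorProduct.rid ℂ A (g.lTensor A z) =
          star (TensorProduct.rid ℂ A (h.lTensor A (star z))) := by
        intro z
        induction z with
        | zero => simp
        | add x y hx hy => simp only [map_add, star_add, hx, hy]
        | tmul x y => simp [g, TensorProduct.star_tmul]
      rw [e1, e2, ha.1, ha.2]
      simp [g]
    intro a
    have := (hg (star a)).eq (hinv (star a)) (by simp [g, h1]) h1
    rw [← this]
    simp [g]
  obtain ⟨ν, _, t, ht, hF⟩ := hv.exists_invariant_form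
  set F := ∑ k, (t k)ᴴ * t k with hFdef
  -- the invariant functional
  let φ : Matrix κ κ ℂ → ℂ := fun T => (T * Fᵀ).trace
  have hφsum : ∀ T : Matrix κ κ ℂ, φ T = ∑ i, ∑ k, T i k * F i k := by
    intro T
    simp only [φ, Matrix.trace, Matrix.diag, mul_apply, transpose_apply]
  -- This is the invariance of the form `F`, read entrywise and integrated by `h`.
  have hφ : ∀ T, φ (average h v T) = φ T := by
    intro T
    have hFe : ∀ j l, ∑ i, ∑ k, F i k • (v i j * star (v k l)) = F j l • (1 : A) := by
      intro j l
      have := congrFun (congrFun hF j) l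
      rw [mul_scalarMatrix_mul_apply, scalarMatrix_apply] at this
      rw [← this, Finset.sum_comm]
      simp
    rw [hφsum, hφsum]
    have e1 : ∀ j l, F j l = ∑ i, ∑ k, F i k * h (v i j * star (v k l)) := by
      intro j l
      have := congrArg h (hFe j l)
      simpa [h1] using this.symm
    calc _ = ∑ i, ∑ k, ∑ l, ∑ j, T j l * (F i k * h (v i j * star (v k l))) := by
          refine Finset.sum_congr rfl fun i _ => Finset.sum_congr rfl fun k _ => ?_
          rw [average, Matrix.map_apply, mul_scalarMatrix_mul_apply]
          simp only [map_sum, map_smul, Finset.sum_mul, conjTranspose_apply, smul_eq_mul]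
          refine Finset.sum_congr rfl fun l _ => Finset.sum_congr rfl fun j _ => by ring
      _ = ∑ l, ∑ j, ∑ i, ∑ k, T j l * (F i k * h (v i j * star (v k l))) := by
          rw [sum_comm_pairs]
      _ = ∑ l, ∑ j, T j l * F j l := by
          refine Finset.sum_congr rfl fun l _ => Finset.sum_congr rfl fun j _ => ?_
          conv_rhs => rw [e1 j l]
          simp only [Finset.mul_sum]
      _ = _ := Finset.sum_comm
  have hφsq : ∀ (τ : Type) [Fintype τ] (y : Matrix κ τ ℂ),
      φ (y * yᴴ) = ∑ k, ((t k * y.map star)ᴴ * (t k * y.map star)).trace := by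
    intro τ _ y
    have e : ∀ k, ((t k * y.map star)ᴴ * (t k * y.map star)).trace =
        (y * yᴴ * ((t k)ᴴ * t k)ᵀ).trace := by
      intro k
      rw [← Matrix.trace_transpose]
      have e3 : (y.map star)ᵀ = yᴴ := rfl
      have e4 : ((y.map star)ᴴ)ᵀ = y := by ext; simp
      rw [conjTranspose_mul, Matrix.mul_assoc, transpose_mul, e4, ← Matrix.mul_assoc, transpose_mul, e3,
        Matrix.trace_mul_comm, Matrix.mul_assoc]
    simp only [e, φ, hFdef, Matrix.transpose_sum, Matrix.mul_sum, Matrix.trace_sum]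
  have hφnn : ∀ (τ : Type) [Fintype τ] (y : Matrix κ τ ℂ), 0 ≤ φ (y * yᴴ) := by
    intro τ _ y
    rw [hφsq]
    exact Finset.sum_nonneg fun k _ => (posSemidef_conjTranspose_mul_self _).trace_nonneg
  have hφz : ∀ y : Matrix κ κ ℂ, φ (y * yᴴ) = 0 → y = 0 := by
    intro y hy
    rw [hφsq, Finset.sum_eq_zero_iff_of_nonneg
      (fun k _ => (posSemidef_conjTranspose_mul_self _).trace_nonneg)] at hy
    exact ht y fun k => trace_conjTranspose_mul_self_eq_zero_iff.1 (hy k (Finset.mem_univ k))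
  set s := average h v (x * xᴴ) with hs
  have hsa : IsSelfAdjoint s := by
    ext i k
    have e : ((v * scalarMatrix A (x * xᴴ) * vᴴ)ᴴ) = v * scalarMatrix A (x * xᴴ) * vᴴ := by
      rw [conjTranspose_mul, conjTranspose_mul, conjTranspose_conjTranspose,
        ← scalarMatrix_conjTranspose, conjTranspose_mul, conjTranspose_conjTranspose,
        Matrix.mul_assoc]
    have e2 := congrFun (congrFun e i) k
    rw [conjTranspose_apply] at e2
    change star (h _) = h _
    rw [← hstar, e2]
  have hherm : s.IsHermitian := hsa
  rw [hherm.posSemidef_iff_eigenvalues_nonneg]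
  -- Let `p` be the spectral projection of `s` for a negative eigenvalue. As `p` commutes with `v`,
  -- the average of `p x xᴴ p` is `p s p = lam p`. But `φ` is preserved by averaging, is nonnegative
  -- on `p x xᴴ p` and is strictly negative on `lam p`.
  by_contra hneg
  rw [Pi.le_def] at hneg
  push Not at hneg
  obtain ⟨i, hi⟩ := hneg
  set lam := hherm.eigenvalues i with hlam
  replace hi : lam < 0 := hi
  have hspec : lam ∈ spectrum ℝ s := by
    rw [hherm.spectrum_real_eq_range_eigenvalues]; exact ⟨i, rfl⟩
  -- The indicator of the eigenvalue. The spectrum is finite, so every function on it is continuous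
  -- and functional calculus applies.
  let χ : ℝ → ℝ := fun x => if x = lam then 1 else 0
  have hfin : (spectrum ℝ s).Finite := by
    rw [hherm.spectrum_real_eq_range_eigenvalues]; exact Set.finite_range _
  have hcont : ∀ g : ℝ → ℝ, ContinuousOn g (spectrum ℝ s) := fun g => hfin.continuousOn g
  let p := cfc χ s
  have hpsa : pᴴ = p := cfc_predicate (R := ℝ) (p := IsSelfAdjoint) χ s
  have hpp : p * p = p := by
    rw [← cfc_mul χ χ s (hcont _) (hcont _)]
    refine cfc_congr fun z _ => ?_
    simp [χ]
  have hsp : s * p = (lam : ℂ) • p := by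
    have e1 : s * p = cfc (fun z => z * χ z) s := by
      rw [cfc_mul (fun z => z) χ s (hcont _) (hcont _), cfc_id' ℝ s]
    have e2 : lam • p = cfc (fun z => lam * χ z) s := by
      rw [cfc_const_mul lam χ s (hcont _)]
    have e3 : (lam : ℂ) • p = lam • p := by ext; simp
    rw [e3, e1, e2]
    refine cfc_congr fun z _ => ?_
    simp only [χ]
    split_ifs with hz
    · rw [hz]
    · simp
  have hpne : p ≠ 0 := by
    intro hp0
    have := cfc_map_spectrum (R := ℝ) χ s hsa (hcont _)
    have hmem : (1 : ℝ) ∈ spectrum ℝ (cfc χ s) := by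
      rw [this]; exact ⟨lam, hspec, by simp [χ]⟩
    have hp0' : cfc χ s = 0 := hp0
    have : Nontrivial (Matrix κ κ ℂ) := by
      by_contra hcon
      rw [not_nontrivial_iff_subsingleton] at hcon
      have := spectrum.of_subsingleton (R := ℝ) (cfc χ s)
      rw [this] at hmem
      exact hmem
    rw [hp0', spectrum.zero_eq] at hmem
    simp at hmem
  have hpv : v * scalarMatrix A p = scalarMatrix A p * v := by
    refine matrix_ext_dual fun f => ?_
    rw [map_functional_mul_scalarMatrix, map_functional_scalarMatrix_mul]
    -- Spectral projections are available for complex matrices, so the intertwining relation is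
    -- tested through functionals, where it becomes commutation with `v.map f`.
    have hc : Commute s (v.map f) := by
      have := congrArg (fun m : Matrix κ κ A => m.map f) (average_invariant hinv hv (x * xᴴ))
      rw [map_functional_mul_scalarMatrix, map_functional_scalarMatrix_mul] at this
      exact this.symm
    exact (hsa.commute_cfc hc χ).symm
  have hpv' : vᴴ * scalarMatrix A p = scalarMatrix A p * vᴴ := by
    have := congrArg conjTranspose hpv
    rw [conjTranspose_mul, conjTranspose_mul, ← scalarMatrix_conjTranspose, hpsa] at this
    exact this.symm
  have hm := hφ (p * (x * xᴴ) * p)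
  rw [average_mul_mul h _ p hpv hpv', ← hs, Matrix.mul_assoc, hsp, Matrix.mul_smul, hpp] at hm
  have e1 : p * (x * xᴴ) * p = (p * x) * (p * x)ᴴ := by
    rw [conjTranspose_mul, hpsa]; simp only [Matrix.mul_assoc]
  have e2 : φ ((lam : ℂ) • p) = lam * φ (p * pᴴ) := by
    rw [hpsa, hpp]; simp [φ]
  rw [e1, e2] at hm
  have hp1 := hφnn _ p
  have hp2 : φ (p * pᴴ) ≠ 0 := fun h0 => hpne (hφz p h0)
  have hp3 : 0 < φ (p * pᴴ) := lt_of_le_of_ne hp1 hp2.symm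
  have hneg : (lam : ℂ) * φ (p * pᴴ) < 0 :=
    mul_neg_of_neg_of_pos (by exact_mod_cast hi) hp3
  rw [hm] at hneg
  exact absurd (hφnn _ (p * x)) (not_le_of_gt hneg)

end Positivity

/-! ### Existence of the Haar state. -/

section HaarExistence

open Matrix

variable (A : Type*) [Ring A] [StarRing A] [HopfAlgebra ℂ A] [StarModule ℂ A]

/-- A compact quantum group has a Haar state. -/
theorem exists_isHaarState [CompactQuantumGroup A] : ∃ h : A →ₗ[ℂ] ℂ, IsHaarState h := by
  obtain ⟨h, h1, hinv⟩ := exists_invariant_functional A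
  refine ⟨h, h1, fun a => ?_, fun a => (hinv a).1, fun a => (hinv a).2⟩
  -- Averages have the form `v T vᴴ`, so `star a * a` is read as `b * star b` with `b = star a`.
  -- Writing `b = ξ (v ⊗ 1) x` with a scalar row `ξ` and a scalar column `x` gives `h (b * star b)`
  -- as `ξ` times the average of `x xᴴ` times `ξᴴ`.
  obtain ⟨κ, _, _, v, hv, hs⟩ := exists_mem_coeffs (star a)
  obtain ⟨c, hc⟩ := mem_coeffs_iff.1 hs
  have hW : IsUnitaryCorep (kron v (1 : Matrix κ κ A)) := hv.kron isUnitaryCorep_one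
  let ξ : Matrix Unit (κ × κ) ℂ := Matrix.of fun _ p => if p.1 = p.2 then 1 else 0
  let x : Matrix (κ × κ) Unit ℂ := Matrix.of fun p _ => c (p.2, p.1)
  have hb : ∀ u u', (scalarMatrix A ξ * kron v (1 : Matrix κ κ A) * scalarMatrix A x) u u' =
      star a := by
    intro u u'
    rw [mul_scalarMatrix_apply, ← hc]
    rw [Fintype.sum_prod_type, Fintype.sum_prod_type, Finset.sum_comm]
    refine Finset.sum_congr rfl fun i _ => Finset.sum_congr rfl fun j _ => ?_
    have : (scalarMatrix A ξ * kron v (1 : Matrix κ κ A)) u (j, i) = v i j := by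
      rw [scalarMatrix_mul_apply, Finset.sum_eq_single (i, i)]
      · simp [ξ, kron_apply]
      · rintro ⟨k, l⟩ _ hkl
        by_cases h1 : k = l
        · subst h1
          have : k ≠ i := fun h => hkl (by rw [h])
          simp [ξ, kron_apply, one_apply_ne this]
        · simp [ξ, h1]
      · simp
    rw [this]
    rfl
  have hp := (average_posSemidef h1 hinv hW x).mul_mul_conjTranspose_same ξ
  have hd := hp.diag_nonneg (i := ())
  rw [average, ← map_functional_scalarMatrix_mul, ← map_functional_mul_scalarMatrix,
    scalarMatrix_mul, scalarMatrix_conjTranspose, scalarMatrix_conjTranspose] at hd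
  have e : scalarMatrix A ξ * (kron v (1 : Matrix κ κ A) * (scalarMatrix A x * (scalarMatrix A x)ᴴ) *
      (kron v (1 : Matrix κ κ A))ᴴ) * (scalarMatrix A ξ)ᴴ =
      (scalarMatrix A ξ * kron v (1 : Matrix κ κ A) * scalarMatrix A x) *
        (scalarMatrix A ξ * kron v (1 : Matrix κ κ A) * scalarMatrix A x)ᴴ := by
    simp only [conjTranspose_mul, Matrix.mul_assoc]
  rw [e, Matrix.map_apply, mul_apply] at hd
  simpa [hb] using hd

theorem isHaarState_haarState [CompactQuantumGroup A] : IsHaarState (haarState A) := by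
  have h := exists_isHaarState A
  unfold haarState
  rw [dif_pos h]
  exact h.choose_spec

end HaarExistence

/-! ### Operators on Hilbert space tensor products -/

section HilbertTensorTools

variable {K L G : Type*} [NormedAddCommGroup K] [InnerProductSpace ℂ K] [CompleteSpace K]
  [NormedAddCommGroup L] [InnerProductSpace ℂ L] [CompleteSpace L]
  [NormedAddCommGroup G] [NormedSpace ℂ G]

theorem inner_toHilbertTensor_tmul (ξ ζ : K) (η θ : L) :
    inner ℂ (toHilbertTensor (ξ ⊗ₜ[ℂ] η)) (toHilbertTensor (ζ ⊗ₜ[ℂ] θ)) =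
      inner ℂ ξ ζ * inner ℂ η θ := by
  rw [LinearIsometry.inner_map_map, TensorProduct.inner_tmul]

theorem norm_toHilbertTensor_tmul (ξ : K) (η : L) :
    ‖toHilbertTensor (ξ ⊗ₜ[ℂ] η)‖ = ‖ξ‖ * ‖η‖ := by
  rw [LinearIsometry.norm_map, TensorProduct.norm_tmul]

/-- The map `ξ ↦ ξ ⊗ η`. -/
def tensorRight (η : L) : K →L[ℂ] HilbertTensor K L :=
  LinearMap.mkContinuous (toHilbertTensor.toLinearMap ∘ₗ (TensorProduct.mk ℂ K L).flip η) ‖η‖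
    fun ξ => by
      rw [mul_comm]; exact (norm_toHilbertTensor_tmul ξ η).le

/-- The map `η ↦ ξ ⊗ η`. -/
def tensorLeft (ξ : K) : L →L[ℂ] HilbertTensor K L :=
  LinearMap.mkContinuous (toHilbertTensor.toLinearMap ∘ₗ TensorProduct.mk ℂ K L ξ) ‖ξ‖
    fun η => (norm_toHilbertTensor_tmul ξ η).le

theorem hilbertTensor_ext {X Y : HilbertTensor K L →L[ℂ] G}
    (h : ∀ ξ η, X (toHilbertTensor (ξ ⊗ₜ[ℂ] η)) = Y (toHilbertTensor (ξ ⊗ₜ[ℂ] η))) : X = Y := by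
  refine ContinuousLinearMap.coeFn_injective (denseRange_toHilbertTensor.equalizer X.continuous
    Y.continuous (funext fun z => ?_))
  simp only [Function.comp_apply]
  induction z with
  | zero => simp
  | add x y hx hy => rw [map_add, map_add, map_add, hx, hy]
  | tmul x y => exact h x y

/-- Operators on the tensor product are determined on elementary tensors from total sets. -/
theorem hilbertTensor_ext_of_dense {s : Set K} {t : Set L}
    (hs : Dense (Submodule.span ℂ s : Set K)) (ht : Dense (Submodule.span ℂ t : Set L))
    {X Y : HilbertTensor K L →L[ℂ] G}
    (h : ∀ ξ ∈ s, ∀ η ∈ t, X (toHilbertTensor (ξ ⊗ₜ[ℂ] η)) = Y (toHilbertTensor (ξ ⊗ₜ[ℂ] η))) :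
    X = Y := by
  have h1 : ∀ ξ ∈ s, X.comp (tensorLeft ξ) = Y.comp (tensorLeft ξ) := fun ξ hξ =>
    ContinuousLinearMap.ext_on ht fun η hη => h ξ hξ η hη
  have h2 : ∀ η, X.comp (tensorRight η) = Y.comp (tensorRight η) := fun η =>
    ContinuousLinearMap.ext_on hs fun ξ hξ => congrArg (fun Z => Z η) (h1 ξ hξ)
  exact hilbertTensor_ext fun ξ η => congrArg (fun Z => Z ξ) (h2 η)

theorem dense_span_tmul {s : Set K} {t : Set L}
    (hs : Dense (Submodule.span ℂ s : Set K)) (ht : Dense (Submodule.span ℂ t : Set L)) :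
    Dense (Submodule.span ℂ {z : HilbertTensor K L | ∃ ξ ∈ s, ∃ η ∈ t,
      z = toHilbertTensor (ξ ⊗ₜ[ℂ] η)} : Set (HilbertTensor K L)) := by
  set N := Submodule.span ℂ {z : HilbertTensor K L | ∃ ξ ∈ s, ∃ η ∈ t,
      z = toHilbertTensor (ξ ⊗ₜ[ℂ] η)} with hN
  rw [Submodule.dense_iff_topologicalClosure_eq_top]
  have h1 : ∀ ξ ∈ s, ∀ η, toHilbertTensor (ξ ⊗ₜ[ℂ] η) ∈ N.topologicalClosure := by
    intro ξ hξ η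
    have hle : Submodule.span ℂ t ≤
        N.topologicalClosure.comap (tensorLeft (L := L) ξ).toLinearMap := by
      refine Submodule.span_le.2 fun η hη => ?_
      exact N.le_topologicalClosure (Submodule.subset_span ⟨ξ, hξ, η, hη, rfl⟩)
    exact (N.isClosed_topologicalClosure.preimage (tensorLeft ξ).continuous).closure_subset_iff.2
      hle (ht η)
  have h2 : ∀ ξ η, toHilbertTensor (ξ ⊗ₜ[ℂ] η) ∈ N.topologicalClosure := by
    intro ξ η
    have hle : Submodule.span ℂ s ≤
        N.topologicalClosure.comap (tensorRight (K := K) η).toLinearMap := by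
      refine Submodule.span_le.2 fun ξ hξ => ?_
      exact h1 ξ hξ η
    exact (N.isClosed_topologicalClosure.preimage (tensorRight η).continuous).closure_subset_iff.2
      hle (hs ξ)
  rw [eq_top_iff]
  intro z _
  refine N.isClosed_topologicalClosure.closure_subset_iff.2 ?_ (denseRange_toHilbertTensor z)
  rintro _ ⟨y, rfl⟩
  induction y with
  | zero => rw [map_zero]; exact zero_mem _
  | add x y hx hy => rw [map_add]; exact add_mem hx hy
  | tmul x y => exact h2 x y

theorem opTensor_mul (x x' : K →L[ℂ] K) (y y' : L →L[ℂ] L) :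
    opTensor x y * opTensor x' y' = opTensor (x * x') (y * y') :=
  hilbertTensor_ext fun ξ η => by
    rw [mul_apply_eq_comp, opTensor_tmul, opTensor_tmul, opTensor_tmul]; rfl

theorem opTensor_one : opTensor (1 : K →L[ℂ] K) (1 : L →L[ℂ] L) = 1 :=
  hilbertTensor_ext fun ξ η => by rw [opTensor_tmul]; rfl

theorem opTensor_add_left (x x' : K →L[ℂ] K) (y : L →L[ℂ] L) :
    opTensor (x + x') y = opTensor x y + opTensor x' y :=
  hilbertTensor_ext fun ξ η => by
    rw [_root_.add_apply, opTensor_tmul, opTensor_tmul, opTensor_tmul,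
      _root_.add_apply, TensorProduct.add_tmul, map_add]

theorem opTensor_smul_left (c : ℂ) (x : K →L[ℂ] K) (y : L →L[ℂ] L) :
    opTensor (c • x) y = c • opTensor x y :=
  hilbertTensor_ext fun ξ η => by
    rw [_root_.smul_apply, opTensor_tmul, opTensor_tmul,
      _root_.smul_apply, ← TensorProduct.smul_tmul', map_smul]

theorem inner_hilbertTensor_ext {X Y : HilbertTensor K L →L[ℂ] HilbertTensor K L}
    (h : ∀ (ξ ζ : K) (η θ : L), inner ℂ (toHilbertTensor (ξ ⊗ₜ[ℂ] η)) (X (toHilbertTensor (ζ ⊗ₜ[ℂ] θ))) =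
      inner ℂ (toHilbertTensor (ξ ⊗ₜ[ℂ] η)) (Y (toHilbertTensor (ζ ⊗ₜ[ℂ] θ)))) : X = Y := by
  refine hilbertTensor_ext fun ζ θ => ?_
  have : innerSL ℂ (X (toHilbertTensor (ζ ⊗ₜ[ℂ] θ))) = innerSL ℂ (Y (toHilbertTensor (ζ ⊗ₜ[ℂ] θ))) := by
    refine hilbertTensor_ext fun ξ η => ?_
    rw [innerSL_apply_apply, innerSL_apply_apply, ← inner_conj_symm, h, inner_conj_symm]
  exact ext_inner_right ℂ fun v => congrArg (fun Z => Z v) this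

theorem opTensor_star (x : K →L[ℂ] K) (y : L →L[ℂ] L) :
    star (opTensor x y) = opTensor (star x) (star y) :=
  inner_hilbertTensor_ext fun ξ ζ η θ => by
    rw [ContinuousLinearMap.star_eq_adjoint, ContinuousLinearMap.adjoint_inner_right, opTensor_tmul,
      opTensor_tmul, inner_toHilbertTensor_tmul, inner_toHilbertTensor_tmul,
      ContinuousLinearMap.star_eq_adjoint, ContinuousLinearMap.star_eq_adjoint,
      ContinuousLinearMap.adjoint_inner_right, ContinuousLinearMap.adjoint_inner_right]

variable (K L) in
/-- The homomorphism `x ↦ x ⊗ 1`. -/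
def opTensorLeft : (K →L[ℂ] K) →⋆ₐ[ℂ] (HilbertTensor K L →L[ℂ] HilbertTensor K L) where
  toFun x := opTensor x 1
  map_one' := opTensor_one
  map_mul' x y := by rw [opTensor_mul, mul_one]
  map_zero' := by
    have := opTensor_smul_left (0 : ℂ) (0 : K →L[ℂ] K) (1 : L →L[ℂ] L)
    rwa [zero_smul, zero_smul] at this
  map_add' x y := opTensor_add_left x y 1
  commutes' c := by
    rw [Algebra.algebraMap_eq_smul_one, opTensor_smul_left, opTensor_one, Algebra.algebraMap_eq_smul_one]
  map_star' x := by rw [opTensor_star, star_one]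

/-- The slice `(ι ⊗ ω_{f,g})(X)` of an operator on the tensor product. -/
def slice (f g : L) :
    (HilbertTensor K L →L[ℂ] HilbertTensor K L) →L[ℂ] (K →L[ℂ] K) :=
  (ContinuousLinearMap.compL ℂ K (HilbertTensor K L) K
      (ContinuousLinearMap.adjoint (tensorRight f))).comp
    ((ContinuousLinearMap.compL ℂ K (HilbertTensor K L) (HilbertTensor K L)).flip (tensorRight g))

theorem inner_slice (f g : L) (X : HilbertTensor K L →L[ℂ] HilbertTensor K L) (ξ ζ : K) :
    inner ℂ ξ (slice f g X ζ) =
      inner ℂ (toHilbertTensor (ξ ⊗ₜ[ℂ] f)) (X (toHilbertTensor (ζ ⊗ₜ[ℂ] g))) :=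
  ContinuousLinearMap.adjoint_inner_right (tensorRight f) ξ _

theorem slice_opTensor (f g : L) (x : K →L[ℂ] K) (y : L →L[ℂ] L) :
    slice f g (opTensor x y) = (inner ℂ f (y g) : ℂ) • x := by
  ext ζ
  refine ext_inner_left ℂ fun ξ => ?_
  rw [inner_slice, opTensor_tmul, inner_toHilbertTensor_tmul, _root_.smul_apply,
    inner_smul_right, mul_comm]

theorem ext_slice {X Y : HilbertTensor K L →L[ℂ] HilbertTensor K L}
    (h : ∀ f g, slice f g X = slice f g Y) : X = Y :=
  inner_hilbertTensor_ext fun ξ ζ η θ => by rw [← inner_slice, h, inner_slice]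

/-- The slice maps are module maps over operators on the first leg. -/
theorem slice_opTensor_mul_mul (f g : L) (x y : K →L[ℂ] K)
    (X : HilbertTensor K L →L[ℂ] HilbertTensor K L) :
    slice f g (opTensor x 1 * X * opTensor y 1) = x * slice f g X * y := by
  ext ζ
  refine ext_inner_left ℂ fun ξ => ?_
  have h1 : inner ℂ ξ ((x * slice f g X * y) ζ) = inner ℂ (star x ξ) (slice f g X (y ζ)) := by
    rw [ContinuousLinearMap.star_eq_adjoint, ContinuousLinearMap.adjoint_inner_left]; rfl
  have h2 : inner ℂ (toHilbertTensor (ξ ⊗ₜ[ℂ] f))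
      ((opTensor x 1 * X * opTensor y 1 : HilbertTensor K L →L[ℂ] HilbertTensor K L) (toHilbertTensor (ζ ⊗ₜ[ℂ] g))) =
      inner ℂ (star (opTensor x 1) (toHilbertTensor (ξ ⊗ₜ[ℂ] f)))
        (X (opTensor y 1 (toHilbertTensor (ζ ⊗ₜ[ℂ] g)))) := by
    rw [ContinuousLinearMap.star_eq_adjoint, ContinuousLinearMap.adjoint_inner_left]; rfl
  rw [h1, inner_slice, inner_slice, h2, opTensor_star, opTensor_tmul, opTensor_tmul, star_one]
  rfl

end HilbertTensorTools

/-! ### Induction in algebras generated by elementary tensors -/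

section Closure

variable {E : Type*} [NormedRing E] [StarRing E] [NormedAlgebra ℂ E] [StarModule ℂ E] [NormedStarGroup E]

/-- The closed star-algebra generated by a star-closed multiplicative set is the closed span. -/
theorem mem_closure_span_of_mem_adjoin {s : Set E} (h1 : (1 : E) ∈ s)
    (hmul : ∀ x ∈ s, ∀ y ∈ s, x * y ∈ s) (hstar : ∀ x ∈ s, star x ∈ s) {x : E}
    (hx : x ∈ (StarAlgebra.adjoin ℂ s).topologicalClosure) :
    x ∈ (Submodule.span ℂ s).topologicalClosure := by
  let S : StarSubalgebra ℂ E :=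
    { carrier := Submodule.span ℂ s
      mul_mem' := fun {x y} hx hy => by
        have := Submodule.mul_mem_mul hx hy
        rw [Submodule.span_mul_span] at this
        refine Submodule.span_mono ?_ this
        rintro _ ⟨a, ha, b, hb, rfl⟩
        exact hmul a ha b hb
      add_mem' := fun hx hy => Submodule.add_mem _ hx hy
      algebraMap_mem' := fun c => by
        rw [Algebra.algebraMap_eq_smul_one]
        exact Submodule.smul_mem _ _ (Submodule.subset_span h1)
      star_mem' := fun {x} hx => by
        induction hx using Submodule.span_induction with
        | mem x hx => exact Submodule.subset_span (hstar x hx)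
        | zero => rw [star_zero]; exact Submodule.zero_mem _
        | add x y _ _ hx hy => rw [star_add]; exact Submodule.add_mem _ hx hy
        | smul c x _ hx => rw [star_smul]; exact Submodule.smul_mem _ _ hx }
  have hle : StarAlgebra.adjoin ℂ s ≤ S := StarAlgebra.adjoin_le Submodule.subset_span
  exact closure_mono (show (StarAlgebra.adjoin ℂ s : Set E) ⊆ Submodule.span ℂ s from hle) hx

end Closure

/-! ### Functoriality of the spatial tensor product -/

section MatrixRep

variable {T : Type*} [CStarAlgebra T] [PartialOrder T] [StarOrderedRing T]
variable {K : Type*} [NormedAddCommGroup K] [InnerProductSpace ℂ K] [CompleteSpace K]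
variable {n : ℕ}

/-- The action of a matrix of operators on `K ⊕ ⋯ ⊕ K`. -/
def matrixOp (M : Fin n → Fin n → K →L[ℂ] K) :
    PiLp 2 (fun _ : Fin n => K) →L[ℂ] PiLp 2 (fun _ : Fin n => K) where
  toFun v := WithLp.toLp 2 fun a => ∑ b, M a b (v b)
  map_add' v w := by
    ext a
    simp [Finset.sum_add_distrib]
  map_smul' c v := by
    ext a
    simp [Finset.smul_sum]
  cont := (PiLp.continuous_toLp 2 _).comp (continuous_pi fun a =>
    continuous_finsetSum _ fun b _ => (M a b).continuous.comp
      ((continuous_apply b).comp (PiLp.continuous_ofLp 2 _)))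

theorem matrixOp_apply (M : Fin n → Fin n → K →L[ℂ] K) (v : PiLp 2 (fun _ : Fin n => K)) (a : Fin n) :
    matrixOp M v a = ∑ b, M a b (v b) := rfl

theorem inner_matrixOp (M : Fin n → Fin n → K →L[ℂ] K) (v w : PiLp 2 (fun _ : Fin n => K)) :
    inner ℂ w (matrixOp M v) = ∑ a, ∑ b, inner ℂ (w a) (M a b (v b)) := by
  simp only [PiLp.inner_apply, matrixOp_apply, inner_sum]

/-- A representation of a C*-algebra induces representations of its matrix algebras. -/
def matrixRep (n : ℕ) (π : T →⋆ₐ[ℂ] (K →L[ℂ] K)) :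
    CStarMatrix (Fin n) (Fin n) T →⋆ₐ[ℂ]
      (PiLp 2 (fun _ : Fin n => K) →L[ℂ] PiLp 2 (fun _ : Fin n => K)) where
  toFun M := matrixOp fun a b => π (M a b)
  map_one' := by
    ext v a
    rw [matrixOp_apply, Finset.sum_eq_single a]
    · simp
    · intro b _ hb
      simp [CStarMatrix.one_apply_ne (Ne.symm hb)]
    · simp
  map_mul' M N := by
    ext v a
    simp only [matrixOp_apply, CStarMatrix.mul_apply, map_sum, map_mul, mul_apply_eq_comp,
      _root_.sum_apply]
    exact Finset.sum_comm
  map_zero' := by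
    ext v a
    simp [matrixOp_apply]
  map_add' M N := by
    ext v a
    simp [matrixOp_apply, Finset.sum_add_distrib]
  commutes' c := by
    ext v a
    rw [matrixOp_apply, Finset.sum_eq_single a]
    · simp [CStarMatrix.algebraMap_apply, Algebra.algebraMap_eq_smul_one]
    · intro b _ hb
      simp [CStarMatrix.algebraMap_apply, Ne.symm hb]
    · simp
  map_star' M := by
    rw [ContinuousLinearMap.star_eq_adjoint, ContinuousLinearMap.eq_adjoint_iff]
    intro v w
    rw [inner_matrixOp, ← inner_conj_symm, inner_matrixOp, map_sum, Finset.sum_comm]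
    refine Finset.sum_congr rfl fun a _ => ?_
    rw [map_sum]
    refine Finset.sum_congr rfl fun b _ => ?_
    rw [inner_conj_symm, CStarMatrix.star_apply, map_star, ContinuousLinearMap.star_eq_adjoint,
      ContinuousLinearMap.adjoint_inner_left]

theorem matrixRep_apply (n : ℕ) (π : T →⋆ₐ[ℂ] (K →L[ℂ] K)) (M : CStarMatrix (Fin n) (Fin n) T) :
    matrixRep n π M = matrixOp fun a b => π (M a b) := rfl

/-- An injective star-homomorphism of C*-algebras is isometric; hence the norm of a matrix over `T`
is the operator norm of its amplification in a faithful representation. -/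
theorem matrixRep_injective {π : T →⋆ₐ[ℂ] (K →L[ℂ] K)} (hπ : Function.Injective π) :
    Function.Injective (matrixRep n π) := by
  intro M N h
  ext a b
  apply hπ
  ext x
  have := congrArg (fun X : PiLp 2 (fun _ : Fin n => K) →L[ℂ] PiLp 2 (fun _ : Fin n => K) =>
    X (WithLp.toLp 2 (Pi.single b x)) a) h
  simp only [matrixRep_apply, matrixOp_apply] at this
  rw [Finset.sum_eq_single b (fun c _ hc => by simp [hc]) (by simp),
    Finset.sum_eq_single b (fun c _ hc => by simp [hc]) (by simp)] at this
  simpa using this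

end MatrixRep

/-! ### Compression of operators on `K ⊗ L` to finite orthonormal families in `L`. -/

section Compression

variable {K L : Type*} [NormedAddCommGroup K] [InnerProductSpace ℂ K] [CompleteSpace K]
  [NormedAddCommGroup L] [InnerProductSpace ℂ L] [CompleteSpace L] {n : ℕ}

/-- The isometry `(v_b) ↦ ∑ v_b ⊗ f_b` for an orthonormal family `f`. -/
def orthonormalEmbedding {f : Fin n → L} (hf : Orthonormal ℂ f) :
    PiLp 2 (fun _ : Fin n => K) →ₗᵢ[ℂ] HilbertTensor K L :=
  LinearMap.isometryOfInner
    { toFun := fun v => ∑ b, toHilbertTensor (v b ⊗ₜ[ℂ] f b)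
      map_add' := fun v w => by simp [TensorProduct.add_tmul, Finset.sum_add_distrib]
      map_smul' := fun c v => by simp [← TensorProduct.smul_tmul', Finset.smul_sum] }
    fun v w => by
      simp only [LinearMap.coe_mk, AddHom.coe_mk, inner_sum, sum_inner, inner_toHilbertTensor_tmul,
        orthonormal_iff_ite.1 hf, PiLp.inner_apply]
      simp

theorem orthonormalEmbedding_apply {f : Fin n → L} (hf : Orthonormal ℂ f)
    (v : PiLp 2 (fun _ : Fin n => K)) :
    orthonormalEmbedding hf v = ∑ b, toHilbertTensor (v b ⊗ₜ[ℂ] f b) := rfl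

theorem inner_orthonormalEmbedding {f : Fin n → L} (hf : Orthonormal ℂ f)
    (v w : PiLp 2 (fun _ : Fin n => K)) (X : HilbertTensor K L →L[ℂ] HilbertTensor K L) :
    inner ℂ (orthonormalEmbedding hf w) (X (orthonormalEmbedding hf v)) =
      inner ℂ w (matrixOp (fun a b => slice (f a) (f b) X) v) := by
  rw [inner_matrixOp, orthonormalEmbedding_apply, orthonormalEmbedding_apply]
  simp only [map_sum, sum_inner, inner_sum, inner_slice]
  exact Finset.sum_comm

/-- The matrix of slices is the compression of `X` along the isometry `orthonormalEmbedding hf`. -/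
theorem norm_matrixOp_slice_le {f : Fin n → L} (hf : Orthonormal ℂ f)
    (X : HilbertTensor K L →L[ℂ] HilbertTensor K L) :
    ‖matrixOp fun a b => slice (f a) (f b) X‖ ≤ ‖X‖ := by
  refine ContinuousLinearMap.opNorm_le_of_re_inner_le (norm_nonneg _) fun v w hv hw => ?_
  rw [inner_re_symm, ← inner_orthonormalEmbedding hf]
  refine (re_inner_le_norm _ _).trans ?_
  rw [LinearIsometry.norm_map, hw, one_mul]
  refine (X.le_opNorm _).trans ?_
  rw [LinearIsometry.norm_map, hv, mul_one]

/-- Two vectors of the algebraic tensor product are supported on one finite orthonormal family. -/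
theorem exists_orthonormalEmbedding (x y : K ⊗[ℂ] L) :
    ∃ (n : ℕ) (f : Fin n → L) (hf : Orthonormal ℂ f) (v w : PiLp 2 (fun _ : Fin n => K)),
      toHilbertTensor x = orthonormalEmbedding hf v ∧ toHilbertTensor y = orthonormalEmbedding hf w := by
  have hmono : ∀ {P Q : Submodule ℂ L}, P ≤ Q →
      LinearMap.range (P.subtype.lTensor K) ≤ LinearMap.range (Q.subtype.lTensor K) := by
    intro P Q h
    rw [← Submodule.subtype_comp_inclusion P Q h, LinearMap.lTensor_comp]
    exact LinearMap.range_comp_le_range _ _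
  have hfin : ∀ z : K ⊗[ℂ] L, ∃ W : Submodule ℂ L, W.FG ∧
      z ∈ LinearMap.range (W.subtype.lTensor K) := by
    intro z
    induction z with
    | zero => exact ⟨⊥, Submodule.fg_bot, zero_mem _⟩
    | add x y hx hy =>
      obtain ⟨W, hW, hx⟩ := hx
      obtain ⟨W', hW', hy⟩ := hy
      exact ⟨W ⊔ W', hW.sup hW', add_mem (hmono le_sup_left hx) (hmono le_sup_right hy)⟩
    | tmul ξ η =>
      exact ⟨Submodule.span ℂ {η}, Submodule.fg_span_singleton η,
        ξ ⊗ₜ ⟨η, Submodule.mem_span_singleton_self η⟩, rfl⟩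
  obtain ⟨W, hW, hx⟩ := hfin x
  obtain ⟨W', hW', hy⟩ := hfin y
  -- A finite dimensional subspace containing the second legs of both vectors; the orthonormal
  -- family is a basis of it.
  set V := W ⊔ W' with hV
  have : FiniteDimensional ℂ V := (Submodule.fg_iff_finiteDimensional V).1 (hW.sup hW')
  let e := stdOrthonormalBasis ℂ V
  have hf : Orthonormal ℂ fun i => (e i : L) := e.orthonormal.comp_linearIsometry V.subtypeₗᵢ
  have hrep : ∀ z : K ⊗[ℂ] V, ∃ v : PiLp 2 (fun _ : Fin (Module.finrank ℂ V) => K),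
      toHilbertTensor (V.subtype.lTensor K z) = orthonormalEmbedding hf v := by
    intro z
    induction z with
    | zero => exact ⟨0, by simp⟩
    | add x y hx hy =>
      obtain ⟨v, hv⟩ := hx
      obtain ⟨w, hw⟩ := hy
      exact ⟨v + w, by rw [map_add, map_add, map_add, hv, hw]⟩
    | tmul ξ η =>
      refine ⟨WithLp.toLp 2 fun i => (inner ℂ (e i) η : ℂ) • ξ, ?_⟩
      rw [orthonormalEmbedding_apply, LinearMap.lTensor_tmul]
      simp only [TensorProduct.smul_tmul, ← map_sum, ← TensorProduct.tmul_sum]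
      congr 2
      conv_lhs => rw [← e.sum_repr' η]
      simp
  obtain ⟨x', rfl⟩ := hmono (le_sup_left : W ≤ V) hx
  obtain ⟨y', rfl⟩ := hmono (le_sup_right : W' ≤ V) hy
  obtain ⟨v, hv⟩ := hrep x'
  obtain ⟨w, hw⟩ := hrep y'
  exact ⟨_, _, hf, v, w, hv, hw⟩

end Compression

/-! ### Homomorphisms `π ⊗ ι` between spatial tensor products. -/

section Functoriality

variable {F K L : Type*} [NormedAddCommGroup F] [InnerProductSpace ℂ F] [CompleteSpace F]
  [NormedAddCommGroup K] [InnerProductSpace ℂ K] [CompleteSpace K]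
  [NormedAddCommGroup L] [InnerProductSpace ℂ L] [CompleteSpace L]
  {T : StarSubalgebra ℂ (F →L[ℂ] F)}

/-- `Y` is the image of `X` under `π ⊗ ι`, tested on slices. -/
def SliceRelated (π : T →⋆ₐ[ℂ] (K →L[ℂ] K)) (X : HilbertTensor F L →L[ℂ] HilbertTensor F L)
    (Y : HilbertTensor K L →L[ℂ] HilbertTensor K L) : Prop :=
  ∀ f g : L, ∃ t : T, (t : F →L[ℂ] F) = slice f g X ∧ π t = slice f g Y

/-- Homomorphisms on the first leg are contractive for the spatial norm. -/
theorem SliceRelated.norm_le [IsClosed (T : Set (F →L[ℂ] F))] {π : T →⋆ₐ[ℂ] (K →L[ℂ] K)}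
    {X : HilbertTensor F L →L[ℂ] HilbertTensor F L}
    {Y : HilbertTensor K L →L[ℂ] HilbertTensor K L} (h : SliceRelated π X Y) : ‖Y‖ ≤ ‖X‖ := by
  let _ : PartialOrder T := CStarAlgebra.spectralOrder T
  have : StarOrderedRing T := CStarAlgebra.spectralOrderedRing T
  have key : ∀ x y : K ⊗[ℂ] L, ‖inner ℂ (toHilbertTensor y) (Y (toHilbertTensor x))‖ ≤
      ‖X‖ * ‖toHilbertTensor x‖ * ‖toHilbertTensor y‖ := by
    intro x y
    obtain ⟨n, f, hf, v, w, hx, hy⟩ := exists_orthonormalEmbedding x y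
    choose t ht1 ht2 using h
    -- One matrix over `T` lies behind both compressions: the inclusion of `T` sends it to that of
    -- `X`, and `π` sends it to that of `Y`. The first amplification is isometric and the second
    -- contractive, which compares the two norms.
    let M : CStarMatrix (Fin n) (Fin n) T := CStarMatrix.ofMatrix fun a b => t (f a) (f b)
    have e1 : matrixRep n T.subtype M = matrixOp fun a b => slice (f a) (f b) X :=
      congrArg matrixOp (funext₂ fun a b => ht1 (f a) (f b))
    have e2 : matrixRep n π M = matrixOp fun a b => slice (f a) (f b) Y :=
      congrArg matrixOp (funext₂ fun a b => ht2 (f a) (f b))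
    have hM : ‖M‖ ≤ ‖X‖ := by
      rw [← NonUnitalStarAlgHom.norm_map (matrixRep n T.subtype)
        (matrixRep_injective Subtype.val_injective) M, e1]
      exact norm_matrixOp_slice_le hf X
    rw [hx, hy, inner_orthonormalEmbedding, LinearIsometry.norm_map, LinearIsometry.norm_map, ← e2]
    calc _ ≤ ‖w‖ * ‖matrixRep n π M v‖ := norm_inner_le_norm _ _
      _ ≤ ‖w‖ * (‖M‖ * ‖v‖) := by
        gcongr
        exact (ContinuousLinearMap.le_opNorm _ _).trans (mul_le_mul_of_nonneg_right
          (NonUnitalStarAlgHom.norm_apply_le _ _) (norm_nonneg _))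
      _ ≤ ‖w‖ * (‖X‖ * ‖v‖) := by gcongr
      _ = _ := by ring
  refine ContinuousLinearMap.opNorm_le_of_re_inner_le (norm_nonneg _) fun v w hv hw => ?_
  have key2 : ‖inner ℂ w (Y v)‖ ≤ ‖X‖ * ‖v‖ * ‖w‖ := by
    refine DenseRange.induction_on₂ (p := fun v w => ‖inner ℂ w (Y v)‖ ≤ ‖X‖ * ‖v‖ * ‖w‖)
      (denseRange_toHilbertTensor (K := K) (L := L)) ?_ key v w
    exact isClosed_le (continuous_snd.inner (𝕜 := ℂ) (Y.continuous.comp continuous_fst)).norm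
      ((continuous_const.mul continuous_fst.norm).mul continuous_snd.norm)
  rw [hv, hw, mul_one, mul_one] at key2
  rw [inner_re_symm]
  exact (Complex.re_le_norm _).trans key2

/-- Slices separate operators, so `Y` vanishes as soon as `π` kills all slices of `X`. This is how
the action is seen to descend to the quotient by the compact operators. -/
theorem SliceRelated.zero_right_of {π : T →⋆ₐ[ℂ] (K →L[ℂ] K)}
    {X : HilbertTensor F L →L[ℂ] HilbertTensor F L}
    {Y : HilbertTensor K L →L[ℂ] HilbertTensor K L} (h : SliceRelated π X Y)
    (h0 : ∀ (f g : L) (t : T), (t : F →L[ℂ] F) = slice f g X → π t = 0) : Y = 0 := by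
  refine ext_slice fun f g => ?_
  obtain ⟨t, ht, ht'⟩ := h f g
  rw [← ht', h0 f g t ht, map_zero]

variable [IsClosed (T : Set (F →L[ℂ] F))]

/-- As `T` is closed and `π` continuous, the graph of `π` is closed among pairs of operators; the
relation is an intersection of preimages of it under the continuous slice maps. -/
theorem isClosed_sliceRelated (π : T →⋆ₐ[ℂ] (K →L[ℂ] K)) :
    IsClosed {p : (HilbertTensor F L →L[ℂ] HilbertTensor F L) ×
      (HilbertTensor K L →L[ℂ] HilbertTensor K L) | SliceRelated π p.1 p.2} := by
  have hπ : Continuous π := AddMonoidHomClass.continuous_of_bound π 1 fun t => by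
    rw [one_mul]; exact NonUnitalStarAlgHom.norm_apply_le π t
  have hG : IsClosed {q : (F →L[ℂ] F) × (K →L[ℂ] K) | ∃ t : T, (t : F →L[ℂ] F) = q.1 ∧ π t = q.2} := by
    have hcl : IsClosed (T : Set (F →L[ℂ] F)) := inferInstance
    have h1 : IsClosed {q : T × (K →L[ℂ] K) | π q.1 = q.2} :=
      isClosed_eq (hπ.comp continuous_fst) continuous_snd
    have h2 := (hcl.isClosedEmbedding_subtypeVal.prodMap
      (Topology.IsClosedEmbedding.id (X := K →L[ℂ] K))).isClosedMap _ h1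
    convert h2 using 1
    ext ⟨x, y⟩
    constructor
    · rintro ⟨t, rfl, rfl⟩
      exact ⟨(t, π t), rfl, rfl⟩
    · rintro ⟨⟨t, z⟩, hz, he⟩
      rw [Prod.ext_iff] at he
      exact ⟨t, he.1, hz.trans he.2⟩
  have : {p : (HilbertTensor F L →L[ℂ] HilbertTensor F L) ×
      (HilbertTensor K L →L[ℂ] HilbertTensor K L) | SliceRelated π p.1 p.2} =
      ⋂ f : L, ⋂ g : L, (fun p => (slice f g p.1, slice f g p.2)) ⁻¹'
        {q : (F →L[ℂ] F) × (K →L[ℂ] K) | ∃ t : T, (t : F →L[ℂ] F) = q.1 ∧ π t = q.2} := by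
    ext p
    simp [SliceRelated]
  rw [this]
  exact isClosed_iInter fun f => isClosed_iInter fun g => hG.preimage
    (((slice f g).continuous.comp continuous_fst).prodMk ((slice f g).continuous.comp continuous_snd))

theorem SliceRelated.opTensor (π : T →⋆ₐ[ℂ] (K →L[ℂ] K)) (t : T) (y : L →L[ℂ] L) :
    SliceRelated π (opTensor (t : F →L[ℂ] F) y) (opTensor (π t) y) := fun f g =>
  ⟨(inner ℂ f (y g) : ℂ) • t, by rw [slice_opTensor]; rfl, by rw [slice_opTensor, map_smul]⟩

theorem SliceRelated.add {π : T →⋆ₐ[ℂ] (K →L[ℂ] K)}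
    {X X' : HilbertTensor F L →L[ℂ] HilbertTensor F L}
    {Y Y' : HilbertTensor K L →L[ℂ] HilbertTensor K L} (h : SliceRelated π X Y)
    (h' : SliceRelated π X' Y') : SliceRelated π (X + X') (Y + Y') := fun f g => by
  obtain ⟨t, h1, h2⟩ := h f g
  obtain ⟨t', h1', h2'⟩ := h' f g
  exact ⟨t + t', by rw [map_add, ← h1, ← h1']; rfl, by rw [map_add, map_add, h2, h2']⟩

theorem SliceRelated.smul {π : T →⋆ₐ[ℂ] (K →L[ℂ] K)} (c : ℂ)
    {X : HilbertTensor F L →L[ℂ] HilbertTensor F L}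
    {Y : HilbertTensor K L →L[ℂ] HilbertTensor K L} (h : SliceRelated π X Y) :
    SliceRelated π (c • X) (c • Y) := fun f g => by
  obtain ⟨t, h1, h2⟩ := h f g
  exact ⟨c • t, by rw [map_smul, ← h1]; rfl, by rw [map_smul, map_smul, h2]⟩

/-- A homomorphism of C*-algebras induces a homomorphism of spatial tensor products. -/
theorem exists_spatialMap {T' : StarSubalgebra ℂ (K →L[ℂ] K)} {B : StarSubalgebra ℂ (L →L[ℂ] L)}
    (π : T →⋆ₐ[ℂ] (K →L[ℂ] K)) (hπ : ∀ t, π t ∈ T') :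
    ∃ Q : SpatialTensor T B →⋆ₐ[ℂ] SpatialTensor T' B,
      (∀ t x, Q (SpatialTensor.tmul t x) = SpatialTensor.tmul ⟨π t, hπ t⟩ x) ∧
      ∀ X, SliceRelated π (SpatialTensor.toOp X) (SpatialTensor.toOp (Q X)) := by
  let E := (HilbertTensor F L →L[ℂ] HilbertTensor F L) × (HilbertTensor K L →L[ℂ] HilbertTensor K L)
  let s : Set E := {p | ∃ t : T, ∃ x ∈ B, p = (CQG.opTensor (t : F →L[ℂ] F) x, CQG.opTensor (π t) x)}
  -- `Γ` is to be the graph of `π ⊗ ι`: the C*-algebra generated by the pairs `(t ⊗ x, π t ⊗ x)`.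
  -- The relation on slices holds for these pairs and survives sums, scalars and limits.
  let Γ : StarSubalgebra ℂ E := (StarAlgebra.adjoin ℂ s).topologicalClosure
  have hrel : ∀ p ∈ Γ, SliceRelated π p.1 p.2 := by
    intro p hp
    have hp' := mem_closure_span_of_mem_adjoin (s := s)
      ⟨1, 1, one_mem _, by rw [map_one]; exact Prod.ext opTensor_one.symm opTensor_one.symm⟩
      (by
        rintro _ ⟨t, x, hx, rfl⟩ _ ⟨t', x', hx', rfl⟩
        exact ⟨t * t', x * x', mul_mem hx hx', by
          rw [map_mul]; exact Prod.ext (opTensor_mul _ _ _ _) (opTensor_mul _ _ _ _)⟩)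
      (by
        rintro _ ⟨t, x, hx, rfl⟩
        exact ⟨star t, star x, star_mem hx, by
          rw [map_star]; exact Prod.ext (opTensor_star _ _) (opTensor_star _ _)⟩) hp
    refine (isClosed_sliceRelated π).closure_subset_iff.2 ?_ hp'
    intro q hq
    induction hq using Submodule.span_induction with
    | mem q hq =>
      obtain ⟨t, x, hx, rfl⟩ := hq
      exact SliceRelated.opTensor π t x
    | zero => exact fun f g => ⟨0, by simp, by simp⟩
    | add x y _ _ hx hy => exact hx.add hy
    | smul c x _ hx => exact hx.smul c
  -- the second component is a function of the first
  let p1 : Γ →⋆ₐ[ℂ] (HilbertTensor F L →L[ℂ] HilbertTensor F L) :=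
    (StarAlgHom.fst ℂ _ _).comp Γ.subtype
  let p2 : Γ →⋆ₐ[ℂ] (HilbertTensor K L →L[ℂ] HilbertTensor K L) :=
    (StarAlgHom.snd ℂ _ _).comp Γ.subtype
  -- The norm on pairs is the maximum, so this bound makes the first projection isometric. Its range
  -- is then closed and contains the whole spatial tensor product, and inverting it turns `Γ` into a
  -- map.
  have hle : ∀ γ : Γ, ‖p2 γ‖ ≤ ‖p1 γ‖ := fun γ => (hrel γ γ.2).norm_le
  have hiso : Isometry p1 := AddMonoidHomClass.isometry_of_norm p1 fun γ =>
    (max_eq_left (hle γ)).symm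
  have hΓ : IsClosed (Γ : Set E) := StarSubalgebra.isClosed_topologicalClosure _
  have : CompleteSpace Γ := hΓ.completeSpace_coe
  have hcl : IsClosed (Set.range p1) := hiso.isClosedEmbedding.isClosed_range
  have hsub : spatialTensor T B ≤ p1.range := by
    refine StarSubalgebra.topologicalClosure_minimal (StarAlgebra.adjoin_le ?_) hcl
    rintro _ ⟨t, ht, x, hx, rfl⟩
    exact ⟨⟨(CQG.opTensor t x, CQG.opTensor (π ⟨t, ht⟩) x), StarSubalgebra.le_topologicalClosure _
      (StarAlgebra.subset_adjoin ℂ _ ⟨⟨t, ht⟩, x, hx, rfl⟩)⟩, rfl⟩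
  have hmem2 : ∀ γ : Γ, p2 γ ∈ spatialTensor T' B := by
    intro γ
    have hcl' : IsClosed (spatialTensor T' B : Set (HilbertTensor K L →L[ℂ] HilbertTensor K L)) :=
      inferInstance
    have hc : IsClosed (Prod.snd ⁻¹' (spatialTensor T' B : Set
        (HilbertTensor K L →L[ℂ] HilbertTensor K L)) : Set E) := hcl'.preimage continuous_snd
    have : Γ ≤ (spatialTensor T' B).comap (StarAlgHom.snd ℂ _ _) := by
      refine StarSubalgebra.topologicalClosure_minimal (StarAlgebra.adjoin_le ?_) hc
      rintro _ ⟨t, x, hx, rfl⟩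
      exact StarSubalgebra.le_topologicalClosure _ (StarAlgebra.subset_adjoin ℂ _
        ⟨π t, hπ t, x, hx, rfl⟩)
    exact this γ.2
  have hex : ∀ X : SpatialTensor T B, ∃ γ : Γ, p1 γ = SpatialTensor.toOp X := fun X => hsub X.2
  choose σ hσ using hex
  have hσu : ∀ (X : SpatialTensor T B) (γ : Γ), p1 γ = SpatialTensor.toOp X → σ X = γ :=
    fun X γ h => hiso.injective ((hσ X).trans h.symm)
  let Q : SpatialTensor T B →⋆ₐ[ℂ] SpatialTensor T' B :=
    { toFun := fun X => ⟨p2 (σ X), hmem2 _⟩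
      map_one' := by
        rw [hσu 1 1 (by rw [map_one, map_one])]
        exact Subtype.ext (map_one p2)
      map_mul' := fun X Y => by
        rw [hσu (X * Y) (σ X * σ Y) (by rw [map_mul, map_mul, hσ, hσ])]
        exact Subtype.ext (map_mul p2 _ _)
      map_zero' := by
        rw [hσu 0 0 (by rw [map_zero, map_zero])]
        exact Subtype.ext (map_zero p2)
      map_add' := fun X Y => by
        rw [hσu (X + Y) (σ X + σ Y) (by rw [map_add, map_add, hσ, hσ])]
        exact Subtype.ext (map_add p2 _ _)
      commutes' := fun c => by
        rw [hσu (algebraMap ℂ _ c) (algebraMap ℂ _ c) (by rw [AlgHomClass.commutes, AlgHomClass.commutes])]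
        exact Subtype.ext (AlgHomClass.commutes p2 c)
      map_star' := fun X => by
        rw [hσu (star X) (star (σ X)) (by rw [map_star, map_star, hσ])]
        exact Subtype.ext (map_star p2 _) }
  refine ⟨Q, fun t x => ?_, fun X => ?_⟩
  · have := hσu (SpatialTensor.tmul t x) ⟨(CQG.opTensor t x, CQG.opTensor (π t) x),
      StarSubalgebra.le_topologicalClosure _ (StarAlgebra.subset_adjoin ℂ _ ⟨t, x, x.2, rfl⟩)⟩ rfl
    refine Subtype.ext ?_
    change p2 (σ (SpatialTensor.tmul t x)) = _
    rw [this]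
    rfl
  · have := hrel (σ X) (σ X).2
    change SliceRelated π (p1 (σ X)) (p2 (σ X)) at this
    rw [hσ] at this
    exact this

end Functoriality

/-! ### Faithfulness of the universal representation -/

section GelfandNaimark

variable {A : Type*} [CStarAlgebra A] [PartialOrder A] [StarOrderedRing A]

/-- A unital functional of norm at most one takes real values on self-adjoint elements. -/
theorem im_eq_zero_of_norm_le_one {f : A →L[ℂ] ℂ} (hf : ‖f‖ ≤ 1) (hf1 : f 1 = 1) {a : A}
    (ha : IsSelfAdjoint a) : (f a).im = 0 := by
  rcases subsingleton_or_nontrivial A with hA | hA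
  · rw [Subsingleton.elim a 0, map_zero, Complex.zero_im]
  -- The value of `f` at `a + i t` has imaginary part `Im (f a) + t` and modulus at most `‖a + i
  -- t‖`, whose square is at most `‖a‖² + t²`.
  have key : ∀ t : ℝ, ((f a).im + t) ^ 2 ≤ ‖a‖ ^ 2 + t ^ 2 := by
    intro t
    let b := a + (t * Complex.I) • (1 : A)
    have h1 : f b = f a + t * Complex.I := by simp [b, hf1]
    have h2 : ‖f b‖ ≤ ‖b‖ := (f.le_opNorm b).trans (mul_le_of_le_one_left (norm_nonneg _) hf)
    have h3 : ‖b‖ * ‖b‖ ≤ ‖a‖ ^ 2 + t ^ 2 := by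
      rw [← CStarRing.norm_star_mul_self]
      have e : star b * b = a * a + ((t ^ 2 : ℝ) : ℂ) • (1 : A) := by
        simp only [b, star_add, star_smul, star_one, ha.star_eq, add_mul, mul_add, smul_mul_assoc,
          one_mul, mul_smul_comm, mul_one]
        have hs : star ((t : ℂ) * Complex.I) = -((t : ℂ) * Complex.I) := by simp
        rw [hs]
        have hI : (t : ℂ) * Complex.I * -(t * Complex.I) = ((t ^ 2 : ℝ) : ℂ) := by
          push_cast
          linear_combination (-(t : ℂ) ^ 2) * Complex.I_sq
        rw [smul_add, smul_smul, hI]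
        module
      rw [e]
      calc _ ≤ ‖a * a‖ + ‖((t ^ 2 : ℝ) : ℂ) • (1 : A)‖ := norm_add_le _ _
        _ ≤ ‖a‖ ^ 2 + t ^ 2 := by
          rw [norm_smul, CStarRing.norm_one, mul_one, Complex.norm_real, Real.norm_of_nonneg (sq_nonneg t)]
          exact add_le_add ((norm_mul_le _ _).trans_eq (sq _).symm) le_rfl
    have h4 : ((f a).im + t) ^ 2 ≤ ‖f b‖ ^ 2 := by
      have := Complex.abs_im_le_norm (f b)
      rw [h1] at this ⊢
      simp only [Complex.add_im, Complex.mul_im, Complex.ofReal_re, Complex.I_im, mul_one,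
        Complex.ofReal_im, Complex.I_re, mul_zero, add_zero] at this
      rw [← sq_abs]
      gcongr
    nlinarith [norm_nonneg (f b), norm_nonneg b]
  by_contra hne
  set β := (f a).im
  -- With this `t` the cross term `2 β t` equals `‖a‖² + 1`, which exceeds what `key` allows.
  have := key ((‖a‖ ^ 2 + 1) / (2 * β))
  have h2 : (β + (‖a‖ ^ 2 + 1) / (2 * β)) ^ 2 = β ^ 2 + (‖a‖ ^ 2 + 1) + ((‖a‖ ^ 2 + 1) / (2 * β)) ^ 2 := by
    field_simp
    ring
  rw [h2] at this
  nlinarith [sq_nonneg β]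

/-- For `0 ≤ a` the element `‖a‖ - a` has norm at most `‖a‖`, so `f a` lies within distance `‖a‖` of
`‖a‖`; being real, it is nonnegative. -/
theorem nonneg_of_norm_le_one {f : A →L[ℂ] ℂ} (hf : ‖f‖ ≤ 1) (hf1 : f 1 = 1) {a : A}
    (ha : 0 ≤ a) : 0 ≤ f a := by
  have him := im_eq_zero_of_norm_le_one hf hf1 (IsSelfAdjoint.of_nonneg ha)
  rw [Complex.nonneg_iff]
  refine ⟨?_, him.symm⟩
  have h1 : ‖algebraMap ℝ A ‖a‖ - a‖ ≤ ‖a‖ := by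
    have h0 : 0 ≤ algebraMap ℝ A ‖a‖ - a :=
      sub_nonneg.2 (IsSelfAdjoint.le_algebraMap_norm_self (IsSelfAdjoint.of_nonneg ha))
    have h2 : algebraMap ℝ A ‖a‖ - a ≤ algebraMap ℝ A ‖a‖ := sub_le_self _ ha
    rwa [CStarAlgebra.norm_le_iff_le_algebraMap _ (norm_nonneg a) h0]
  have h2 : ‖f (algebraMap ℝ A ‖a‖ - a)‖ ≤ ‖a‖ :=
    ((f.le_opNorm _).trans (mul_le_of_le_one_left (norm_nonneg _) hf)).trans h1
  have h3 : f (algebraMap ℝ A ‖a‖ - a) = ‖a‖ - f a := by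
    rw [map_sub, IsScalarTower.algebraMap_apply ℝ ℂ A, Algebra.algebraMap_eq_smul_one, map_smul, hf1]
    simp
  rw [h3] at h2
  have h4 := (Complex.re_le_norm _).trans h2
  simp at h4
  linarith

/-- Positive functionals separate the positive elements from `0`. -/
theorem exists_positive_apply_ne_zero {x : A} (hx : 0 ≤ x) (hx0 : x ≠ 0) :
    ∃ φ : A →ₚ[ℂ] ℂ, φ x ≠ 0 := by
  have : Nontrivial A := ⟨x, 0, hx0⟩
  have hsa : IsSelfAdjoint x := IsSelfAdjoint.of_nonneg hx
  have := hsa.isStarNormal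
  -- The commutative C*-algebra generated by `x` has a character with value `‖x‖` at `x`. A
  -- norm-preserving extension still has value `1` at the unit, hence is positive on all of `A`.
  let S := StarAlgebra.elemental ℂ x
  let x' : S := ⟨x, StarAlgebra.elemental.self_mem ℂ x⟩
  have hspec : ((‖x‖ : ℝ) : ℂ) ∈ spectrum ℂ x' := by
    rw [StarSubalgebra.spectrum_eq (hS := StarAlgebra.elemental.isClosed ℂ x)]
    exact spectrum.algebraMap_mem ℂ (CStarAlgebra.norm_mem_spectrum_of_nonneg (a := x))
  obtain ⟨χ, hχ⟩ := WeakDual.CharacterSpace.mem_spectrum_iff_exists.1 hspec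
  let f : StrongDual ℂ S := WeakDual.toStrongDual (χ : WeakDual ℂ S)
  have hf : ‖f‖ ≤ 1 := (WeakDual.CharacterSpace.norm_le_norm_one χ).trans_eq CStarRing.norm_one
  obtain ⟨g, hg, hgn⟩ := exists_extension_norm_eq (S.toSubalgebra.toSubmodule) f
  have hg1 : g 1 = 1 := (hg (1 : S)).trans (map_one χ)
  have hgx : g x = ‖x‖ := (hg x').trans hχ
  refine ⟨PositiveLinearMap.mk₀ g.toLinearMap fun a ha =>
    nonneg_of_norm_le_one (hgn.trans_le hf) hg1 ha, ?_⟩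
  change g x ≠ 0
  rw [hgx]
  simpa using hx0

/-- The universal representation is faithful. -/
theorem universalRep_injective : Function.Injective (universalRep (A := A)) := by
  classical
  rw [injective_iff_map_eq_zero]
  intro b hb
  by_contra hb0
  have hne : star b * b ≠ 0 := fun h => hb0 (CStarRing.star_mul_self_eq_zero_iff b |>.1 h)
  -- In the summand of `φ`, the cyclic vector is moved by `b` to a vector of squared norm `φ (star b
  -- * b)`, which is not zero.
  obtain ⟨φ, hφ⟩ := exists_positive_apply_ne_zero (star_mul_self_nonneg b) hne
  have h1 : φ.gnsStarAlgHom b (Completion.coe' (φ.toPreGNS 1)) = 0 := by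
    have := congrArg (fun X : UniversalSpace A →L[ℂ] UniversalSpace A =>
      (show GNSSum A from X (lp.single 2 φ (Completion.coe' (φ.toPreGNS 1) : φ.GNS))) φ) hb
    change φ.gnsStarAlgHom b ((lp.single 2 φ (Completion.coe' (φ.toPreGNS 1) : φ.GNS) : GNSSum A) φ) = 0 at this
    rwa [lp.single_apply_self] at this
  have h2 : φ.gnsStarAlgHom b (Completion.coe' (φ.toPreGNS 1)) =
      Completion.coe' (φ.toPreGNS b) := by
    have := φ.gnsNonUnitalStarAlgHom_apply_coe (a := b) (b := φ.toPreGNS 1)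
    refine this.trans ?_
    simp
  rw [h2] at h1
  have h3 : ‖φ.toPreGNS b‖ = 0 := by
    rw [← Completion.norm_coe, h1, norm_zero]
  have h4 := φ.preGNS_norm_sq (φ.toPreGNS b)
  rw [h3] at h4
  simp at h4
  exact hφ h4.symm

end GelfandNaimark

/-! ### The regular representation -/

section Regular

open Matrix

variable {A : Type*} [Ring A] [StarRing A] [HopfAlgebra ℂ A] [StarModule ℂ A]
variable {κ : Type} [Fintype κ] [DecidableEq κ]

theorem norm_toL2_sq (a : A) : ((‖toL2 A a‖ ^ 2 : ℝ) : ℂ) = haarState A (star a * a) := by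
  rw [← inner_toL2, inner_self_eq_norm_sq_to_K]
  push_cast
  rfl

/-- Each column of `v` satisfies `∑ k, star (v k j) * v k j = 1`, so the squared norms of the
vectors `Λ(v k j * b)` add up to that of `Λ(b)`. Boundedness of left multiplication by any element
of `A` follows from this. -/
theorem norm_toL2_mul_le {v : Matrix κ κ A} (hv : vᴴ * v = 1) (i j : κ) (b : A) :
    ‖toL2 A (v i j * b)‖ ≤ ‖toL2 A b‖ := by
  have h : ∑ k, ‖toL2 A (v k j * b)‖ ^ 2 = ‖toL2 A b‖ ^ 2 := by
    apply Complex.ofReal_injective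
    rw [Complex.ofReal_sum, norm_toL2_sq]
    simp only [norm_toL2_sq]
    rw [← map_sum]
    congr 1
    have hj := congrFun (congrFun hv j) j
    rw [mul_apply, one_apply_eq] at hj
    simp only [conjTranspose_apply] at hj
    have e : ∀ k, star (v k j * b) * (v k j * b) = star b * (star (v k j) * v k j) * b := fun k => by
      rw [StarMul.star_mul]; simp only [mul_assoc]
    simp only [e, ← Finset.sum_mul, ← Finset.mul_sum, hj, mul_one]
  refine le_of_sq_le_sq ?_ (norm_nonneg _)
  rw [← h]
  exact Finset.single_le_sum (f := fun k => ‖toL2 A (v k j * b)‖ ^ 2)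
    (fun k _ => sq_nonneg _) (Finset.mem_univ i)

theorem exists_norm_toL2_mul_le [CompactQuantumGroup A] (a : A) :
    ∃ C, ∀ b, ‖toL2 A (a * b)‖ ≤ C * ‖toL2 A b‖ := by
  obtain ⟨n, _, _, v, hv, ha⟩ := exists_mem_coeffs a
  induction ha using Submodule.span_induction with
  | mem x hx =>
    obtain ⟨⟨i, j⟩, rfl⟩ := hx
    exact ⟨1, fun b => by rw [one_mul]; exact norm_toL2_mul_le hv.star_mul i j b⟩
  | zero => exact ⟨0, fun b => by simp⟩
  | add x y _ _ hx hy =>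
    obtain ⟨C, hC⟩ := hx
    obtain ⟨D, hD⟩ := hy
    refine ⟨C + D, fun b => ?_⟩
    rw [add_mul, map_add, add_mul]
    exact (norm_add_le _ _).trans (add_le_add (hC b) (hD b))
  | smul c x _ hx =>
    obtain ⟨C, hC⟩ := hx
    refine ⟨‖c‖ * C, fun b => ?_⟩
    rw [smul_mul_assoc, map_smul, norm_smul, mul_assoc]
    exact mul_le_mul_of_nonneg_left (hC b) (norm_nonneg _)

/-- The operator of left multiplication by `a` on `L²(G)`. -/
def leftMul (a : A) : L2 A →L[ℂ] L2 A :=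
  (toL2 A ∘ₗ LinearMap.mulLeft ℂ a).extendOfNorm (toL2 A)

theorem leftMul_toL2 [CompactQuantumGroup A] (a b : A) :
    leftMul a (toL2 A b) = toL2 A (a * b) :=
  LinearMap.extendOfNorm_eq (f := toL2 A ∘ₗ LinearMap.mulLeft ℂ a) (denseRange_toL2 A)
    (exists_norm_toL2_mul_le a) b

theorem l2_ext {E : Type*} [NormedAddCommGroup E] [NormedSpace ℂ E] {X Y : L2 A →L[ℂ] E}
    (h : ∀ b, X (toL2 A b) = Y (toL2 A b)) : X = Y :=
  ContinuousLinearMap.coeFn_injective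
    ((denseRange_toL2 A).equalizer X.continuous Y.continuous (funext h))

theorem dense_span_range_toL2 :
    Dense (Submodule.span ℂ (Set.range (toL2 A)) : Set (L2 A)) :=
  (denseRange_toL2 A).mono Submodule.subset_span

variable (A) in
/-- The regular representation of the Hopf algebra on `L²(G)`. -/
def regularRep [CompactQuantumGroup A] : A →⋆ₐ[ℂ] (L2 A →L[ℂ] L2 A) where
  toFun := leftMul
  map_one' := l2_ext fun b => by rw [leftMul_toL2, one_mul]; rfl
  map_mul' x y := l2_ext fun b => by
    rw [leftMul_toL2, mul_assoc, ← leftMul_toL2, ← leftMul_toL2]; rfl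
  map_zero' := l2_ext fun b => by rw [leftMul_toL2, zero_mul, map_zero]; rfl
  map_add' x y := l2_ext fun b => by
    rw [leftMul_toL2, add_mul, map_add, ← leftMul_toL2, ← leftMul_toL2]; rfl
  commutes' c := l2_ext fun b => by
    rw [leftMul_toL2, ← Algebra.smul_def, map_smul, Algebra.algebraMap_eq_smul_one]; rfl
  map_star' x := by
    rw [ContinuousLinearMap.star_eq_adjoint, ContinuousLinearMap.eq_adjoint_iff]
    refine (denseRange_toL2 A).induction_on₂
      (isClosed_eq (((leftMul (star x)).continuous.comp continuous_fst).inner (𝕜 := ℂ) continuous_snd)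
        (continuous_fst.inner (𝕜 := ℂ) ((leftMul x).continuous.comp continuous_snd))) fun a b => ?_
    rw [leftMul_toL2, leftMul_toL2, inner_toL2, inner_toL2, StarMul.star_mul, star_star, mul_assoc]

theorem regularRep_toL2 [CompactQuantumGroup A] (a b : A) :
    regularRep A a (toL2 A b) = toL2 A (a * b) := leftMul_toL2 a b

theorem regularRep_mem [CompactQuantumGroup A] (a : A) : regularRep A a ∈ reducedAlgebra A :=
  StarSubalgebra.le_topologicalClosure _
    (StarAlgebra.subset_adjoin ℂ _ ⟨a, fun b => leftMul_toL2 a b⟩)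

end Regular

/-! ### The Fock space and the unitary representation on it -/

namespace SubproductSystem

variable {𝓗 : SubproductSystem}

theorem inner_toFock_self (n : ℕ) (ζ z : 𝓗.H n) :
    inner ℂ (𝓗.toFock n ζ) (𝓗.toFock n z) = inner ℂ ζ z :=
  (lp.inner_single_left (𝕜 := ℂ) (G := 𝓗.H) n ζ (lp.single 2 n z)).trans
    (congrArg (inner ℂ ζ) (lp.single_apply_self (E := 𝓗.H) 2 n z))

theorem inner_toFock_of_ne {m n : ℕ} (h : m ≠ n) (ζ : 𝓗.H m) (z : 𝓗.H n) :
    inner ℂ (𝓗.toFock m ζ) (𝓗.toFock n z) = 0 :=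
  (lp.inner_single_left (𝕜 := ℂ) (G := 𝓗.H) m ζ (lp.single 2 n z)).trans
    ((congrArg (inner ℂ ζ) (lp.single_apply_ne (E := 𝓗.H) 2 n z h)).trans (inner_zero_right _))

theorem toFock_injective (n : ℕ) : Function.Injective (𝓗.toFock n) := fun x y h => by
  refine ext_inner_left ℂ fun z => ?_
  rw [← inner_toFock_self, h, inner_toFock_self]

theorem toFock_castEquiv {m n : ℕ} (h : m = n) (ζ : 𝓗.H m) :
    𝓗.toFock n (𝓗.castEquiv h ζ) = 𝓗.toFock m ζ := by
  subst h; rfl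

theorem dense_span_toFock :
    Dense (Submodule.span ℂ {x : 𝓗.Fock | ∃ n ζ, x = 𝓗.toFock n ζ} : Set 𝓗.Fock) := fun f => by
  have h : HasSum (fun n => 𝓗.toFock n ((show 𝓗.FockSum from f) n)) f :=
    lp.hasSum_single (E := 𝓗.H) (p := 2) ENNReal.ofNat_ne_top f
  refine mem_closure_of_tendsto h (Filter.Eventually.of_forall fun s => ?_)
  exact Submodule.sum_mem _ fun n _ => Submodule.subset_span ⟨n, _, rfl⟩

theorem fock_ext {E : Type*} [NormedAddCommGroup E] [NormedSpace ℂ E] {X Y : 𝓗.Fock →L[ℂ] E}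
    (h : ∀ n ζ, X (𝓗.toFock n ζ) = Y (𝓗.toFock n ζ)) : X = Y :=
  ContinuousLinearMap.ext_on dense_span_toFock fun x hx => by
    obtain ⟨n, ζ, rfl⟩ := hx
    exact h n ζ

variable (𝓗) in
/-- An orthonormal basis of `H n`. -/
def basis (n : ℕ) : OrthonormalBasis (Fin (Module.finrank ℂ (𝓗.H n))) ℂ (𝓗.H n) :=
  stdOrthonormalBasis ℂ (𝓗.H n)

variable (𝓗) in
/-- The orthonormal basis of the Fock space. -/
def fockBasis (p : Σ n, Fin (Module.finrank ℂ (𝓗.H n))) : 𝓗.Fock := 𝓗.toFock p.1 (𝓗.basis p.1 p.2)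

theorem toFock_mem_span (n : ℕ) (ζ : 𝓗.H n) :
    𝓗.toFock n ζ ∈ Submodule.span ℂ (Set.range 𝓗.fockBasis) := by
  rw [← (𝓗.basis n).sum_repr' ζ, map_sum]
  refine Submodule.sum_mem _ fun i _ => ?_
  rw [map_smul]
  exact Submodule.smul_mem _ _ (Submodule.subset_span ⟨⟨n, i⟩, rfl⟩)

theorem dense_span_fockBasis :
    Dense (Submodule.span ℂ (Set.range 𝓗.fockBasis) : Set 𝓗.Fock) := by
  refine dense_span_toFock.mono (Submodule.span_le.2 ?_)
  rintro _ ⟨n, ζ, rfl⟩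
  exact toFock_mem_span n ζ

/-! ### The unitary `U_𝓗` on `F ⊗ L²(G)`, given by a family of matrices over `A`. -/

section Unitary

open Matrix

variable {A : Type*} [Ring A] [StarRing A] [HopfAlgebra ℂ A] [StarModule ℂ A]

theorem fockTensor_tmul (n : ℕ) (ζ : 𝓗.H n) (a : A) :
    fockTensor n (ζ ⊗ₜ a) = toHilbertTensor (𝓗.toFock n ζ ⊗ₜ[ℂ] toL2 A a) := rfl

theorem inner_fockTensor_self (n : ℕ) (ζ z : 𝓗.H n) (a b : A) :
    inner ℂ (fockTensor (A := A) n (ζ ⊗ₜ a)) (fockTensor n (z ⊗ₜ b)) =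
      inner ℂ ζ z * haarState A (star a * b) := by
  rw [fockTensor_tmul, fockTensor_tmul, inner_toHilbertTensor_tmul, inner_toL2, inner_toFock_self]

theorem inner_fockTensor_of_ne {m n : ℕ} (h : m ≠ n) (ζ : 𝓗.H m) (z : 𝓗.H n) (a b : A) :
    inner ℂ (fockTensor (A := A) m (ζ ⊗ₜ a)) (fockTensor n (z ⊗ₜ b)) = 0 := by
  rw [fockTensor_tmul, fockTensor_tmul, inner_toHilbertTensor_tmul, inner_toFock_of_ne h, zero_mul]

/-- Operators on `F ⊗ L²(G)` are determined by the vectors `b i ⊗ Λ(a)`. -/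
theorem fockTensor_ext {E : Type*} [NormedAddCommGroup E] [NormedSpace ℂ E]
    {X Y : HilbertTensor 𝓗.Fock (L2 A) →L[ℂ] E}
    (h : ∀ n j (a : A), X (fockTensor n (𝓗.basis n j ⊗ₜ a)) = Y (fockTensor n (𝓗.basis n j ⊗ₜ a))) :
    X = Y := by
  refine hilbertTensor_ext_of_dense dense_span_fockBasis dense_span_range_toL2 ?_
  rintro _ ⟨⟨n, j⟩, rfl⟩ _ ⟨a, rfl⟩
  exact h n j a

/-- `X` acts on `F ⊗ L²(G)` by the family of matrices `m`. -/
def ActsBy (m : ∀ n, Matrix (Fin (Module.finrank ℂ (𝓗.H n))) (Fin (Module.finrank ℂ (𝓗.H n))) A)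
    (X : HilbertTensor 𝓗.Fock (L2 A) →L[ℂ] HilbertTensor 𝓗.Fock (L2 A)) : Prop :=
  ∀ n j (a : A), X (fockTensor n (𝓗.basis n j ⊗ₜ a)) =
    ∑ i, fockTensor n (𝓗.basis n i ⊗ₜ (m n i j * a))

variable {m m' : ∀ n, Matrix (Fin (Module.finrank ℂ (𝓗.H n))) (Fin (Module.finrank ℂ (𝓗.H n))) A}
  {X X' : HilbertTensor 𝓗.Fock (L2 A) →L[ℂ] HilbertTensor 𝓗.Fock (L2 A)}

theorem ActsBy.unique (h : ActsBy m X) (h' : ActsBy m X') : X = X' :=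
  fockTensor_ext fun n j a => by rw [h, h']

theorem actsBy_one : ActsBy (𝓗 := 𝓗) (A := A) (fun _ => 1) 1 := fun n j a => by
  change _ = ∑ i, fockTensor n (𝓗.basis n i ⊗ₜ ((1 : Matrix _ _ A) i j * a))
  rw [Finset.sum_eq_single j]
  · rw [one_apply_eq, one_mul]; rfl
  · intro i _ hij
    rw [one_apply_ne hij, zero_mul, TensorProduct.tmul_zero, map_zero]
  · simp

theorem ActsBy.mul (h : ActsBy m X) (h' : ActsBy m' X') :
    ActsBy (fun n => m n * m' n) (X * X') := fun n j a => by
  change X (X' _) = _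
  rw [h', map_sum]
  simp only [h _ _ (_ * a)]
  rw [Finset.sum_comm]
  refine Finset.sum_congr rfl fun i _ => ?_
  rw [mul_apply, Finset.sum_mul, TensorProduct.tmul_sum, map_sum]
  simp only [mul_assoc]

theorem ActsBy.star_eq (h : ActsBy m X) (h' : ActsBy (fun n => (m n)ᴴ) X') : star X = X' := by
  refine fockTensor_ext fun n j a => ext_inner_right ℂ fun y => ?_
  rw [ContinuousLinearMap.star_eq_adjoint, ContinuousLinearMap.adjoint_inner_left]
  have key : (innerSL ℂ (fockTensor n (𝓗.basis n j ⊗ₜ a))).comp X =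
      innerSL ℂ (X' (fockTensor n (𝓗.basis n j ⊗ₜ a))) := by
    refine fockTensor_ext fun n' l c => ?_
    rw [ContinuousLinearMap.comp_apply, innerSL_apply_apply, innerSL_apply_apply, h, h', sum_inner,
      inner_sum]
    by_cases hn : n = n'
    · subst hn
      simp only [inner_fockTensor_self, orthonormal_iff_ite.1 (𝓗.basis n).orthonormal, ite_mul,
        one_mul, zero_mul, Finset.sum_ite_eq, Finset.mem_univ, if_true, Finset.sum_ite_eq']
      rw [StarMul.star_mul, conjTranspose_apply, star_star, mul_assoc]
    · simp only [inner_fockTensor_of_ne hn, Finset.sum_const_zero]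
  exact congrArg (fun Z => Z y) key

/-- A family of matrices of isometries defines an isometry on `F ⊗ L²(G)`. -/
theorem exists_actsBy
    (m : ∀ n, Matrix (Fin (Module.finrank ℂ (𝓗.H n))) (Fin (Module.finrank ℂ (𝓗.H n))) A)
    (hm : ∀ n, (m n)ᴴ * m n = 1) :
    ∃ X : HilbertTensor 𝓗.Fock (L2 A) →L[ℂ] HilbertTensor 𝓗.Fock (L2 A), ActsBy m X := by
  -- Finitely supported families in `A` parametrize a dense subspace through `J`, and `W` is what
  -- the operator should do on it. Preservation of inner products makes `W` factor isometrically
  -- through `J`.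
  let J : ((Σ n, Fin (Module.finrank ℂ (𝓗.H n))) →₀ A) →ₗ[ℂ] HilbertTensor 𝓗.Fock (L2 A) :=
    Finsupp.lsum ℂ fun p => fockTensor p.1 ∘ₗ TensorProduct.mk ℂ (𝓗.H p.1) A (𝓗.basis p.1 p.2)
  let W : ((Σ n, Fin (Module.finrank ℂ (𝓗.H n))) →₀ A) →ₗ[ℂ] HilbertTensor 𝓗.Fock (L2 A) :=
    Finsupp.lsum ℂ fun p => ∑ i, fockTensor p.1 ∘ₗ
      TensorProduct.mk ℂ (𝓗.H p.1) A (𝓗.basis p.1 i) ∘ₗ LinearMap.mulLeft ℂ (m p.1 i p.2)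
  have hJ : ∀ p a, J (Finsupp.single p a) = fockTensor p.1 (𝓗.basis p.1 p.2 ⊗ₜ a) := fun p a => by
    simp [J]
  have hW : ∀ p a, W (Finsupp.single p a) =
      ∑ i, fockTensor p.1 (𝓗.basis p.1 i ⊗ₜ (m p.1 i p.2 * a)) := fun p a => by
    simp [W]
  have hdense : DenseRange J := by
    have hle : Submodule.span ℂ {z : HilbertTensor 𝓗.Fock (L2 A) | ∃ ξ ∈ Set.range 𝓗.fockBasis,
        ∃ η ∈ Set.range (toL2 A), z = toHilbertTensor (ξ ⊗ₜ[ℂ] η)} ≤ LinearMap.range J := by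
      rw [Submodule.span_le]
      rintro _ ⟨_, ⟨p, rfl⟩, _, ⟨a, rfl⟩, rfl⟩
      exact ⟨Finsupp.single p a, hJ p a⟩
    exact (dense_span_tmul dense_span_fockBasis dense_span_range_toL2).mono fun x hx => hle hx
  have hinner : ∀ x y, inner ℂ (W x) (W y) = inner ℂ (J x) (J y) := by
    intro x y
    induction x using Finsupp.induction_linear with
    | zero => simp only [map_zero, inner_zero_left]
    | add x x' hx hx' => rw [map_add, map_add, inner_add_left, inner_add_left, hx, hx']
    | single p a =>
    induction y using Finsupp.induction_linear with
    | zero => simp only [map_zero, inner_zero_right]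
    | add y y' hy hy' => rw [map_add, map_add, inner_add_right, inner_add_right, hy, hy']
    | single q c =>
      rw [hW, hW, hJ, hJ]
      obtain ⟨n, j⟩ := p
      obtain ⟨n', l⟩ := q
      simp only [sum_inner, inner_sum]
      by_cases h : n = n'
      · subst h
        simp only [inner_fockTensor_self, orthonormal_iff_ite.1 (𝓗.basis n).orthonormal, ite_mul,
          one_mul, zero_mul, Finset.mem_univ, if_true, Finset.sum_ite_eq']
        have e : ∀ i, star (m n i j * a) * (m n i l * c) =
            star a * (star (m n i j) * m n i l) * c := fun i => by
          rw [StarMul.star_mul]; simp only [mul_assoc]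
        simp only [e]
        rw [← map_sum, ← Finset.sum_mul, ← Finset.mul_sum]
        have hjl := congrFun (congrFun (hm n) j) l
        rw [mul_apply] at hjl
        simp only [conjTranspose_apply] at hjl
        rw [hjl, one_apply]
        split_ifs <;> simp
      · rw [inner_fockTensor_of_ne h]
        exact Finset.sum_eq_zero fun i _ => Finset.sum_eq_zero fun k _ => inner_fockTensor_of_ne h _ _ _ _
  have hnorm : ∀ x, ‖W x‖ = ‖J x‖ := fun x => by
    rw [@norm_eq_sqrt_re_inner ℂ, hinner, ← @norm_eq_sqrt_re_inner ℂ]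
  refine ⟨W.extendOfNorm J, fun n j a => ?_⟩
  rw [← hJ ⟨n, j⟩ a, LinearMap.extendOfNorm_eq hdense ⟨1, fun x => by rw [hnorm, one_mul]⟩]
  exact hW ⟨n, j⟩ a

/-- The matrix coefficients of the representation on `H n`. -/
def Equivariant.matrix (ρ : 𝓗.Equivariant A) (n : ℕ) :
    Matrix (Fin (Module.finrank ℂ (𝓗.H n))) (Fin (Module.finrank ℂ (𝓗.H n))) A :=
  toMatrixAlg (𝓗.basis n) A (ρ.rep n).U

theorem Equivariant.isUnitaryCorep_matrix (ρ : 𝓗.Equivariant A) (n : ℕ) :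
    IsUnitaryCorep (ρ.matrix n) :=
  (ρ.rep n).isUnitaryCorep (𝓗.basis n)

theorem Equivariant.fockTensor_coaction (ρ : 𝓗.Equivariant A) (n : ℕ)
    (j : Fin (Module.finrank ℂ (𝓗.H n))) (a : A) :
    fockTensor n ((LinearMap.mulRight ℂ a).lTensor (𝓗.H n) (coaction (ρ.rep n).U (𝓗.basis n j))) =
      ∑ i, fockTensor n (𝓗.basis n i ⊗ₜ (ρ.matrix n i j * a)) := by
  rw [coaction_apply_basis (𝓗.basis n), map_sum, map_sum]
  rfl

theorem Equivariant.IsFockRep.actsBy {ρ : 𝓗.Equivariant A}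
    {U : HilbertTensor 𝓗.Fock (L2 A) →L[ℂ] HilbertTensor 𝓗.Fock (L2 A)} (hU : ρ.IsFockRep U) :
    ActsBy ρ.matrix U := fun n j a => by
  rw [hU.2, ρ.fockTensor_coaction]

theorem Equivariant.IsFockRep.unique {ρ : 𝓗.Equivariant A}
    {U V : HilbertTensor 𝓗.Fock (L2 A) →L[ℂ] HilbertTensor 𝓗.Fock (L2 A)} (hU : ρ.IsFockRep U)
    (hV : ρ.IsFockRep V) : U = V :=
  hU.actsBy.unique hV.actsBy

/-- The matrices of the `U_n` and their conjugate transposes both consist of isometries. The two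
operators they define are inverse and adjoint to each other, because products and adjoints can be
read off the matrices. -/
theorem Equivariant.exists_isFockRep (ρ : 𝓗.Equivariant A) : ∃ U, ρ.IsFockRep U := by
  have h1 := fun n => (ρ.isUnitaryCorep_matrix n).star_mul
  have h2 := fun n => (ρ.isUnitaryCorep_matrix n).mul_star
  obtain ⟨U, hU⟩ := exists_actsBy ρ.matrix h1
  obtain ⟨V, hV⟩ := exists_actsBy (fun n => (ρ.matrix n)ᴴ) fun n => by
    rw [conjTranspose_conjTranspose]; exact h2 n
  have hVU : V * U = 1 := ActsBy.unique (by simpa only [h1] using hV.mul hU) actsBy_one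
  have hUV : U * V = 1 := ActsBy.unique (by simpa only [h2] using hU.mul hV) actsBy_one
  have hadj : star U = V := hU.star_eq hV
  refine ⟨U, ⟨by rw [hadj, hVU], by rw [hadj, hUV]⟩, fun n ζ b => ?_⟩
  have hlin : (U.toLinearMap ∘ₗ fockTensor n) ∘ₗ (TensorProduct.mk ℂ (𝓗.H n) A).flip b =
      fockTensor n ∘ₗ (LinearMap.mulRight ℂ b).lTensor (𝓗.H n) ∘ₗ coaction (ρ.rep n).U := by
    refine (𝓗.basis n).toBasis.ext fun j => ?_
    simp only [OrthonormalBasis.coe_toBasis]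
    exact (hU n j b).trans (ρ.fockTensor_coaction n j b).symm
  exact LinearMap.congr_fun hlin ζ

end Unitary

end SubproductSystem

/-! ### Intertwiners in matrix form -/

section Intertwiners

open Matrix

variable {A : Type*} [Ring A] [StarRing A] [HopfAlgebra ℂ A]
variable {κ μ : Type} [Fintype κ] [DecidableEq κ] [Fintype μ] [DecidableEq μ]
variable {H K : Type*} [NormedAddCommGroup H] [InnerProductSpace ℂ H] [FiniteDimensional ℂ H]
  [NormedAddCommGroup K] [InnerProductSpace ℂ K] [FiniteDimensional ℂ K]

theorem toMatrixAlg_tensorRep (b : OrthonormalBasis κ ℂ H) (c : OrthonormalBasis μ ℂ K)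
    (U : Module.End ℂ H ⊗[ℂ] A) (V : Module.End ℂ K ⊗[ℂ] A) :
    toMatrixAlg (b.tensorProduct c) A (tensorRep U V) =
      kron (toMatrixAlg b A U) (toMatrixAlg c A V) := by
  ext ⟨i, k⟩ ⟨j, l⟩
  rw [kron_apply]
  unfold tensorRep
  induction U with
  | zero => simp
  | add x y hx hy => simp only [map_add, add_mul, Matrix.add_apply, hx, hy]
  | tmul x a =>
  induction V with
  | zero => simp
  | add x y hx hy => simp only [map_add, mul_add, Matrix.add_apply, hx, hy]
  | tmul y d =>
    rw [Algebra.TensorProduct.map_tmul, Algebra.TensorProduct.map_tmul,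
      Algebra.TensorProduct.tmul_mul_tmul, toMatrixAlg_tmul, toMatrixAlg_tmul, toMatrixAlg_tmul,
      OrthonormalBasis.tensorProduct_apply, OrthonormalBasis.tensorProduct_apply, smul_mul_smul_comm]
    congr 1

theorem sum_tmul_injective (c : OrthonormalBasis μ ℂ K) {x y : μ → A}
    (h : ∑ k, c k ⊗ₜ[ℂ] x k = ∑ k, c k ⊗ₜ[ℂ] y k) : x = y := by
  funext l
  have := congrArg (fun z => TensorProduct.lid ℂ A ((innerₛₗ ℂ (c l)).rTensor A z)) h
  simpa [orthonormal_iff_ite.1 c.orthonormal] using this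

/-- The matrix of a linear map in orthonormal bases. -/
def onMatrix (b : OrthonormalBasis κ ℂ H) (c : OrthonormalBasis μ ℂ K) (t : H →ₗ[ℂ] K) :
    Matrix μ κ ℂ :=
  Matrix.of fun i j => inner ℂ (c i) (t (b j))

theorem onMatrix_adjoint (b : OrthonormalBasis κ ℂ H) (c : OrthonormalBasis μ ℂ K)
    (t : H →ₗ[ℂ] K) : onMatrix c b (LinearMap.adjoint t) = (onMatrix b c t)ᴴ := by
  ext i j
  simp [onMatrix, LinearMap.adjoint_inner_right]

/-- Turns the comodule form of the intertwining condition into a matrix equation, where unitarity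
and averaging can be used. -/
theorem intertwines_iff (b : OrthonormalBasis κ ℂ H) (c : OrthonormalBasis μ ℂ K)
    (U : Module.End ℂ H ⊗[ℂ] A) (V : Module.End ℂ K ⊗[ℂ] A) (t : H →ₗ[ℂ] K) :
    Intertwines U V t ↔ scalarMatrix A (onMatrix b c t) * toMatrixAlg b A U =
      toMatrixAlg c A V * scalarMatrix A (onMatrix b c t) := by
  have h1 : ∀ j, (t.rTensor A ∘ₗ coaction U) (b j) =
      ∑ k, c k ⊗ₜ (scalarMatrix A (onMatrix b c t) * toMatrixAlg b A U) k j := fun j => by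
    have e : ∀ i, t (b i) = ∑ k, onMatrix b c t k i • c k := fun i => (c.sum_repr' _).symm
    rw [LinearMap.comp_apply, coaction_apply_basis, map_sum]
    simp only [LinearMap.rTensor_tmul, scalarMatrix_mul_apply, TensorProduct.tmul_sum, e,
      TensorProduct.sum_tmul, TensorProduct.tmul_smul, ← TensorProduct.smul_tmul']
    exact Finset.sum_comm
  have h2 : ∀ j, (coaction V ∘ₗ t) (b j) =
      ∑ k, c k ⊗ₜ (toMatrixAlg c A V * scalarMatrix A (onMatrix b c t)) k j := fun j => by
    have e : ∀ i, t (b i) = ∑ k, onMatrix b c t k i • c k := fun i => (c.sum_repr' _).symm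
    rw [LinearMap.comp_apply, e, map_sum]
    simp only [map_smul, coaction_apply_basis c, mul_scalarMatrix_apply, TensorProduct.tmul_sum,
      TensorProduct.tmul_smul, Finset.smul_sum]
    exact Finset.sum_comm
  constructor
  · intro h
    have h' : ∀ j, (t.rTensor A ∘ₗ coaction U) (b j) = (coaction V ∘ₗ t) (b j) := fun j => by rw [h]
    ext k j
    have := h' j
    rw [h1, h2] at this
    exact congrFun (sum_tmul_injective c this) k
  · intro h
    refine b.toBasis.ext fun j => ?_
    rw [OrthonormalBasis.coe_toBasis, h1, h2, h]

/-- The adjoint of an intertwiner of unitary representations is an intertwiner. -/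
theorem Intertwines.adjoint [StarModule ℂ A] (b : OrthonormalBasis κ ℂ H) (c : OrthonormalBasis μ ℂ K)
    {U : Module.End ℂ H ⊗[ℂ] A} {V : Module.End ℂ K ⊗[ℂ] A} {t : H →ₗ[ℂ] K}
    (hU : IsUnitaryCorep (toMatrixAlg b A U)) (hV : IsUnitaryCorep (toMatrixAlg c A V))
    (h : Intertwines U V t) : Intertwines V U (LinearMap.adjoint t) := by
  rw [intertwines_iff b c] at h
  rw [intertwines_iff c b, onMatrix_adjoint, scalarMatrix_conjTranspose]
  set M := scalarMatrix A (onMatrix b c t)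
  set u := toMatrixAlg b A U
  set v := toMatrixAlg c A V
  have h' : uᴴ * Mᴴ = Mᴴ * vᴴ := by
    rw [← conjTranspose_mul, h, conjTranspose_mul]
  calc Mᴴ * v = u * uᴴ * Mᴴ * v := by rw [hU.mul_star, Matrix.one_mul]
    _ = u * (Mᴴ * vᴴ) * v := by rw [← h']; simp only [Matrix.mul_assoc]
    _ = u * Mᴴ * (vᴴ * v) := by simp only [Matrix.mul_assoc]
    _ = _ := by rw [hV.star_mul, Matrix.mul_one]

theorem coaction_tensorRep_basis (b : OrthonormalBasis κ ℂ H) (c : OrthonormalBasis μ ℂ K)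
    (U : Module.End ℂ H ⊗[ℂ] A) (V : Module.End ℂ K ⊗[ℂ] A) (i : κ) (j : μ) :
    coaction (tensorRep U V) (b i ⊗ₜ[ℂ] c j) =
      ∑ l, ∑ m, (b l ⊗ₜ[ℂ] c m) ⊗ₜ (toMatrixAlg b A U l i * toMatrixAlg c A V m j) := by
  have := coaction_apply_basis (b.tensorProduct c) (tensorRep U V) (i, j)
  rw [OrthonormalBasis.tensorProduct_apply, toMatrixAlg_tensorRep, Fintype.sum_prod_type] at this
  rw [this]
  simp only [OrthonormalBasis.tensorProduct_apply, kron_apply]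

end Intertwiners

/-! ### Creation operators of higher degree -/

namespace SubproductSystem

variable {𝓗 : SubproductSystem}

variable (𝓗) in
/-- The multiplication `H k ⊗ H l → H (k + l)`, the adjoint of `w k l`. -/
def mult (k l : ℕ) : 𝓗.H k ⊗[ℂ] 𝓗.H l →ₗ[ℂ] 𝓗.H (k + l) :=
  LinearMap.adjoint (𝓗.w k l).toLinearMap

theorem inner_mult (k l : ℕ) (x : 𝓗.H (k + l)) (z : 𝓗.H k ⊗[ℂ] 𝓗.H l) :
    inner ℂ x (𝓗.mult k l z) = inner ℂ (𝓗.w k l x) z :=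
  LinearMap.adjoint_inner_right _ _ _

theorem mult_w (k l : ℕ) (x : 𝓗.H (k + l)) : 𝓗.mult k l (𝓗.w k l x) = x :=
  ext_inner_left ℂ fun y => by rw [inner_mult, LinearIsometry.inner_map_map]

theorem cast_eq_castEquiv {m n : ℕ} (h : m = n) (x : 𝓗.H m) :
    cast (congrArg 𝓗.H h) x = 𝓗.castEquiv h x := by
  subst h; rfl

/-! ### Product functionals on tensor products. -/

section TensorForm

variable {E F G E' : Type*} [AddCommGroup E] [Module ℂ E] [AddCommGroup F] [Module ℂ F]
  [AddCommGroup G] [Module ℂ G] [AddCommGroup E'] [Module ℂ E']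

/-- The functional `x ⊗ y ↦ f x * g y`. -/
def tensorForm (f : E →ₗ[ℂ] ℂ) (g : F →ₗ[ℂ] ℂ) : E ⊗[ℂ] F →ₗ[ℂ] ℂ :=
  LinearMap.mul' ℂ ℂ ∘ₗ TensorProduct.map f g

theorem tensorForm_tmul (f : E →ₗ[ℂ] ℂ) (g : F →ₗ[ℂ] ℂ) (x : E) (y : F) :
    tensorForm f g (x ⊗ₜ y) = f x * g y := rfl

theorem tensorForm_lTensor (f : E →ₗ[ℂ] ℂ) (g : F →ₗ[ℂ] ℂ) (t : E' →ₗ[ℂ] F) (z : E ⊗[ℂ] E') :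
    tensorForm f g (t.lTensor E z) = tensorForm f (g ∘ₗ t) z :=
  LinearMap.congr_fun (TensorProduct.ext' (g := tensorForm f g ∘ₗ t.lTensor E)
    (h := tensorForm f (g ∘ₗ t)) fun _ _ => rfl) z

theorem tensorForm_rTensor (f : E →ₗ[ℂ] ℂ) (g : F →ₗ[ℂ] ℂ) (t : E' →ₗ[ℂ] E) (z : E' ⊗[ℂ] F) :
    tensorForm f g (t.rTensor F z) = tensorForm (f ∘ₗ t) g z :=
  LinearMap.congr_fun (TensorProduct.ext' (g := tensorForm f g ∘ₗ t.rTensor F)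
    (h := tensorForm (f ∘ₗ t) g) fun _ _ => rfl) z

theorem tensorForm_assoc (f : E →ₗ[ℂ] ℂ) (g : F →ₗ[ℂ] ℂ) (h : G →ₗ[ℂ] ℂ) (z : (E ⊗[ℂ] F) ⊗[ℂ] G) :
    tensorForm f (tensorForm g h) (TensorProduct.assoc ℂ E F G z) =
      tensorForm (tensorForm f g) h z :=
  LinearMap.congr_fun (TensorProduct.ext_threefold
    (g := tensorForm f (tensorForm g h) ∘ₗ (TensorProduct.assoc ℂ E F G).toLinearMap)
    (h := tensorForm (tensorForm f g) h) fun x y w => (mul_assoc (f x) (g y) (h w)).symm) z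

theorem innerₛₗ_tmul {E F : Type*} [NormedAddCommGroup E] [InnerProductSpace ℂ E]
    [NormedAddCommGroup F] [InnerProductSpace ℂ F] (x : E) (y : F) :
    innerₛₗ ℂ (x ⊗ₜ[ℂ] y) = tensorForm (innerₛₗ ℂ x) (innerₛₗ ℂ y) :=
  TensorProduct.ext' fun z w => by
    rw [tensorForm_tmul, innerₛₗ_apply_apply, TensorProduct.inner_tmul]; rfl

end TensorForm

theorem innerₛₗ_mult (k l : ℕ) (ξ : 𝓗.H k) (η : 𝓗.H l) :
    innerₛₗ ℂ (𝓗.mult k l (ξ ⊗ₜ η)) =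
      tensorForm (innerₛₗ ℂ ξ) (innerₛₗ ℂ η) ∘ₗ (𝓗.w k l).toLinearMap := by
  ext x
  rw [LinearMap.comp_apply, ← innerₛₗ_tmul]
  exact LinearMap.adjoint_inner_left _ _ _

/-- Associativity of the multiplication. -/
theorem mult_assoc (k l n : ℕ) (ξ : 𝓗.H k) (η : 𝓗.H l) (ζ : 𝓗.H n) :
    𝓗.mult k (l + n) (ξ ⊗ₜ 𝓗.mult l n (η ⊗ₜ ζ)) =
      𝓗.castEquiv (Nat.add_assoc k l n) (𝓗.mult (k + l) n (𝓗.mult k l (ξ ⊗ₜ η) ⊗ₜ ζ)) := by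
  refine ext_inner_right ℂ fun y => ?_
  obtain ⟨x, rfl⟩ := (𝓗.castEquiv (Nat.add_assoc k l n)).surjective y
  -- Pairing with `x` turns both sides into the product functional of `ξ`, `η`, `ζ` on the triple
  -- tensor product, evaluated on the two sides of coassociativity.
  rw [LinearIsometryEquiv.inner_map_map, ← innerₛₗ_apply_apply, ← innerₛₗ_apply_apply,
    innerₛₗ_mult, innerₛₗ_mult, LinearMap.comp_apply, innerₛₗ_mult, LinearMap.comp_apply,
    innerₛₗ_mult, ← tensorForm_lTensor, ← tensorForm_rTensor, ← tensorForm_assoc,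
    ← cast_eq_castEquiv]
  exact congrArg _ (𝓗.coassoc k l n x).symm

/-- `X` is the operator `ζ ↦ η ζ` of multiplication by `η` on the Fock space. -/
def IsShift (n : ℕ) (η : 𝓗.H n) (X : 𝓗.Fock →L[ℂ] 𝓗.Fock) : Prop :=
  ∀ k (ζ : 𝓗.H k), X (𝓗.toFock k ζ) = 𝓗.toFock (n + k) (𝓗.mult n k (η ⊗ₜ ζ))

theorem IsShift.unique {n : ℕ} {η : 𝓗.H n} {X Y : 𝓗.Fock →L[ℂ] 𝓗.Fock} (hX : IsShift n η X)
    (hY : IsShift n η Y) : X = Y :=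
  fock_ext fun k ζ => by rw [hX, hY]

theorem isShift_creation (ξ : 𝓗.H 1) : IsShift 1 ξ (𝓗.creation ξ) := fun k ζ => by
  rw [creation_toFock, mulVec]
  exact toFock_castEquiv _ _

theorem IsShift.add {n : ℕ} {η θ : 𝓗.H n} {X Y : 𝓗.Fock →L[ℂ] 𝓗.Fock} (hX : IsShift n η X)
    (hY : IsShift n θ Y) : IsShift n (η + θ) (X + Y) := fun k ζ => by
  rw [_root_.add_apply, hX, hY, TensorProduct.add_tmul, map_add, map_add]

theorem IsShift.smul {n : ℕ} {η : 𝓗.H n} {X : 𝓗.Fock →L[ℂ] 𝓗.Fock} (c : ℂ) (hX : IsShift n η X) :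
    IsShift n (c • η) (c • X) := fun k ζ => by
  rw [_root_.smul_apply, hX, ← TensorProduct.smul_tmul', map_smul, map_smul]

theorem IsShift.mul {k l : ℕ} {ξ : 𝓗.H k} {η : 𝓗.H l} {X Y : 𝓗.Fock →L[ℂ] 𝓗.Fock}
    (hX : IsShift k ξ X) (hY : IsShift l η Y) :
    IsShift (k + l) (𝓗.mult k l (ξ ⊗ₜ η)) (X * Y) := fun n ζ => by
  change X (Y _) = _
  rw [hY, hX, mult_assoc, toFock_castEquiv]

/-- As `H 0` is one dimensional, `w 0 n` is an isometry between spaces of equal dimension, hence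
bijective, and `mult 0 n` is its inverse. -/
theorem mult_zero_injective (n : ℕ) : Function.Injective (𝓗.mult 0 n) := by
  have hd : Module.finrank ℂ (𝓗.H (0 + n)) = Module.finrank ℂ (𝓗.H 0 ⊗[ℂ] 𝓗.H n) := by
    rw [Module.finrank_tensorProduct, 𝓗.finrank_zero, one_mul, Nat.zero_add]
  have hs : Function.Surjective (𝓗.w 0 n).toLinearMap :=
    (LinearMap.injective_iff_surjective_of_finrank_eq_finrank hd).1 (𝓗.w 0 n).injective
  intro x y h
  obtain ⟨x, rfl⟩ := hs x
  obtain ⟨y, rfl⟩ := hs y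
  have h' : 𝓗.mult 0 n (𝓗.w 0 n x) = 𝓗.mult 0 n (𝓗.w 0 n y) := h
  rw [mult_w, mult_w] at h'
  rw [h']

/-- `H 0` contains a unit of the multiplication. -/
theorem exists_isShift_one : ∃ e : 𝓗.H 0, IsShift 0 e 1 := by
  obtain ⟨e₀, he₀, hspan⟩ := finrank_eq_one_iff'.1 𝓗.finrank_zero
  obtain ⟨c, hc⟩ := hspan (𝓗.mult 0 0 (e₀ ⊗ₜ e₀))
  -- Cancelling `e₀` in `e₀ (e₀ ζ) = (e₀ e₀) ζ = c e₀ ζ` shows that `e₀` acts as the scalar `c`. The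
  -- identity is stated in the Fock space, where `H (0 + k)` and `H k` have the same image.
  have key : ∀ k (ζ : 𝓗.H k), 𝓗.toFock (0 + k) (𝓗.mult 0 k (e₀ ⊗ₜ ζ)) = 𝓗.toFock k (c • ζ) := by
    intro k ζ
    let z : 𝓗.H k := 𝓗.castEquiv (Nat.zero_add k) (𝓗.mult 0 k (e₀ ⊗ₜ ζ))
    have h1 : 𝓗.mult 0 k (e₀ ⊗ₜ z) = 𝓗.mult 0 k (e₀ ⊗ₜ (c • ζ)) := by
      have h2 : 𝓗.toFock (0 + (0 + k)) (𝓗.mult 0 (0 + k) (e₀ ⊗ₜ 𝓗.mult 0 k (e₀ ⊗ₜ ζ))) =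
          𝓗.toFock (0 + k) (𝓗.mult 0 k (e₀ ⊗ₜ z)) := by
        have : ∀ m (h : m = k) (x : 𝓗.H m), 𝓗.toFock (0 + m) (𝓗.mult 0 m (e₀ ⊗ₜ x)) =
            𝓗.toFock (0 + k) (𝓗.mult 0 k (e₀ ⊗ₜ 𝓗.castEquiv h x)) := by
          intro m h x; subst h; rfl
        exact this _ (Nat.zero_add k) _
      rw [mult_assoc, toFock_castEquiv, ← hc] at h2
      rw [← toFock_injective _ h2, ← TensorProduct.smul_tmul', TensorProduct.tmul_smul]
    have h3 := mult_zero_injective k h1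
    have h4 : z = c • ζ := by
      rw [← sub_eq_zero, ← TensorProduct.tmul_sub] at h3
      have := congrArg norm h3
      rw [TensorProduct.norm_tmul, norm_zero, mul_eq_zero] at this
      exact sub_eq_zero.1 (norm_eq_zero.1 (this.resolve_left (norm_ne_zero_iff.2 he₀)))
    rw [← h4, toFock_castEquiv]
  have hc0 : c ≠ 0 := by
    rintro rfl
    rw [zero_smul] at hc
    have h1 := mult_zero_injective 0 (hc.symm.trans (map_zero _).symm)
    have := congrArg norm h1
    rw [TensorProduct.norm_tmul, norm_zero, mul_self_eq_zero] at this
    exact he₀ (norm_eq_zero.1 this)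
  refine ⟨c⁻¹ • e₀, fun k ζ => ?_⟩
  rw [TensorProduct.smul_tmul, key, smul_smul, mul_inv_cancel₀ hc0, one_smul]
  rfl

/-- The multiplication `H 1 ⊗ H n → H (1 + n)` is onto, with right inverse `w 1 n`, so by
associativity multiplication by any vector is a sum of products of creation operators; in degree `0`
it is a multiple of the identity. -/
theorem exists_isShift (n : ℕ) : ∀ η : 𝓗.H n, ∃ X : 𝓗.toeplitz, IsShift n η X := by
  induction n with
  | zero =>
    intro η
    obtain ⟨e, he⟩ := exists_isShift_one (𝓗 := 𝓗)
    have he0 : e ≠ 0 := by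
      rintro rfl
      obtain ⟨e₀, he₀, -⟩ := finrank_eq_one_iff'.1 𝓗.finrank_zero
      have h := he 0 e₀
      rw [TensorProduct.zero_tmul, map_zero, map_zero] at h
      exact he₀ (toFock_injective 0 (h.trans (map_zero _).symm))
    obtain ⟨c, rfl⟩ := (finrank_eq_one_iff_of_nonzero' e he0).1 𝓗.finrank_zero η
    exact ⟨c • 1, he.smul c⟩
  | succ n ih =>
    have key : ∀ η : 𝓗.H (1 + n), ∃ X : 𝓗.toeplitz, IsShift (1 + n) η X := by
      intro η
      rw [← mult_w 1 n η]
      generalize 𝓗.w 1 n η = z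
      induction z with
      | zero => exact ⟨0, fun k ζ => by rw [map_zero, TensorProduct.zero_tmul, map_zero, map_zero]; rfl⟩
      | add x y hx hy =>
        obtain ⟨X, hX⟩ := hx
        obtain ⟨Y, hY⟩ := hy
        exact ⟨X + Y, by rw [map_add]; exact hX.add hY⟩
      | tmul ξ ζ =>
        obtain ⟨Y, hY⟩ := ih ζ
        exact ⟨𝓗.S ξ * Y, (isShift_creation ξ).mul hY⟩
    rwa [Nat.add_comm 1 n] at key

/-- The operator of multiplication by `η ∈ H n` on the Fock space, an element of the Toeplitz
algebra. -/
def shift (n : ℕ) : 𝓗.H n →ₗ[ℂ] 𝓗.toeplitz where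
  toFun η := (exists_isShift n η).choose
  map_add' η θ := Subtype.ext <| (exists_isShift n (η + θ)).choose_spec.unique
    ((exists_isShift n η).choose_spec.add (exists_isShift n θ).choose_spec)
  map_smul' c η := Subtype.ext <| (exists_isShift n (c • η)).choose_spec.unique
    ((exists_isShift n η).choose_spec.smul c)

theorem isShift_shift {n : ℕ} (η : 𝓗.H n) : IsShift n η (shift n η : 𝓗.toeplitz) :=
  (exists_isShift n η).choose_spec

theorem IsShift.eq_shift {n : ℕ} {η : 𝓗.H n} {X : 𝓗.toeplitz} (h : IsShift n η X) :
    X = shift n η :=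
  Subtype.ext (h.unique (isShift_shift η))

theorem shift_mul_shift {k l : ℕ} (ξ : 𝓗.H k) (η : 𝓗.H l) :
    shift k ξ * shift l η = shift (k + l) (𝓗.mult k l (ξ ⊗ₜ η)) :=
  IsShift.eq_shift ((isShift_shift ξ).mul (isShift_shift η))

theorem S_eq_shift (ξ : 𝓗.H 1) : 𝓗.S ξ = shift 1 ξ :=
  IsShift.eq_shift (isShift_creation ξ)

/-- With its adjoint counterpart, this reduces normally ordered monomials to products `T_η T_θ*`
with each vector in a single level; the empty product corresponds to the unit of `H 0`. -/
theorem exists_prod_s_eq (l : List (𝓗.H 1)) :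
    ∃ n, ∃ η : 𝓗.H n, (l.map 𝓗.s).prod = 𝓗.quotientMap (shift n η) := by
  induction l with
  | nil =>
    obtain ⟨e, he⟩ := exists_isShift_one (𝓗 := 𝓗)
    refine ⟨0, e, ?_⟩
    rw [← IsShift.eq_shift (X := (1 : 𝓗.toeplitz)) he, map_one]
    rfl
  | cons ξ l ih =>
    obtain ⟨n, η, h⟩ := ih
    exact ⟨1 + n, 𝓗.mult 1 n (ξ ⊗ₜ η), by
      rw [List.map_cons, List.prod_cons, h, s, S_eq_shift, ← map_mul, shift_mul_shift]⟩

theorem exists_prod_star_s_eq (l : List (𝓗.H 1)) :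
    ∃ n, ∃ η : 𝓗.H n, (l.map fun ξ => star (𝓗.s ξ)).prod = star (𝓗.quotientMap (shift n η)) := by
  induction l with
  | nil =>
    obtain ⟨e, he⟩ := exists_isShift_one (𝓗 := 𝓗)
    refine ⟨0, e, ?_⟩
    rw [← IsShift.eq_shift (X := (1 : 𝓗.toeplitz)) he, map_one, star_one]
    rfl
  | cons ξ l ih =>
    obtain ⟨n, η, h⟩ := ih
    exact ⟨n + 1, 𝓗.mult n 1 (η ⊗ₜ ξ), by
      rw [List.map_cons, List.prod_cons, h, s, S_eq_shift, ← StarMul.star_mul, ← map_mul,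
        shift_mul_shift]⟩

end SubproductSystem

/-- Conjugation by a unitary. -/
def conjHom {E : Type*} [Ring E] [StarRing E] [Algebra ℂ E] [StarModule ℂ E] {u : E}
    (hu : u ∈ unitary E) : E →⋆ₐ[ℂ] E :=
  (Unitary.conjStarAlgAut ℂ E ⟨u, hu⟩ : E ≃⋆ₐ[ℂ] E)

/-! ### The action on the Toeplitz algebra -/

namespace SubproductSystem

variable {𝓗 : SubproductSystem}
variable {A : Type*} [Ring A] [StarRing A] [HopfAlgebra ℂ A] [StarModule ℂ A]

theorem Equivariant.intertwines_mult (ρ : 𝓗.Equivariant A) (k l : ℕ) :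
    Intertwines (tensorRep (ρ.rep k).U (ρ.rep l).U) (ρ.rep (k + l)).U (𝓗.mult k l) := by
  refine Intertwines.adjoint (𝓗.basis (k + l)) ((𝓗.basis k).tensorProduct (𝓗.basis l))
    (ρ.isUnitaryCorep_matrix _) ?_ (ρ.equivariant k l)
  rw [toMatrixAlg_tensorRep]
  exact (ρ.isUnitaryCorep_matrix k).kron (ρ.isUnitaryCorep_matrix l)

theorem Equivariant.coaction_mult_basis (ρ : 𝓗.Equivariant A) (n k : ℕ)
    (i : Fin (Module.finrank ℂ (𝓗.H n))) (j : Fin (Module.finrank ℂ (𝓗.H k))) :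
    coaction (ρ.rep (n + k)).U (𝓗.mult n k (𝓗.basis n i ⊗ₜ 𝓗.basis k j)) =
      ∑ l, ∑ m, 𝓗.mult n k (𝓗.basis n l ⊗ₜ 𝓗.basis k m) ⊗ₜ (ρ.matrix n l i * ρ.matrix k m j) := by
  have h := LinearMap.congr_fun (ρ.intertwines_mult n k) (𝓗.basis n i ⊗ₜ 𝓗.basis k j)
  rw [LinearMap.comp_apply, LinearMap.comp_apply, coaction_tensorRep_basis, map_sum] at h
  rw [← h]
  simp only [map_sum, LinearMap.rTensor_tmul]
  rfl

theorem opTensor_fockTensor (x : 𝓗.Fock →L[ℂ] 𝓗.Fock) (y : L2 A →L[ℂ] L2 A) (n : ℕ) (ζ : 𝓗.H n)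
    (a : A) : opTensor x y (fockTensor n (ζ ⊗ₜ a)) =
      toHilbertTensor (x (𝓗.toFock n ζ) ⊗ₜ[ℂ] y (toL2 A a)) :=
  opTensor_tmul _ _ _ _

/-! ### Conjugation of `X ⊗ 1` by the representation on the Fock space. -/

section Conjugation

variable {ρ : 𝓗.Equivariant A}
  {U : HilbertTensor 𝓗.Fock (L2 A) →L[ℂ] HilbertTensor 𝓗.Fock (L2 A)}

/-- Multiplication `H n ⊗ H k → H (n + k)` is an intertwiner, so applying `U` to a product `η ζ`
amounts to applying `U_n` to `η` and `U` to `ζ`; the coefficients of `U_n` end up in the second leg.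
-/
theorem Equivariant.IsFockRep.mul_opTensor_shift [CompactQuantumGroup A] (hU : ρ.IsFockRep U) (n : ℕ)
    (i : Fin (Module.finrank ℂ (𝓗.H n))) :
    U * opTensor (shift n (𝓗.basis n i) : 𝓗.toeplitz) 1 =
      (∑ l, opTensor (shift n (𝓗.basis n l) : 𝓗.toeplitz) (regularRep A (ρ.matrix n l i))) * U := by
  refine fockTensor_ext fun k j a => ?_
  rw [mul_apply_eq_comp, mul_apply_eq_comp, opTensor_fockTensor, isShift_shift]
  have e : U (toHilbertTensor (𝓗.toFock (n + k) (𝓗.mult n k (𝓗.basis n i ⊗ₜ 𝓗.basis k j)) ⊗ₜ[ℂ]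
      (1 : L2 A →L[ℂ] L2 A) (toL2 A a))) =
      fockTensor (n + k) ((LinearMap.mulRight ℂ a).lTensor _
        (coaction (ρ.rep (n + k)).U (𝓗.mult n k (𝓗.basis n i ⊗ₜ 𝓗.basis k j)))) := hU.2 _ _ _
  rw [e, ρ.coaction_mult_basis, hU.actsBy, _root_.sum_apply]
  simp only [map_sum, LinearMap.lTensor_tmul, LinearMap.mulRight_apply, opTensor_fockTensor,
    isShift_shift _ k, regularRep_toL2]
  simp only [fockTensor_tmul, mul_assoc]

theorem Equivariant.IsFockRep.conj_shift [CompactQuantumGroup A] (hU : ρ.IsFockRep U) (n : ℕ)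
    (i : Fin (Module.finrank ℂ (𝓗.H n))) :
    U * opTensor (shift n (𝓗.basis n i) : 𝓗.toeplitz) 1 * star U =
      ∑ l, opTensor (shift n (𝓗.basis n l) : 𝓗.toeplitz) (regularRep A (ρ.matrix n l i)) := by
  rw [hU.mul_opTensor_shift, mul_assoc, Unitary.mul_star_self_of_mem hU.1, mul_one]

/-- Conjugation of `X ⊗ 1` by the representation on the Fock space. -/
def Equivariant.IsFockRep.conj (hU : ρ.IsFockRep U) :
    (𝓗.Fock →L[ℂ] 𝓗.Fock) →⋆ₐ[ℂ] (HilbertTensor 𝓗.Fock (L2 A) →L[ℂ] HilbertTensor 𝓗.Fock (L2 A)) :=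
  (conjHom hU.1).comp (opTensorLeft 𝓗.Fock (L2 A))

theorem Equivariant.IsFockRep.conj_apply (hU : ρ.IsFockRep U) (X : 𝓗.Fock →L[ℂ] 𝓗.Fock) :
    hU.conj X = U * opTensor X 1 * star U := rfl

theorem Equivariant.IsFockRep.continuous_conj (hU : ρ.IsFockRep U) : Continuous hU.conj :=
  AddMonoidHomClass.continuous_of_bound hU.conj 1 fun t => by
    rw [one_mul]; exact NonUnitalStarAlgHom.norm_apply_le hU.conj t

/-- By continuity the generators suffice, and a creation operator is conjugated into a finite sum of
elementary tensors. -/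
theorem Equivariant.IsFockRep.conj_mem [CompactQuantumGroup A] (hU : ρ.IsFockRep U)
    {t : 𝓗.Fock →L[ℂ] 𝓗.Fock} (ht : t ∈ 𝓗.toeplitz) :
    hU.conj t ∈ spatialTensor 𝓗.toeplitz (reducedAlgebra A) := by
  have hcl : IsClosed ((spatialTensor 𝓗.toeplitz (reducedAlgebra A)).comap hU.conj :
      Set (𝓗.Fock →L[ℂ] 𝓗.Fock)) :=
    (StarSubalgebra.isClosed_topologicalClosure _).preimage hU.continuous_conj
  refine StarSubalgebra.topologicalClosure_minimal (StarAlgebra.adjoin_le ?_) hcl ht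
  rintro _ ⟨ξ, rfl⟩
  change hU.conj (𝓗.S ξ : 𝓗.toeplitz) ∈ spatialTensor 𝓗.toeplitz (reducedAlgebra A)
  rw [S_eq_shift, ← (𝓗.basis 1).sum_repr' ξ, map_sum, AddSubmonoidClass.coe_finsetSum, map_sum]
  refine sum_mem fun i _ => ?_
  rw [map_smul]
  refine (map_smul hU.conj _ (shift 1 (𝓗.basis 1 i) : 𝓗.toeplitz).1).symm ▸ SMulMemClass.smul_mem _ ?_
  rw [hU.conj_apply, hU.conj_shift]
  refine sum_mem fun l _ => ?_
  exact StarSubalgebra.le_topologicalClosure _ (StarAlgebra.subset_adjoin ℂ _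
    ⟨_, Subtype.prop _, _, regularRep_mem _, rfl⟩)

end Conjugation

theorem Equivariant.exists_isToeplitzAction [CompactQuantumGroup A] (ρ : 𝓗.Equivariant A) :
    ∃ αT, ρ.IsToeplitzAction αT := by
  obtain ⟨U, hU⟩ := ρ.exists_isFockRep
  exact ⟨(hU.conj.comp 𝓗.toeplitz.subtype).codRestrict _ fun t => hU.conj_mem t.2, U, hU,
    fun t => rfl⟩

theorem Equivariant.IsToeplitzAction.unique {ρ : 𝓗.Equivariant A}
    {α β : 𝓗.toeplitz →⋆ₐ[ℂ] SpatialTensor 𝓗.toeplitz (reducedAlgebra A)}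
    (hα : ρ.IsToeplitzAction α) (hβ : ρ.IsToeplitzAction β) : α = β := by
  obtain ⟨U, hU, h⟩ := hα
  obtain ⟨V, hV, h'⟩ := hβ
  refine StarAlgHom.ext fun t => Subtype.ext ?_
  have : SpatialTensor.toOp (α t) = SpatialTensor.toOp (β t) := by rw [h, h', hU.unique hV]
  exact this

/-! ### Projections onto finitely many levels -/

variable (𝓗) in
/-- The embedding of `H n` as a continuous map. -/
def toFockL (n : ℕ) : 𝓗.H n →L[ℂ] 𝓗.Fock := LinearMap.toContinuousLinearMap (𝓗.toFock n)

theorem adjoint_toFockL_apply (n : ℕ) (f : 𝓗.Fock) :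
    ContinuousLinearMap.adjoint (𝓗.toFockL n) f = (show 𝓗.FockSum from f) n :=
  ext_inner_left ℂ fun ζ => by
    rw [ContinuousLinearMap.adjoint_inner_right]
    exact lp.inner_single_left (𝕜 := ℂ) (G := 𝓗.H) n ζ f

variable (𝓗) in
/-- The projection onto the sum of the `H n` with `n < N`. -/
def levelProj (N : ℕ) : 𝓗.Fock →L[ℂ] 𝓗.Fock :=
  ∑ n ∈ Finset.range N, (𝓗.toFockL n).comp (ContinuousLinearMap.adjoint (𝓗.toFockL n))

theorem tendsto_levelProj (f : 𝓗.Fock) :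
    Filter.Tendsto (fun N => 𝓗.levelProj N f) Filter.atTop (nhds f) := by
  have h : HasSum (fun n => 𝓗.toFock n ((show 𝓗.FockSum from f) n)) f :=
    lp.hasSum_single (E := 𝓗.H) (p := 2) ENNReal.ofNat_ne_top f
  refine h.tendsto_sum_nat.congr fun N => ?_
  rw [levelProj, _root_.sum_apply]
  refine Finset.sum_congr rfl fun n _ => ?_
  rw [ContinuousLinearMap.comp_apply, adjoint_toFockL_apply]
  rfl

theorem adjoint_toFockL_toFock_of_ne {m n : ℕ} (h : m ≠ n) (ζ : 𝓗.H n) :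
    ContinuousLinearMap.adjoint (𝓗.toFockL m) (𝓗.toFock n ζ) = 0 :=
  ext_inner_left ℂ fun z => by
    rw [ContinuousLinearMap.adjoint_inner_right, inner_zero_right]
    exact inner_toFock_of_ne h z ζ

theorem adjoint_toFockL_toFock (n : ℕ) (ζ : 𝓗.H n) :
    ContinuousLinearMap.adjoint (𝓗.toFockL n) (𝓗.toFock n ζ) = ζ :=
  ext_inner_left ℂ fun z => by
    rw [ContinuousLinearMap.adjoint_inner_right]
    exact inner_toFock_self n z ζ

theorem levelProj_toFock (N n : ℕ) (ζ : 𝓗.H n) :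
    𝓗.levelProj N (𝓗.toFock n ζ) = if n < N then 𝓗.toFock n ζ else 0 := by
  rw [levelProj, _root_.sum_apply]
  split_ifs with h
  · rw [Finset.sum_eq_single n]
    · rw [ContinuousLinearMap.comp_apply, adjoint_toFockL_toFock]; rfl
    · intro m _ hm
      rw [ContinuousLinearMap.comp_apply, adjoint_toFockL_toFock_of_ne hm, map_zero]
    · intro hn; exact absurd (Finset.mem_range.2 h) hn
  · refine Finset.sum_eq_zero fun m hm => ?_
    have : m ≠ n := fun e => h (e ▸ Finset.mem_range.1 hm)
    rw [ContinuousLinearMap.comp_apply, adjoint_toFockL_toFock_of_ne this, map_zero]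

theorem isCompactOperator_levelProj (N : ℕ) : IsCompactOperator (𝓗.levelProj N) := by
  unfold levelProj
  refine Finset.sum_induction _ (fun X : 𝓗.Fock →L[ℂ] 𝓗.Fock => IsCompactOperator X)
    (fun X Y hX hY => IsCompactOperator.add (f := X) (g := Y) hX hY) isCompactOperator_zero
    fun n _ => ?_
  exact (isCompactOperator_of_locallyCompactSpace_rng (𝓗.toFockL n)).comp_clm _

theorem isStarProjection_levelProj (N : ℕ) : IsStarProjection (𝓗.levelProj N) where
  isIdempotentElem := fock_ext fun n ζ => by
    rw [mul_apply_eq_comp, levelProj_toFock]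
    split_ifs with h
    · rw [levelProj_toFock, if_pos h]
    · rw [map_zero]
  isSelfAdjoint := by
    rw [IsSelfAdjoint, levelProj, star_sum]
    refine Finset.sum_congr rfl fun n _ => ?_
    rw [ContinuousLinearMap.star_eq_adjoint, ContinuousLinearMap.adjoint_comp,
      ContinuousLinearMap.adjoint_adjoint]

theorem norm_levelProj_le (N : ℕ) : ‖𝓗.levelProj N‖ ≤ 1 :=
  (isStarProjection_levelProj N).norm_le

/-- Compact operators are approximated by their compressions. -/
theorem tendsto_levelProj_mul {k : 𝓗.Fock →L[ℂ] 𝓗.Fock} (hk : IsCompactOperator k) :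
    Filter.Tendsto (fun N => 𝓗.levelProj N * k) Filter.atTop (nhds k) := by
  have h1 : TotallyBounded (k '' Metric.closedBall 0 1) :=
    (hk.isCompact_closure_image_closedBall (f := (k : 𝓗.Fock →ₗ[ℂ] 𝓗.Fock)) 1
      ).totallyBounded.subset subset_closure
  rw [Metric.totallyBounded_iff] at h1
  rw [Metric.tendsto_atTop']
  intro ε hε
  obtain ⟨t, ht, hcov⟩ := h1 (ε / 4) (by positivity)
  have hev : ∀ᶠ N in Filter.atTop, ∀ y ∈ t, ‖𝓗.levelProj N y - y‖ < ε / 4 := by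
    rw [Filter.eventually_all_finite ht]
    intro y _
    have := tendsto_iff_norm_sub_tendsto_zero.1 (tendsto_levelProj y)
    exact this.eventually (gt_mem_nhds (by positivity))
  obtain ⟨N₀, hN₀⟩ := Filter.eventually_atTop.1 hev
  refine ⟨N₀, fun N hN => ?_⟩
  rw [dist_eq_norm]
  have hle : ‖𝓗.levelProj N * k - k‖ ≤ 3 * (ε / 4) := by
    refine ContinuousLinearMap.opNorm_le_of_unit_norm (by positivity) fun x hx => ?_
    have hmem : k x ∈ k '' Metric.closedBall 0 1 := ⟨x, by simp [hx], rfl⟩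
    obtain ⟨y, hy, hxy⟩ := Set.mem_iUnion₂.1 (hcov hmem)
    rw [Metric.mem_ball, dist_eq_norm] at hxy
    have e : (𝓗.levelProj N * k - k) x =
        𝓗.levelProj N (k x - y) + (𝓗.levelProj N y - y) - (k x - y) := by
      rw [_root_.sub_apply, mul_apply_eq_comp, map_sub]; abel
    have h2 : ‖𝓗.levelProj N (k x - y)‖ ≤ ‖k x - y‖ :=
      ((𝓗.levelProj N).le_opNorm _).trans
        (mul_le_of_le_one_left (norm_nonneg _) (norm_levelProj_le N))
    have h3 := hN₀ N hN.le y hy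
    rw [e]
    calc _ ≤ ‖𝓗.levelProj N (k x - y)‖ + ‖𝓗.levelProj N y - y‖ + ‖k x - y‖ :=
          (norm_sub_le _ _).trans (add_le_add_left (norm_add_le _ _) _)
      _ ≤ _ := by linarith
  linarith

/-- `U` is block diagonal with respect to the levels of the Fock space. -/
theorem Equivariant.IsFockRep.levelProj_comm {ρ : 𝓗.Equivariant A}
    {U : HilbertTensor 𝓗.Fock (L2 A) →L[ℂ] HilbertTensor 𝓗.Fock (L2 A)} (hU : ρ.IsFockRep U) (N : ℕ) :
    U * opTensor (𝓗.levelProj N) 1 = opTensor (𝓗.levelProj N) 1 * U := by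
  refine fockTensor_ext fun n j a => ?_
  rw [mul_apply_eq_comp, mul_apply_eq_comp, hU.actsBy, map_sum]
  simp only [opTensor_fockTensor, levelProj_toFock]
  split_ifs with h
  · exact hU.actsBy n j a
  · simp only [TensorProduct.zero_tmul, map_zero, Finset.sum_const_zero]

/-- The slices of the conjugate of a compact operator are compact. -/
theorem Equivariant.IsFockRep.isCompactOperator_slice_conj {ρ : 𝓗.Equivariant A}
    {U : HilbertTensor 𝓗.Fock (L2 A) →L[ℂ] HilbertTensor 𝓗.Fock (L2 A)} (hU : ρ.IsFockRep U)
    {k : 𝓗.Fock →L[ℂ] 𝓗.Fock} (hk : IsCompactOperator k) (f g : L2 A) :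
    IsCompactOperator (slice f g (hU.conj k)) := by
  have hcl : IsClosed {X : 𝓗.Fock →L[ℂ] 𝓗.Fock | IsCompactOperator (slice f g (hU.conj X))} :=
    (isClosed_setOfPred_isCompactOperator (σ₁₂ := RingHom.id ℂ) (M₁ := 𝓗.Fock)
      (M₂ := 𝓗.Fock)).preimage ((slice f g).continuous.comp hU.continuous_conj)
  refine hcl.mem_of_tendsto (tendsto_levelProj_mul hk) (Filter.Eventually.of_forall fun N => ?_)
  -- The level projection leaves the conjugation as `P_N ⊗ 1` and then leaves the slice, which
  -- becomes `P_N` times a bounded operator. The trailing `opTensor 1 1` only fits the two-sided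
  -- form of `slice_opTensor_mul_mul`.
  have e : hU.conj (𝓗.levelProj N * k) =
      opTensor (𝓗.levelProj N) 1 * hU.conj k * opTensor 1 1 := by
    have h1 : opTensor (𝓗.levelProj N * k) (1 : L2 A →L[ℂ] L2 A) =
        opTensor (𝓗.levelProj N) 1 * opTensor k 1 := by rw [opTensor_mul, mul_one]
    rw [opTensor_one, mul_one, hU.conj_apply, hU.conj_apply, h1, ← mul_assoc U, hU.levelProj_comm]
    simp only [mul_assoc]
  change IsCompactOperator (slice f g (hU.conj (𝓗.levelProj N * k)))
  rw [e, slice_opTensor_mul_mul, mul_one]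
  exact IsCompactOperator.comp_clm (f := 𝓗.levelProj N) (isCompactOperator_levelProj N) _

end SubproductSystem

/-! ### The induced action on the Cuntz--Pimsner algebra -/

theorem continuous_starAlgHom {B C : Type*} [CStarAlgebra B] [CStarAlgebra C] (f : B →⋆ₐ[ℂ] C) :
    Continuous f :=
  AddMonoidHomClass.continuous_of_bound f 1 fun t => by
    rw [one_mul]; exact NonUnitalStarAlgHom.norm_apply_le f t

/-- Homomorphisms on a spatial tensor product are determined on elementary tensors. -/
theorem SpatialTensor.hom_ext {K L C : Type*} [NormedAddCommGroup K] [InnerProductSpace ℂ K]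
    [CompleteSpace K] [NormedAddCommGroup L] [InnerProductSpace ℂ L] [CompleteSpace L]
    [CStarAlgebra C] {A : StarSubalgebra ℂ (K →L[ℂ] K)} {B : StarSubalgebra ℂ (L →L[ℂ] L)}
    {f g : SpatialTensor A B →⋆ₐ[ℂ] C} (h : ∀ a b, f (tmul a b) = g (tmul a b)) : f = g := by
  have hiso : Isometry (toOp : SpatialTensor A B →⋆ₐ[ℂ] _) := isometry_subtype_coe
  have hcl : IsClosed ((StarAlgHom.equalizer f g : StarSubalgebra ℂ (SpatialTensor A B)) :
      Set (SpatialTensor A B)) :=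
    isClosed_eq (continuous_starAlgHom f) (continuous_starAlgHom g)
  have hle : spatialTensor A B ≤
      (StarAlgHom.equalizer f g : StarSubalgebra ℂ (SpatialTensor A B)).map toOp := by
    refine StarSubalgebra.topologicalClosure_minimal (StarAlgebra.adjoin_le ?_)
      (hiso.isClosedEmbedding.isClosedMap _ hcl)
    rintro _ ⟨a, ha, b, hb, rfl⟩
    exact ⟨tmul ⟨a, ha⟩ ⟨b, hb⟩, h _ _, rfl⟩
  refine StarAlgHom.ext fun X => ?_
  obtain ⟨Y, hY, hYX⟩ := hle X.2
  have : Y = X := hiso.injective hYX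
  exact this ▸ hY

namespace SubproductSystem

variable {𝓗 : SubproductSystem}
variable {A : Type*} [Ring A] [StarRing A] [HopfAlgebra ℂ A] [StarModule ℂ A]

theorem quotientMap_surjective : Function.Surjective 𝓗.quotientMap :=
  Ideal.Quotient.mk_surjective

theorem quotientMap_eq_zero_iff (t : 𝓗.toeplitz) :
    𝓗.quotientMap t = 0 ↔ IsCompactOperator (t : 𝓗.Fock →L[ℂ] 𝓗.Fock) :=
  Ideal.Quotient.eq_zero_iff_mem (I := 𝓗.compacts)

/-- A homomorphism vanishing on the compact operators factors through the Cuntz--Pimsner algebra. -/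
theorem exists_lift_quotientMap {C : Type*} [CStarAlgebra C] (f : 𝓗.toeplitz →⋆ₐ[ℂ] C)
    (hf : ∀ t : 𝓗.toeplitz, IsCompactOperator (t : 𝓗.Fock →L[ℂ] 𝓗.Fock) → f t = 0) :
    ∃ α : 𝓗.CuntzPimsner →⋆ₐ[ℂ] C, ∀ t, α (𝓗.quotientMap t) = f t := by
  choose σ hσ using quotientMap_surjective (𝓗 := 𝓗)
  have key : ∀ a t, 𝓗.quotientMap t = a → f (σ a) = f t := fun a t h => by
    rw [← sub_eq_zero, ← map_sub]
    refine hf _ ((quotientMap_eq_zero_iff _).1 ?_)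
    rw [map_sub, hσ, h, sub_self]
  refine ⟨{ toFun := fun a => f (σ a)
            map_one' := (key 1 1 (map_one _)).trans (map_one f)
            map_mul' := fun a b =>
              (key (a * b) (σ a * σ b) (by rw [map_mul, hσ, hσ])).trans (map_mul f _ _)
            map_zero' := (key 0 0 (map_zero _)).trans (map_zero f)
            map_add' := fun a b =>
              (key (a + b) (σ a + σ b) (by rw [map_add, hσ, hσ])).trans (map_add f _ _)
            commutes' := fun c =>
              (key _ (algebraMap ℂ _ c) (AlgHomClass.commutes 𝓗.quotientMap c)).trans
                (AlgHomClass.commutes f c)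
            map_star' := fun a =>
              (key (star a) (star (σ a)) (by rw [map_star, hσ])).trans (map_star f _) },
    fun t => key _ t rfl⟩

theorem IsQuotientTensor.unique
    {Q Q' : SpatialTensor 𝓗.toeplitz (reducedAlgebra A) →⋆ₐ[ℂ] TensorReduced A 𝓗.CuntzPimsner}
    (hQ : IsQuotientTensor Q) (hQ' : IsQuotientTensor Q') : Q = Q' :=
  SpatialTensor.hom_ext fun t x => by rw [hQ, hQ']

variable (𝓗) in
/-- The representation of the Toeplitz algebra on the universal space of the quotient. -/
def quotientRep : 𝓗.toeplitz →⋆ₐ[ℂ]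
    (UniversalSpace 𝓗.CuntzPimsner →L[ℂ] UniversalSpace 𝓗.CuntzPimsner) :=
  universalRep.comp 𝓗.quotientMap

variable (𝓗 A) in
theorem exists_isQuotientTensor :
    ∃ Q : SpatialTensor 𝓗.toeplitz (reducedAlgebra A) →⋆ₐ[ℂ] TensorReduced A 𝓗.CuntzPimsner,
      IsQuotientTensor Q ∧ ∀ X, SliceRelated 𝓗.quotientRep (SpatialTensor.toOp X)
        (SpatialTensor.toOp (A := universalImage 𝓗.CuntzPimsner) (B := reducedAlgebra A) (Q X)) :=
  exists_spatialMap (T' := universalImage 𝓗.CuntzPimsner) 𝓗.quotientRep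
    fun t => ⟨𝓗.quotientMap t, rfl⟩

/-- Elementary tensors determine `q ⊗ ι`, so it is the map built from the graph and is compatible
with slices. -/
theorem IsQuotientTensor.sliceRelated
    {Q : SpatialTensor 𝓗.toeplitz (reducedAlgebra A) →⋆ₐ[ℂ] TensorReduced A 𝓗.CuntzPimsner}
    (hQ : IsQuotientTensor Q) (X : SpatialTensor 𝓗.toeplitz (reducedAlgebra A)) :
    SliceRelated 𝓗.quotientRep (SpatialTensor.toOp X)
      (SpatialTensor.toOp (A := universalImage 𝓗.CuntzPimsner) (B := reducedAlgebra A) (Q X)) := by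
  obtain ⟨Q', hQ', h⟩ := exists_isQuotientTensor 𝓗 A
  rw [hQ.unique hQ']
  exact h X

/-- For compact `t` the slices of `αT t` are compact, hence killed by `q`. They map to the slices of
`(q ⊗ ι)(αT t)`, which is therefore zero. Arguing by slices avoids any exactness question for the
tensor product. -/
theorem Equivariant.exists_isInducedAction [CompactQuantumGroup A] (ρ : 𝓗.Equivariant A) :
    ∃ α, ρ.IsInducedAction α := by
  obtain ⟨αT, hαT⟩ := ρ.exists_isToeplitzAction
  obtain ⟨Q, hQ, hQs⟩ := exists_isQuotientTensor 𝓗 A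
  obtain ⟨U, hU, hUT⟩ := id hαT
  obtain ⟨α, hα⟩ := exists_lift_quotientMap (Q.comp αT) fun t ht => by
    have h0 : SpatialTensor.toOp (A := universalImage 𝓗.CuntzPimsner) (B := reducedAlgebra A)
        (Q (αT t)) = 0 := by
      refine (hQs (αT t)).zero_right_of fun f g t' ht' => ?_
      have hc : IsCompactOperator (t' : 𝓗.Fock →L[ℂ] 𝓗.Fock) := by
        rw [ht', hUT]
        exact hU.isCompactOperator_slice_conj ht f g
      change universalRep (𝓗.quotientMap t') = 0
      rw [(quotientMap_eq_zero_iff t').2 hc, map_zero]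
    exact Subtype.ext h0
  exact ⟨α, αT, Q, hαT, hQ, hα⟩

theorem Equivariant.IsInducedAction.unique {ρ : 𝓗.Equivariant A}
    {α β : 𝓗.CuntzPimsner →⋆ₐ[ℂ] TensorReduced A 𝓗.CuntzPimsner} (hα : ρ.IsInducedAction α)
    (hβ : ρ.IsInducedAction β) : α = β := by
  obtain ⟨αT, Q, hαT, hQ, h⟩ := hα
  obtain ⟨βT, Q', hβT, hQ', h'⟩ := hβ
  refine StarAlgHom.ext fun a => ?_
  obtain ⟨t, rfl⟩ := quotientMap_surjective a
  rw [h, h', hαT.unique hβT, hQ.unique hQ']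

end SubproductSystem

/-! ### Schur's lemma and orthogonality -/

section Schur

open Matrix

variable {A : Type*} [Ring A] [StarRing A] [HopfAlgebra ℂ A]
variable {κ μ : Type} [Fintype κ] [DecidableEq κ] [Fintype μ] [DecidableEq μ]

variable {H K : Type*} [NormedAddCommGroup H] [InnerProductSpace ℂ H] [FiniteDimensional ℂ H]
  [NormedAddCommGroup K] [InnerProductSpace ℂ K] [FiniteDimensional ℂ K]

/-- By flatness of `A` the kernel of `t ⊗ ι` is `ker t ⊗ A`, so `ker t` is an invariant subspace. -/
theorem Intertwines.ker_eq_bot_or_top [StarModule ℂ A] {V : UnitaryRep A H} {W : UnitaryRep A K}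
    {t : H →ₗ[ℂ] K} (h : Intertwines V.U W.U t) (hV : V.IsSimple) :
    LinearMap.ker t = ⊥ ∨ LinearMap.ker t = ⊤ := by
  refine hV.2 _ fun ξ hξ => ?_
  have h1 : t.rTensor A (coaction V.U ξ) = 0 := by
    have := LinearMap.congr_fun h ξ
    rw [LinearMap.comp_apply, LinearMap.comp_apply, LinearMap.mem_ker.1 hξ, map_zero] at this
    exact this
  have hex : Function.Exact (LinearMap.ker t).subtype t := LinearMap.exact_subtype_ker_map t
  exact (Module.Flat.rTensor_exact A hex _).1 h1

theorem Intertwines.range_eq_bot_or_top [StarModule ℂ A] {V : UnitaryRep A H} {W : UnitaryRep A K}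
    {t : H →ₗ[ℂ] K} (h : Intertwines V.U W.U t) (hW : W.IsSimple) :
    LinearMap.range t = ⊥ ∨ LinearMap.range t = ⊤ := by
  refine hW.2 _ ?_
  rintro _ ⟨ξ, rfl⟩
  have := LinearMap.congr_fun h ξ
  rw [LinearMap.comp_apply, LinearMap.comp_apply] at this
  rw [← this]
  refine ⟨t.rangeRestrict.rTensor A (coaction V.U ξ), ?_⟩
  rw [← LinearMap.comp_apply, ← LinearMap.rTensor_comp]
  rfl

/-- Schur's lemma for nonisomorphic simple modules. -/
theorem Intertwines.eq_zero [StarModule ℂ A] {V : UnitaryRep A H} {W : UnitaryRep A K}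
    {t : H →ₗ[ℂ] K} (h : Intertwines V.U W.U t) (hV : V.IsSimple) (hW : W.IsSimple)
    (hVW : ¬ V.IsIso W) : t = 0 := by
  rcases h.ker_eq_bot_or_top hV with hk | hk
  · rcases h.range_eq_bot_or_top hW with hr | hr
    · exact LinearMap.range_eq_bot.1 hr
    · exact absurd ⟨LinearEquiv.ofBijective t
        ⟨LinearMap.ker_eq_bot.1 hk, LinearMap.range_eq_top.1 hr⟩, h⟩ hVW
  · exact LinearMap.ker_eq_top.1 hk

/-- Schur's lemma for endomorphisms of a simple module. -/
theorem Intertwines.exists_eq_smul [StarModule ℂ A] {V : UnitaryRep A H} {t : H →ₗ[ℂ] H}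
    (h : Intertwines V.U V.U t) (hV : V.IsSimple) : ∃ c : ℂ, t = c • LinearMap.id := by
  have := hV.1
  obtain ⟨c, hc⟩ := Module.End.exists_eigenvalue t
  refine ⟨c, sub_eq_zero.1 ?_⟩
  have h' : Intertwines V.U V.U (t - c • LinearMap.id) := by
    unfold Intertwines at h ⊢
    rw [LinearMap.rTensor_sub, LinearMap.rTensor_smul, LinearMap.rTensor_id, LinearMap.sub_comp, h,
      LinearMap.smul_comp, LinearMap.id_comp, LinearMap.comp_sub, LinearMap.comp_smul,
      LinearMap.comp_id]
  rcases h'.ker_eq_bot_or_top hV with hk | hk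
  · obtain ⟨x, hx, hx0⟩ := hc.exists_hasEigenvector
    refine absurd ?_ hx0
    have : x ∈ LinearMap.ker (t - c • LinearMap.id) := by
      rw [LinearMap.mem_ker, LinearMap.sub_apply, Module.End.mem_eigenspace_iff.1 hx]
      simp
    rwa [hk, Submodule.mem_bot] at this
  · exact LinearMap.ker_eq_top.1 hk

theorem exists_onMatrix_eq (b : OrthonormalBasis κ ℂ H) (c : OrthonormalBasis μ ℂ K)
    (C : Matrix μ κ ℂ) : ∃ t : H →ₗ[ℂ] K, onMatrix b c t = C := by
  refine ⟨b.toBasis.constr ℂ fun j => ∑ i, C i j • c i, ?_⟩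
  ext i j
  have : b.toBasis.constr ℂ (fun j => ∑ i, C i j • c i) (b j) = ∑ i, C i j • c i := by
    rw [← b.coe_toBasis, Module.Basis.constr_basis]
  rw [onMatrix, Matrix.of_apply, this, c.orthonormal.inner_right_fintype]

end Schur

/-! ### Orthogonality relations for the coefficients of the representations on the levels. -/

namespace SubproductSystem

open Matrix

variable {𝓗 : SubproductSystem}
variable {A : Type*} [Ring A] [StarRing A] [HopfAlgebra ℂ A] [StarModule ℂ A]

theorem haarState_invariantAt [CompactQuantumGroup A] (a : A) : InvariantAt (haarState A) a :=
  ⟨(isHaarState_haarState A).left_invariant a, (isHaarState_haarState A).right_invariant a⟩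

theorem average_single_apply (h : A →ₗ[ℂ] ℂ) {κ μ : Type} [Fintype κ] [DecidableEq κ] [Fintype μ]
    [DecidableEq μ] (v : Matrix κ κ A) (w : Matrix μ μ A) (i l : κ) (j k : μ) :
    (v * scalarMatrix A (Matrix.single i j 1) * wᴴ).map h l k = h (v l i * star (w k j)) := by
  rw [Matrix.map_apply, Matrix.mul_assoc, mul_apply]
  simp only [scalarMatrix_mul_apply, conjTranspose_apply]
  rw [Finset.sum_eq_single i]
  · rw [Finset.sum_eq_single j]
    · rw [Matrix.single_apply_same, one_smul]
    · intro k' _ hk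
      rw [Matrix.single_apply_of_ne _ _ _ _ _ (by simp [Ne.symm hk]), zero_smul]
    · simp
  · intro l' _ hl
    rw [Finset.sum_eq_zero, mul_zero]
    intro k' _
    rw [Matrix.single_apply_of_ne _ _ _ _ _ (by simp [Ne.symm hl]), zero_smul]
  · simp

/-- The average of a matrix unit comes from an intertwiner. -/
theorem Equivariant.exists_intertwines_average [CompactQuantumGroup A] (ρ : 𝓗.Equivariant A)
    (n m : ℕ) (i : Fin (Module.finrank ℂ (𝓗.H n))) (j : Fin (Module.finrank ℂ (𝓗.H m))) :
    ∃ t : 𝓗.H m →ₗ[ℂ] 𝓗.H n, Intertwines (ρ.rep m).U (ρ.rep n).U t ∧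
      ∀ l k, onMatrix (𝓗.basis m) (𝓗.basis n) t l k =
        haarState A (ρ.matrix n l i * star (ρ.matrix m k j)) := by
  obtain ⟨t, ht⟩ := exists_onMatrix_eq (𝓗.basis m) (𝓗.basis n)
    ((ρ.matrix n * scalarMatrix A (Matrix.single i j 1) * (ρ.matrix m)ᴴ).map (haarState A))
  refine ⟨t, ?_, fun l k => by rw [ht, average_single_apply]⟩
  rw [intertwines_iff (𝓗.basis m) (𝓗.basis n), ht]
  exact (average_intertwines haarState_invariantAt (ρ.isUnitaryCorep_matrix n)
    (ρ.isUnitaryCorep_matrix m) _).symm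

/-- The orthogonality relations for coefficients of different levels. -/
theorem Equivariant.haarState_matrix_of_ne [CompactQuantumGroup A] (ρ : 𝓗.Equivariant A)
    (hsimple : ∀ n, (ρ.rep n).IsSimple) (hiso : ∀ m n, m ≠ n → ¬ (ρ.rep m).IsIso (ρ.rep n))
    {n m : ℕ} (hnm : n ≠ m) (i l : Fin (Module.finrank ℂ (𝓗.H n)))
    (j k : Fin (Module.finrank ℂ (𝓗.H m))) :
    haarState A (ρ.matrix n l i * star (ρ.matrix m k j)) = 0 := by
  obtain ⟨t, ht, h⟩ := ρ.exists_intertwines_average n m i j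
  rw [← h, ht.eq_zero (hsimple m) (hsimple n) (hiso m n hnm.symm)]
  simp [onMatrix]

/-- The orthogonality relations for coefficients of one level. -/
theorem Equivariant.exists_haarState_matrix_eq [CompactQuantumGroup A] (ρ : 𝓗.Equivariant A)
    (hsimple : ∀ n, (ρ.rep n).IsSimple) (n : ℕ) (i j : Fin (Module.finrank ℂ (𝓗.H n))) :
    ∃ c : ℂ, ∀ l k, haarState A (ρ.matrix n l i * star (ρ.matrix n k j)) =
      if l = k then c else 0 := by
  obtain ⟨t, ht, h⟩ := ρ.exists_intertwines_average n n i j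
  obtain ⟨c, rfl⟩ := ht.exists_eq_smul (hsimple n)
  refine ⟨c, fun l k => ?_⟩
  rw [← h, onMatrix, Matrix.of_apply, LinearMap.smul_apply, LinearMap.id_apply, inner_smul_right,
    orthonormal_iff_ite.1 (𝓗.basis n).orthonormal]
  simp

/-! ### Ergodicity -/

theorem exists_eq_sum_tmul {H K : Type*} [NormedAddCommGroup H] [InnerProductSpace ℂ H]
    [AddCommGroup K] [Module ℂ K] {κ : Type} [Fintype κ] (b : OrthonormalBasis κ ℂ H)
    (z : H ⊗[ℂ] K) : ∃ y : κ → K, z = ∑ l, b l ⊗ₜ y l := by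
  induction z with
  | zero => exact ⟨0, by simp⟩
  | add z z' hz hz' =>
    obtain ⟨y, rfl⟩ := hz
    obtain ⟨y', rfl⟩ := hz'
    exact ⟨y + y', by simp only [Pi.add_apply, TensorProduct.tmul_add, Finset.sum_add_distrib]⟩
  | tmul x y =>
    refine ⟨fun l => (inner ℂ (b l) x : ℂ) • y, ?_⟩
    simp only [← TensorProduct.smul_tmul, ← TensorProduct.sum_tmul]
    rw [b.sum_repr']

/-- The operator `T_l*` picks the component of `w n k x` along the basis vector `l` in the first
leg. Hence `∑ l, T_l T_l*` acts on `H (n + k)` as `w* w`. -/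
theorem star_shift_toFock {n k : ℕ} (l : Fin (Module.finrank ℂ (𝓗.H n))) (x : 𝓗.H (n + k))
    {y : Fin (Module.finrank ℂ (𝓗.H n)) → 𝓗.H k} (hy : 𝓗.w n k x = ∑ l, 𝓗.basis n l ⊗ₜ y l) :
    star (shift n (𝓗.basis n l) : 𝓗.toeplitz).1 (𝓗.toFock (n + k) x) = 𝓗.toFock k (y l) := by
  have h : (innerSL ℂ (𝓗.toFock (n + k) x)).comp (shift n (𝓗.basis n l) : 𝓗.toeplitz).1 =
      innerSL ℂ (𝓗.toFock k (y l)) := by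
    refine fock_ext fun m ζ => ?_
    rw [ContinuousLinearMap.comp_apply, innerSL_apply_apply, innerSL_apply_apply,
      isShift_shift (𝓗.basis n l) m ζ]
    by_cases hkm : k = m
    · subst hkm
      refine (inner_toFock_self (n + k) x _).trans (Eq.trans ?_ (inner_toFock_self k (y l) ζ).symm)
      rw [inner_mult, hy, sum_inner]
      simp only [TensorProduct.inner_tmul, orthonormal_iff_ite.1 (𝓗.basis n).orthonormal]
      simp
    · exact (inner_toFock_of_ne (fun h => hkm (Nat.add_left_cancel h)) _ _).trans
        (inner_toFock_of_ne hkm (y l) ζ).symm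
  refine ext_inner_right ℂ fun f => ?_
  rw [ContinuousLinearMap.star_eq_adjoint, ContinuousLinearMap.adjoint_inner_left]
  exact congrArg (fun Z => Z f) h

/-- The sum `∑ T_i T_i*` over an orthonormal basis of `H n` is `1` up to a compact operator. -/
theorem isCompactOperator_sum_shift_mul_star_sub_one (n : ℕ) :
    IsCompactOperator (∑ l, (shift n (𝓗.basis n l) : 𝓗.toeplitz).1 *
      star (shift n (𝓗.basis n l) : 𝓗.toeplitz).1 - 1 : 𝓗.Fock →L[ℂ] 𝓗.Fock) := by
  set X : 𝓗.Fock →L[ℂ] 𝓗.Fock := ∑ l, (shift n (𝓗.basis n l) : 𝓗.toeplitz).1 *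
      star (shift n (𝓗.basis n l) : 𝓗.toeplitz).1 - 1 with hX
  -- On levels from `n` on, the sum is `w* w = 1`; so `X` lives on the finitely many levels below
  -- `n`.
  have h0 : ∀ k (x : 𝓗.H (n + k)), X (𝓗.toFock (n + k) x) = 0 := by
    intro k x
    obtain ⟨y, hy⟩ := exists_eq_sum_tmul (𝓗.basis n) (𝓗.w n k x)
    rw [hX, _root_.sub_apply, _root_.sum_apply, sub_eq_zero]
    simp only [mul_apply_eq_comp, star_shift_toFock _ x hy, isShift_shift _ k]
    rw [← map_sum, ← map_sum, ← hy, mult_w]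
    rfl
  have h1 : X = X * 𝓗.levelProj n := by
    refine fock_ext fun m ζ => ?_
    rw [mul_apply_eq_comp, levelProj_toFock]
    split_ifs with h
    · rfl
    · obtain ⟨k, rfl⟩ := Nat.exists_eq_add_of_le (not_lt.1 h)
      rw [h0, map_zero]
  rw [h1]
  exact IsCompactOperator.clm_comp (f := 𝓗.levelProj n) (isCompactOperator_levelProj n) X

variable (𝓗) in
/-- The sums of a scalar and a compact operator. -/
def scalarAddCompact : Submodule ℂ (𝓗.Fock →L[ℂ] 𝓗.Fock) :=
  Submodule.span ℂ {1} ⊔ compactOperator (RingHom.id ℂ) 𝓗.Fock 𝓗.Fock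

/-! ### Averaging over the quantum group. -/

section Average

variable [CompactQuantumGroup A] {ρ : 𝓗.Equivariant A}
  {U : HilbertTensor 𝓗.Fock (L2 A) →L[ℂ] HilbertTensor 𝓗.Fock (L2 A)}

theorem inner_toL2_one_regularRep (a : A) :
    inner ℂ (toL2 A 1) (regularRep A a (toL2 A 1)) = haarState A a := by
  rw [regularRep_toL2, inner_toL2, star_one, one_mul, mul_one]

/-- The slice at the vector `Λ(1)` is `ι ⊗ h`, so the average of `T_i T_j*` is governed by the Haar
state on products of coefficients. -/
theorem Equivariant.IsFockRep.slice_conj_shift_mul_star (hU : ρ.IsFockRep U) (n m : ℕ)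
    (i : Fin (Module.finrank ℂ (𝓗.H n))) (j : Fin (Module.finrank ℂ (𝓗.H m))) :
    slice (toL2 A 1) (toL2 A 1) (hU.conj ((shift n (𝓗.basis n i) : 𝓗.toeplitz).1 *
      star (shift m (𝓗.basis m j) : 𝓗.toeplitz).1)) =
      ∑ l, ∑ k, haarState A (ρ.matrix n l i * star (ρ.matrix m k j)) •
        ((shift n (𝓗.basis n l) : 𝓗.toeplitz).1 * star (shift m (𝓗.basis m k) : 𝓗.toeplitz).1) := by
  rw [map_mul, map_star, hU.conj_apply, hU.conj_apply, hU.conj_shift, hU.conj_shift, star_sum,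
    Finset.sum_mul_sum, map_sum]
  refine Finset.sum_congr rfl fun l _ => ?_
  rw [map_sum]
  refine Finset.sum_congr rfl fun k _ => ?_
  rw [opTensor_star, opTensor_mul, slice_opTensor, ← map_star, ← map_mul, inner_toL2_one_regularRep]

/-- Orthogonality makes the average zero for different levels and leaves a multiple of `∑ l, T_l
T_l*` for equal ones; that sum is `1` plus a compact operator. -/
theorem Equivariant.IsFockRep.slice_conj_basis_mem (hU : ρ.IsFockRep U)
    (hsimple : ∀ n, (ρ.rep n).IsSimple) (hiso : ∀ m n, m ≠ n → ¬ (ρ.rep m).IsIso (ρ.rep n)) (n m : ℕ)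
    (i : Fin (Module.finrank ℂ (𝓗.H n))) (j : Fin (Module.finrank ℂ (𝓗.H m))) :
    slice (toL2 A 1) (toL2 A 1) (hU.conj ((shift n (𝓗.basis n i) : 𝓗.toeplitz).1 *
      star (shift m (𝓗.basis m j) : 𝓗.toeplitz).1)) ∈ 𝓗.scalarAddCompact := by
  rw [hU.slice_conj_shift_mul_star]
  by_cases hnm : n = m
  · subst hnm
    obtain ⟨c, hc⟩ := ρ.exists_haarState_matrix_eq hsimple n i j
    simp only [hc, ite_smul, zero_smul, Finset.sum_ite_eq, Finset.mem_univ, if_true]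
    rw [← Finset.smul_sum]
    refine Submodule.smul_mem _ _ (Submodule.mem_sup.2 ⟨1, Submodule.mem_span_singleton_self _, _,
      isCompactOperator_sum_shift_mul_star_sub_one n, add_sub_cancel _ _⟩)
  · simp only [ρ.haarState_matrix_of_ne hsimple hiso hnm, zero_smul, Finset.sum_const_zero]
    exact zero_mem _

theorem Equivariant.IsFockRep.slice_conj_mem (hU : ρ.IsFockRep U)
    (hsimple : ∀ n, (ρ.rep n).IsSimple) (hiso : ∀ m n, m ≠ n → ¬ (ρ.rep m).IsIso (ρ.rep n)) {n m : ℕ}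
    (η : 𝓗.H n) (θ : 𝓗.H m) :
    slice (toL2 A 1) (toL2 A 1) (hU.conj (shift n η * star (shift m θ) : 𝓗.toeplitz).1) ∈
      𝓗.scalarAddCompact := by
  have e : (shift n η * star (shift m θ) : 𝓗.toeplitz).1 =
      ∑ i, ∑ j, ((inner ℂ (𝓗.basis n i) η : ℂ) * star (inner ℂ (𝓗.basis m j) θ : ℂ)) •
        ((shift n (𝓗.basis n i) : 𝓗.toeplitz).1 * star (shift m (𝓗.basis m j) : 𝓗.toeplitz).1) := by
    conv_lhs => rw [← (𝓗.basis n).sum_repr' η, ← (𝓗.basis m).sum_repr' θ]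
    rw [map_sum, map_sum, star_sum, Finset.sum_mul_sum, AddSubmonoidClass.coe_finsetSum]
    refine Finset.sum_congr rfl fun i _ => ?_
    rw [AddSubmonoidClass.coe_finsetSum]
    refine Finset.sum_congr rfl fun j _ => ?_
    rw [map_smul, map_smul, star_smul, smul_mul_smul_comm]
    rfl
  rw [e, map_sum, map_sum]
  refine Submodule.sum_mem _ fun i _ => ?_
  rw [map_sum, map_sum]
  refine Submodule.sum_mem _ fun j _ => ?_
  rw [map_smul, map_smul]
  exact Submodule.smul_mem _ _ (hU.slice_conj_basis_mem hsimple hiso n m i j)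

end Average

/-- The compact part need not be assumed to lie in the Toeplitz algebra: it is the difference of `t`
and a scalar. -/
theorem quotientRep_mem_span_one {t : 𝓗.toeplitz} (ht : t.1 ∈ 𝓗.scalarAddCompact) :
    𝓗.quotientRep t ∈ Submodule.span ℂ {(1 :
      UniversalSpace 𝓗.CuntzPimsner →L[ℂ] UniversalSpace 𝓗.CuntzPimsner)} := by
  obtain ⟨x, hx, k, hk, h⟩ := Submodule.mem_sup.1 ht
  obtain ⟨c, rfl⟩ := Submodule.mem_span_singleton.1 hx
  have h0 : 𝓗.quotientMap (t - c • 1) = 0 := by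
    rw [quotientMap_eq_zero_iff]
    have : (t - c • 1 : 𝓗.toeplitz).1 = k := by
      change t.1 - c • 1 = k
      rw [← h]; abel
    rw [this]
    exact hk
  rw [map_sub, map_smul, map_one, sub_eq_zero] at h0
  refine Submodule.mem_span_singleton.2 ⟨c, ?_⟩
  change _ = universalRep (𝓗.quotientMap t)
  rw [h0, map_smul, map_one]

/-- The average of an element over the group is a scalar. -/
theorem Equivariant.IsInducedAction.slice_mem [CompactQuantumGroup A] {ρ : 𝓗.Equivariant A}
    {α : 𝓗.CuntzPimsner →⋆ₐ[ℂ] TensorReduced A 𝓗.CuntzPimsner} (hα : ρ.IsInducedAction α)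
    (hsimple : ∀ n, (ρ.rep n).IsSimple) (hiso : ∀ m n, m ≠ n → ¬ (ρ.rep m).IsIso (ρ.rep n))
    (hno : 𝓗.AdmitsNormalOrdering) (a : 𝓗.CuntzPimsner) :
    slice (toL2 A 1) (toL2 A 1) (SpatialTensor.toOp (A := universalImage 𝓗.CuntzPimsner)
      (B := reducedAlgebra A) (α a)) ∈ Submodule.span ℂ {(1 :
        UniversalSpace 𝓗.CuntzPimsner →L[ℂ] UniversalSpace 𝓗.CuntzPimsner)} := by
  obtain ⟨αT, Q, ⟨U, hU, hUT⟩, hQ, h⟩ := hα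
  -- `F` is `(ι ⊗ h) ∘ α`. It is continuous and the scalars form a closed subspace, so normal
  -- ordering reduces the claim to monomials.
  let F : 𝓗.CuntzPimsner →ₗ[ℂ]
      (UniversalSpace 𝓗.CuntzPimsner →L[ℂ] UniversalSpace 𝓗.CuntzPimsner) :=
    (slice (toL2 A 1) (toL2 A 1)).toLinearMap ∘ₗ
      ((SpatialTensor.toOp (A := universalImage 𝓗.CuntzPimsner) (B := reducedAlgebra A)).comp
        α).toAlgHom.toLinearMap
  have hF : Continuous F := (slice (toL2 A 1) (toL2 A 1)).continuous.comp
    (continuous_starAlgHom ((SpatialTensor.toOp (A := universalImage 𝓗.CuntzPimsner)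
      (B := reducedAlgebra A)).comp α))
  have hcl : IsClosed (F ⁻¹' (Submodule.span ℂ {(1 : UniversalSpace 𝓗.CuntzPimsner →L[ℂ]
      UniversalSpace 𝓗.CuntzPimsner)} : Set _)) :=
    (Submodule.closed_of_finiteDimensional _).preimage hF
  refine hcl.closure_subset_iff.2 ?_ (hno a)
  change Submodule.span ℂ _ ≤ (Submodule.span ℂ _).comap F
  rw [Submodule.span_le]
  rintro _ ⟨ξ, ζ, rfl⟩
  obtain ⟨n, η, hη⟩ := exists_prod_s_eq ξ
  obtain ⟨m, θ, hθ⟩ := exists_prod_star_s_eq ζ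
  rw [hη, hθ, ← map_star, ← map_mul]
  -- Averaging commutes with the quotient map: the slice of `α(q T)` is the image of the slice of
  -- `αT T`.
  obtain ⟨t, ht, ht'⟩ := hQ.sliceRelated (αT (shift n η * star (shift m θ))) (toL2 A 1) (toL2 A 1)
  change slice (toL2 A 1) (toL2 A 1) (SpatialTensor.toOp (A := universalImage 𝓗.CuntzPimsner)
      (B := reducedAlgebra A) (α (𝓗.quotientMap _))) ∈ Submodule.span ℂ _
  rw [h, ← ht']
  refine quotientRep_mem_span_one ?_
  rw [ht, hUT]
  exact hU.slice_conj_mem hsimple hiso η θ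

/-- Averaging a fixed element returns it, since `h 1 = 1`, and averages are scalars; faithfulness of
the universal representation brings the equality back to the algebra. -/
theorem Equivariant.IsInducedAction.isErgodic [CompactQuantumGroup A] {ρ : 𝓗.Equivariant A}
    {α : 𝓗.CuntzPimsner →⋆ₐ[ℂ] TensorReduced A 𝓗.CuntzPimsner} (hα : ρ.IsInducedAction α)
    (hsimple : ∀ n, (ρ.rep n).IsSimple) (hiso : ∀ m n, m ≠ n → ¬ (ρ.rep m).IsIso (ρ.rep n))
    (hno : 𝓗.AdmitsNormalOrdering) : IsErgodic α := by
  refine Set.Subset.antisymm (fun a ha => ?_) ?_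
  · have h1 := hα.slice_mem hsimple hiso hno a
    have h2 : slice (toL2 A 1) (toL2 A 1) (SpatialTensor.toOp (A := universalImage 𝓗.CuntzPimsner)
        (B := reducedAlgebra A) (α a)) = universalRep a := by
      have h3 : α a = tmulReduced a 1 := ha
      rw [h3]
      refine (slice_opTensor (toL2 A 1) (toL2 A 1) (universalRep a) (1 : L2 A →L[ℂ] L2 A)).trans ?_
      have h4 := inner_toL2_one_regularRep (1 : A)
      rw [map_one (regularRep A), (isHaarState_haarState A).map_one] at h4
      rw [h4, one_smul]
    rw [h2] at h1
    obtain ⟨c, hc⟩ := Submodule.mem_span_singleton.1 h1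
    refine ⟨c, universalRep_injective ?_⟩
    rw [← hc, AlgHomClass.commutes, Algebra.algebraMap_eq_smul_one]
  · rintro _ ⟨c, rfl⟩
    change α _ = tmulReduced _ 1
    rw [AlgHomClass.commutes]
    have h1 : universalRep (algebraMap ℂ 𝓗.CuntzPimsner c) = c • 1 := by
      rw [AlgHomClass.commutes, Algebra.algebraMap_eq_smul_one]
    refine Subtype.ext (Eq.trans (b := c • 1) ((AlgHomClass.commutes (SpatialTensor.toOp
      (A := universalImage 𝓗.CuntzPimsner) (B := reducedAlgebra A)) c).trans
        (Algebra.algebraMap_eq_smul_one c)) ?_)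
    change c • 1 = opTensor (universalRep (algebraMap ℂ 𝓗.CuntzPimsner c)) 1
    rw [h1, opTensor_smul_left, opTensor_one]

end SubproductSystem

end
end CQG

theorem mainTheorem6 {A : Type*} [Ring A] [StarRing A] [HopfAlgebra ℂ A] [StarModule ℂ A]
    [CQG.CompactQuantumGroup A] (𝓗 : CQG.SubproductSystem) (ρ : 𝓗.Equivariant A)
    (hsimple : ∀ n, (ρ.rep n).IsSimple)
    (hiso : ∀ m n, m ≠ n → ¬ (ρ.rep m).IsIso (ρ.rep n))
    (hno : 𝓗.AdmitsNormalOrdering) :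
    (∃! α, ρ.IsInducedAction α) ∧ ∀ α, ρ.IsInducedAction α → CQG.IsErgodic α := by
  obtain ⟨α, hα⟩ := ρ.exists_isInducedAction
  exact ⟨⟨α, hα, fun β hβ => hβ.unique hα⟩, fun β hβ => hβ.isErgodic hsimple hiso hno⟩
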